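/- Let $\Bbbk$ be a commutative ring and $n\ge 0$. **The category $\Omega_n^{epi}$.** An object is a sequence $\underline\tau=(t_0\xrightarrow{\tau_1}t_1\to\cdots\xrightarrow{\tau_n}t_n)$ of non-decreasing surjections between ordered sets $t_i=\{1<\dots<t_i\}$ with $t_n=1$ (a planar tree with $n$ levels). A morphism $u:\underline\tau\to\underline\sigma$ is a sequence of surjections $u:t_i\to s_i$ commuting with the structure maps and non-decreasing on each fibre $\tau_{i+1}^{-1}(x)$. Put $\deg\underline\tau=t_0+\dots+t_{n-1}$ and $\deg u=\deg\underline\tau-\deg\underline\sigma$. We also write $\Omega_n^{epi}$ for the dg-category, concentrated in degree $0$, with the same objects and with hom-modules $\bigoplus_{u:\underline\tau\to\underline\sigma}\Bbbk\{u\}$. **Signs.** A morphism $u$ of degree $1$ merges exactly two vertices of level $<n$ of $\underline\tau$. Attach a symbol of degree $1$ to each vertex of level $<n$, and order these symbols by running over the tree depth first, from the root upwards and from left to right. Then $\operatorname{sgn}(u)$ is the product of the Koszul sign of the permutation which moves the two merged vertices of $\underline\tau$ to the front (keeping their relative order) and of the Koszul sign of the permutation which puts the sequence formed by the merged vertex followed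 by the other vertices in the order given by $\underline\sigma$. **The Koszul cocategory.** $K=K(\Omega_n^{epi})$ has $K(\underline\tau,\underline\sigma)=\bigoplus_{u:\underline\tau\to\underline\sigma}\Bbbk\{u\}$ with $\{u\}$ in degree $\deg u$, zero differential, diagonal $\Delta\{u\}=\sum_{u=vw}\{v\}\otimes\{w\}$, and augmentation $\{\mathrm{id}\}\mapsto 1$. It is a connected dg-cocategory. Let $\widetilde K(\underline\tau,\underline\sigma)$ be $0$ if $\underline\tau=\underline\sigma$ and $K(\underline\tau,\underline\sigma)$ otherwise. **The cobar construction.** $B^c(K)=(\mathrm{Free}(\Sigma^{-1}\widetilde K),\partial)$ is the free dg-category on the desuspension $\Sigma^{-1}\widetilde K$, whose differential is the internal one plus the derivation $\partial$ determined by $\partial\{u\}=\sum_{u=vw}(-1)^{\deg v}\{v\}\otimes\{w\}$, the sum being over the factorizations of $u$ with $v,w\neq\mathrm{id}$. **Theorem.** The dg-category $\mathrm{Res}(\Omega_n^{epi})=B^c(K(\Omega_n^{epi}))$ is a minimal quasi-free model of $\Omega_n^{epi}$ in the category of dg-categories with object set $\mathrm{Ob}\,\Omega_n^{epi}$ (and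 functors that are the identity on objects): 1. it is quasi-free, i.e. obtained from a free dg-category by adding a twisting derivation to its differential; 2. there is a morphism of dg-categories $\epsilon:B^c(K(\Omega_n^{epi}))\to\Omega_n^{epi}$ given on the generators ($u\ne\mathrm{id}$) by $\epsilon\{u\}=\operatorname{sgn}(u)\{u\}$ if $\deg u=1$ and $\epsilon\{u\}=0$ otherwise, and $\epsilon$ is a weak equivalence, i.e. it induces an isomorphism in homology on the hom dg-module of every pair of objects; 3. it is minimal: the internal differential of the dg-graph of generators $\Sigma^{-1}\widetilde K(\Omega_n^{epi})$ is zero, and $\partial$ maps every generator to a decomposable element (a linear combination of composites of at least two generators). -/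

import Mathlib

open CategoryTheory
open scoped TensorProduct

universe u

namespace PrunedTree

noncomputable section

/-! ## Dg-graphs

A dg-module over `k` is a `ℤ`-graded chain complex of `k`-modules (differential of degree `-1`).
A dg-graph on a set `X` is a collection of dg-modules `Γ b a`, indexed by pairs `(b, a)`, with `b`
the source and `a` the target. -/

/-- The sign `(-1) ^ i`. -/
def eps (i : ℤ) : ℤ := (i.negOnePow : ℤ)

theorem eps_zero : eps 0 = 1 := by simp [eps]

theorem eps_add (i j : ℤ) : eps (i + j) = eps i * eps j := by
  simp [eps, Int.negOnePow_add]

theorem eps_mul_self (i : ℤ) : eps i * eps i = 1 := by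
  rw [← eps_add, eps, Int.negOnePow_even _ (Even.add_self i)]; rfl

theorem eps_sub_one (i : ℤ) : eps (i - 1) = - eps i := by
  simp [eps, Int.negOnePow_sub]

/-- Dg-graphs on the set of objects `X`. -/
abbrev DGGraph (k : Type u) [CommRing k] (X : Type) :=
  X → X → ChainComplex (ModuleCat.{u} k) ℤ

section Graph

variable {k : Type u} [CommRing k] {X : Type}

theorem d_d_apply (C : ChainComplex (ModuleCat.{u} k) ℤ) (i j l : ℤ) (x : C.X i) :
    (C.d j l).hom ((C.d i j).hom x) = 0 := by
  rw [← ModuleCat.comp_apply, HomologicalComplex.d_comp_d]; rfl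

/-- The total module of a dg-graph: the direct sum of all the components `Γ b a` in all degrees. -/
abbrev Tot (Γ : DGGraph k X) : Type u :=
  DirectSum (ℤ × X × X) fun p => (Γ p.2.1 p.2.2).X p.1

open Classical in
/-- Inclusion of the degree `i` part of `Γ b a` in the total module. -/
def incl (Γ : DGGraph k X) (i : ℤ) (b a : X) : (Γ b a).X i →ₗ[k] Tot Γ :=
  DirectSum.lof k (ℤ × X × X) (fun p => (Γ p.2.1 p.2.2).X p.1) (i, b, a)

open Classical in
/-- A linear map on the total module given by its components. -/
def totLift {Γ : DGGraph k X} {N : Type*} [AddCommGroup N] [Module k N]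
    (f : ∀ (i : ℤ) (b a : X), (Γ b a).X i →ₗ[k] N) : Tot Γ →ₗ[k] N :=
  DirectSum.toModule k (ℤ × X × X) N fun p => f p.1 p.2.1 p.2.2

theorem totLift_incl {Γ : DGGraph k X} {N : Type*} [AddCommGroup N] [Module k N]
    (f : ∀ (i : ℤ) (b a : X), (Γ b a).X i →ₗ[k] N) (i : ℤ) (b a : X) (x : (Γ b a).X i) :
    totLift f (incl Γ i b a x) = f i b a x := by
  classical
  unfold totLift incl
  exact DirectSum.toModule_lof k (M := fun p : ℤ × X × X => (Γ p.2.1 p.2.2).X p.1) (i, b, a) x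

theorem tot_ext {Γ : DGGraph k X} {N : Type*} [AddCommGroup N] [Module k N]
    {f g : Tot Γ →ₗ[k] N} (h : ∀ i b a x, f (incl Γ i b a x) = g (incl Γ i b a x)) : f = g := by
  classical
  refine DirectSum.linearMap_ext k fun p => LinearMap.ext fun x => ?_
  exact h p.1 p.2.1 p.2.2 x

/-- The differential of a dg-graph on the total module. -/
def totD (Γ : DGGraph k X) : Tot Γ →ₗ[k] Tot Γ :=
  totLift fun i b a => incl Γ (i - 1) b a ∘ₗ ((Γ b a).d i (i - 1)).hom

/-- The operator `γ ↦ (-1) ^ deg γ • γ` on the total module. -/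
def totSign (Γ : DGGraph k X) : Tot Γ →ₗ[k] Tot Γ :=
  totLift fun i b a => eps i • incl Γ i b a

theorem totD_incl (Γ : DGGraph k X) (i : ℤ) (b a : X) (x : (Γ b a).X i) :
    totD Γ (incl Γ i b a x) = incl Γ (i - 1) b a (((Γ b a).d i (i - 1)).hom x) := by
  simp [totD, totLift_incl]

theorem totD_incl' (Γ : DGGraph k X) {i j : ℤ} (h : j + 1 = i) (b a : X) (x : (Γ b a).X i) :
    totD Γ (incl Γ i b a x) = incl Γ j b a (((Γ b a).d i j).hom x) := by
  obtain rfl : j = i - 1 := by lia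
  exact totD_incl Γ i b a x

theorem totSign_incl (Γ : DGGraph k X) (i : ℤ) (b a : X) (x : (Γ b a).X i) :
    totSign Γ (incl Γ i b a x) = eps i • incl Γ i b a x := by
  simp [totSign, totLift_incl]

theorem totSign_totSign (Γ : DGGraph k X) (z : Tot Γ) : totSign Γ (totSign Γ z) = z := by
  suffices h : totSign Γ ∘ₗ totSign Γ = LinearMap.id from LinearMap.congr_fun h z
  refine tot_ext fun i b a x => ?_
  rw [LinearMap.comp_apply, totSign_incl, map_zsmul, totSign_incl, smul_smul, eps_mul_self,
    one_smul, LinearMap.id_apply]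

theorem totD_totSign (Γ : DGGraph k X) (z : Tot Γ) :
    totD Γ (totSign Γ z) = - totSign Γ (totD Γ z) := by
  suffices h : totD Γ ∘ₗ totSign Γ = - (totSign Γ ∘ₗ totD Γ) from LinearMap.congr_fun h z
  refine tot_ext fun i b a x => ?_
  rw [LinearMap.comp_apply, LinearMap.neg_apply, LinearMap.comp_apply, totSign_incl, map_zsmul,
    totD_incl, totSign_incl, eps_sub_one, neg_smul, neg_neg]

theorem totD_totD (Γ : DGGraph k X) (z : Tot Γ) : totD Γ (totD Γ z) = 0 := by
  suffices h : totD Γ ∘ₗ totD Γ = 0 from LinearMap.congr_fun h z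
  refine tot_ext fun i b a x => ?_
  rw [LinearMap.comp_apply, totD_incl, totD_incl, d_d_apply, map_zero, LinearMap.zero_apply]

end Graph

/-! ## Dg-categories with a fixed set of objects -/

/-- A dg-category with set of objects `X`.  The composition goes from
`Hom x a ⊗ Hom b x` to `Hom b a` and is a morphism of dg-modules. -/
structure DGCat (k : Type u) [CommRing k] (X : Type) where
  Hom : DGGraph k X
  comp : ∀ {b x a : X} {i j l : ℤ}, i + j = l →
    (Hom x a).X i →ₗ[k] (Hom b x).X j →ₗ[k] (Hom b a).X l
  one : ∀ x : X, (Hom x x).X 0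
  assoc : ∀ {b y x a : X} {i j l p q r : ℤ} (hp : i + j = p) (hr : p + l = r) (hq : j + l = q)
    (hr' : i + q = r) (f : (Hom x a).X i) (g : (Hom y x).X j) (h : (Hom b y).X l),
    comp hr (comp hp f g) h = comp hr' f (comp hq g h)
  one_comp : ∀ {b a : X} {i : ℤ} (f : (Hom b a).X i), comp (zero_add i) (one a) f = f
  comp_one : ∀ {b a : X} {i : ℤ} (f : (Hom b a).X i), comp (add_zero i) f (one b) = f
  d_one : ∀ x : X, ((Hom x x).d 0 (0 - 1)).hom (one x) = 0
  d_comp : ∀ {b x a : X} {i j l : ℤ} (h : i + j = l) (f : (Hom x a).X i) (g : (Hom b x).X j),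
    ((Hom b a).d l (l - 1)).hom (comp h f g) =
      comp (show i - 1 + j = l - 1 by lia) (((Hom x a).d i (i - 1)).hom f) g +
        eps i • comp (show i + (j - 1) = l - 1 by lia) f (((Hom b x).d j (j - 1)).hom g)

/-- A morphism of dg-categories with the same set of objects (identity on objects). -/
structure DGFunctor {k : Type u} [CommRing k] {X : Type} (Φ Ψ : DGCat k X) where
  map : ∀ b a : X, Φ.Hom b a ⟶ Ψ.Hom b a
  map_one : ∀ x : X, ((map x x).f 0).hom (Φ.one x) = Ψ.one x
  map_comp : ∀ {b x a : X} {i j l : ℤ} (h : i + j = l) (f : (Φ.Hom x a).X i)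
    (g : (Φ.Hom b x).X j),
    ((map b a).f l).hom (Φ.comp h f g) =
      Ψ.comp h (((map x a).f i).hom f) (((map b x).f j).hom g)

/-- A weak equivalence of dg-categories: every map on hom dg-modules induces an isomorphism
in homology. -/
def DGFunctor.IsWeakEquivalence {k : Type u} [CommRing k] {X : Type} {Φ Ψ : DGCat k X}
    (F : DGFunctor Φ Ψ) : Prop :=
  ∀ b a : X, QuasiIso (F.map b a)

/-- A twisting derivation of a dg-category `Θ`: a derivation `∂` of degree `-1` such that
`δ ∂ + ∂ δ + ∂ ∂ = 0`, with `δ` the differential of `Θ`. -/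
structure TwistingDerivation {k : Type u} [CommRing k] {X : Type} (Θ : DGCat k X) where
  map : ∀ (b a : X) (i j : ℤ), (Θ.Hom b a).X i ⟶ (Θ.Hom b a).X j
  shape : ∀ (b a : X) (i j : ℤ), j + 1 ≠ i → map b a i j = 0
  twist : ∀ (b a : X) (i j l : ℤ),
    map b a i j ≫ (Θ.Hom b a).d j l + (Θ.Hom b a).d i j ≫ map b a j l +
      map b a i j ≫ map b a j l = 0
  derivation : ∀ {b x a : X} {i j l : ℤ} (h : i + j = l) (f : (Θ.Hom x a).X i)
    (g : (Θ.Hom b x).X j),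
    (map b a l (l - 1)).hom (Θ.comp h f g) =
      Θ.comp (show i - 1 + j = l - 1 by lia) ((map x a i (i - 1)).hom f) g +
        eps i • Θ.comp (show i + (j - 1) = l - 1 by lia) f ((map b x j (j - 1)).hom g)

section Twist

variable {k : Type u} [CommRing k] {X : Type}

/-- A twisting derivation kills the identities. -/
theorem TwistingDerivation.map_one {Θ : DGCat k X} (D : TwistingDerivation Θ) (x : X) :
    (D.map x x 0 (0 - 1)).hom (Θ.one x) = 0 := by
  have h := D.derivation (zero_add (0 : ℤ)) (Θ.one x) (Θ.one x)
  rw [Θ.one_comp] at h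
  have h1 := Θ.comp_one ((D.map x x 0 (0 - 1)).hom (Θ.one x))
  have h2 := Θ.one_comp ((D.map x x 0 (0 - 1)).hom (Θ.one x))
  rw [h1, h2, eps_zero, one_smul] at h
  simpa using h

/-- The dg-graph underlying the twisted dg-category `(Θ, ∂)`: the differential is `δ + ∂`. -/
def DGCat.twistHom (Θ : DGCat k X) (D : TwistingDerivation Θ) : DGGraph k X := fun b a =>
  { X := (Θ.Hom b a).X
    d := fun i j => (Θ.Hom b a).d i j + D.map b a i j
    shape := fun i j h => by
      rw [(Θ.Hom b a).shape i j h, D.shape b a i j h, add_zero]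
    d_comp_d' := fun i j l _ _ => by
      have h := D.twist b a i j l
      rw [Preadditive.add_comp, Preadditive.comp_add, Preadditive.comp_add,
        HomologicalComplex.d_comp_d, zero_add, ← h]
      abel }

theorem DGCat.twist_d_comp (Θ : DGCat k X) (D : TwistingDerivation Θ) {b x a : X} {i j l : ℤ}
    (h : i + j = l) (f : (Θ.Hom x a).X i) (g : (Θ.Hom b x).X j) :
    ((Θ.Hom b a).d l (l - 1)).hom (Θ.comp h f g) + (D.map b a l (l - 1)).hom (Θ.comp h f g) =
      Θ.comp (show i - 1 + j = l - 1 by lia)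
        (((Θ.Hom x a).d i (i - 1)).hom f + (D.map x a i (i - 1)).hom f) g +
      eps i • Θ.comp (show i + (j - 1) = l - 1 by lia) f
        (((Θ.Hom b x).d j (j - 1)).hom g + (D.map b x j (j - 1)).hom g) := by
  rw [Θ.d_comp h f g, D.derivation h f g, map_add, map_add, LinearMap.add_apply, smul_add]
  abel

/-- The twisted dg-category `(Θ, ∂)`, with differential `δ + ∂`. -/
def DGCat.twist (Θ : DGCat k X) (D : TwistingDerivation Θ) : DGCat k X where
  Hom := Θ.twistHom D
  comp {b x a i j l} h := Θ.comp (b := b) (x := x) (a := a) (i := i) (j := j) (l := l) h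
  one x := Θ.one x
  assoc hp hr hq hr' f g h := Θ.assoc hp hr hq hr' f g h
  one_comp f := Θ.one_comp f
  comp_one f := Θ.comp_one f
  d_one x := (congrArg₂ (· + ·) (Θ.d_one x) (D.map_one x)).trans (add_zero _)
  d_comp h f g := Θ.twist_d_comp D h f g

end Twist

/-! ## Free dg-categories -/

section Free

variable {k : Type u} [CommRing k] {X : Type} (Γ : DGGraph k X)

/-- The tensor algebra on the total module of a dg-graph. -/
abbrev TensorAlg : Type u := TensorAlgebra k (Tot Γ)

/-- The elements of `Γ b a` as elements of the tensor algebra. -/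
def gen (i : ℤ) (b a : X) : (Γ b a).X i →ₗ[k] TensorAlg Γ :=
  TensorAlgebra.ι k ∘ₗ incl Γ i b a

/-- `Word Γ m d b a w`: `w` is a tensor `γ₁ ⊗ ⋯ ⊗ γₘ` of `m` composable homogeneous elements
`γ₁ ∈ Γ x₁ a`, `γ₂ ∈ Γ x₂ x₁`, …, `γₘ ∈ Γ b xₘ₋₁`, of total degree `d`. -/
inductive Word : ℕ → ℤ → X → X → TensorAlg Γ → Prop
  | nil (x : X) : Word 0 0 x x 1
  | cons {m : ℕ} {i j d : ℤ} {b x a : X} (h : i + j = d) (γ : (Γ x a).X i) {w : TensorAlg Γ}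
      (hw : Word m j b x w) : Word (m + 1) d b a (gen Γ i x a γ * w)

/-- The degree `d` part of the hom dg-module from `b` to `a` of the free dg-category:
the direct sum of the tensor products `Γ x₁ a ⊗ Γ x₂ x₁ ⊗ ⋯ ⊗ Γ b xₘ₋₁`, which is the span of the
composable tensors in the tensor algebra of the total module. -/
def freeHom (d : ℤ) (b a : X) : Submodule k (TensorAlg Γ) :=
  Submodule.span k {w | ∃ m, Word Γ m d b a w}

/-- The decomposable elements of the free dg-category: the span of the composable tensors of
order `m ≥ 2`. -/
def decHom (d : ℤ) (b a : X) : Submodule k (TensorAlg Γ) :=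
  Submodule.span k {w | ∃ m, 2 ≤ m ∧ Word Γ m d b a w}

variable {Γ}

theorem Word.mem {m : ℕ} {d : ℤ} {b a : X} {w : TensorAlg Γ} (h : Word Γ m d b a w) :
    w ∈ freeHom Γ d b a := Submodule.subset_span ⟨m, h⟩

theorem Word.mul {m : ℕ} {i : ℤ} {x a : X} {v : TensorAlg Γ} (hv : Word Γ m i x a v) :
    ∀ {m' : ℕ} {j l : ℤ} {b : X} {w : TensorAlg Γ}, i + j = l → Word Γ m' j b x w →
      Word Γ (m + m') l b a (v * w) := by
  induction hv with
  | nil x =>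
    intro m' j l b w h hw
    obtain rfl : j = l := by lia
    simpa using hw
  | cons h γ _ ih =>
    intro m' j l b w h' hw
    rw [mul_assoc, Nat.succ_add_eq_add_succ, Nat.add_succ]
    exact Word.cons (by lia) γ (ih rfl hw)

theorem freeHom_mul {i j l : ℤ} (h : i + j = l) {b x a : X} {s t : TensorAlg Γ}
    (hs : s ∈ freeHom Γ i x a) (ht : t ∈ freeHom Γ j b x) : s * t ∈ freeHom Γ l b a := by
  have h1 := Submodule.mul_mem_mul hs ht
  rw [freeHom, freeHom, Submodule.span_mul_span] at h1
  refine Submodule.span_le.2 ?_ h1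
  rintro _ ⟨v, ⟨m, hv⟩, w, ⟨m', hw⟩, rfl⟩
  exact (hv.mul h hw).mem

theorem one_mem_freeHom (x : X) : (1 : TensorAlg Γ) ∈ freeHom Γ 0 x x := (Word.nil x).mem

theorem Word.single {i : ℤ} {b a : X} (γ : (Γ b a).X i) : Word Γ 1 i b a (gen Γ i b a γ) := by
  have := Word.cons (add_zero i) γ (Word.nil b)
  rwa [mul_one] at this

theorem gen_mem {i : ℤ} {b a : X} (γ : (Γ b a).X i) : gen Γ i b a γ ∈ freeHom Γ i b a :=
  (Word.single γ).mem

/-- The sign operator `t ↦ (-1) ^ deg t • t` on the tensor algebra. -/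
def signAlg (Γ : DGGraph k X) : TensorAlg Γ →ₐ[k] TensorAlg Γ :=
  TensorAlgebra.lift k (TensorAlgebra.ι k ∘ₗ totSign Γ)

theorem signAlg_gen {i : ℤ} {b a : X} (γ : (Γ b a).X i) :
    signAlg Γ (gen Γ i b a γ) = eps i • gen Γ i b a γ := by
  simp [signAlg, gen, totSign_incl]

theorem signAlg_freeHom {d : ℤ} {b a : X} {t : TensorAlg Γ} (ht : t ∈ freeHom Γ d b a) :
    signAlg Γ t = eps d • t := by
  induction ht using Submodule.span_induction with
  | mem w hw =>
    obtain ⟨m, hw⟩ := hw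
    induction hw with
    | nil x => simp [eps_zero]
    | cons h γ _ ih =>
      rw [map_mul, ih, signAlg_gen, ← h, eps_add, smul_mul_smul_comm]
  | zero => simp
  | add s t _ _ hs ht => simp [hs, ht]
  | smul c t _ ht => rw [map_smul, ht, smul_comm]

/-- Auxiliary algebra map `t ↦ !![± t, ∂ t; 0, t]`, for `∂` the derivation extending `f`. -/
def derAlg (f : Tot Γ →ₗ[k] TensorAlg Γ) :
    TensorAlg Γ →ₐ[k] Matrix (Fin 2) (Fin 2) (TensorAlg Γ) :=
  TensorAlgebra.lift k
    { toFun := fun m => !![TensorAlgebra.ι k (totSign Γ m), f m; 0, TensorAlgebra.ι k m]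
      map_add' := fun x y => by
        ext i j; fin_cases i <;> fin_cases j <;> simp
      map_smul' := fun c x => by
        ext i j; fin_cases i <;> fin_cases j <;> simp }

/-- The derivation of the tensor algebra (with the signs of graded algebra) extending a map `f`
defined on generators. -/
def der (f : Tot Γ →ₗ[k] TensorAlg Γ) : TensorAlg Γ →ₗ[k] TensorAlg Γ where
  toFun t := derAlg f t 0 1
  map_add' s t := by simp
  map_smul' c t := by simp

theorem derAlg_eq (f : Tot Γ →ₗ[k] TensorAlg Γ) (t : TensorAlg Γ) :
    derAlg f t = !![signAlg Γ t, der f t; 0, t] := by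
  suffices h : derAlg f t 0 0 = signAlg Γ t ∧ derAlg f t 1 0 = 0 ∧ derAlg f t 1 1 = t by
    ext i j; fin_cases i <;> fin_cases j
    · exact h.1
    · rfl
    · exact h.2.1
    · exact h.2.2
  induction t using TensorAlgebra.induction with
  | algebraMap r => simp [Matrix.algebraMap_matrix_apply]
  | ι x => simp [derAlg, signAlg]
  | mul a b ha hb => simp [Matrix.mul_apply, Fin.sum_univ_two, ha, hb]
  | add a b ha hb => simp [ha, hb]

theorem der_ι (f : Tot Γ →ₗ[k] TensorAlg Γ) (x : Tot Γ) : der f (TensorAlgebra.ι k x) = f x := by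
  simp [der, derAlg]

theorem der_gen (f : Tot Γ →ₗ[k] TensorAlg Γ) {i : ℤ} {b a : X} (γ : (Γ b a).X i) :
    der f (gen Γ i b a γ) = f (incl Γ i b a γ) := der_ι f _

theorem der_one (f : Tot Γ →ₗ[k] TensorAlg Γ) : der f 1 = 0 := by
  simp [der]

theorem der_mul (f : Tot Γ →ₗ[k] TensorAlg Γ) (s t : TensorAlg Γ) :
    der f (s * t) = der f s * t + signAlg Γ s * der f t := by
  have h := congrFun (congrFun (map_mul (derAlg f) s t) 0) 1
  rw [derAlg_eq f s, derAlg_eq f t, derAlg_eq f (s * t)] at h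
  simp only [Matrix.mul_apply, Fin.sum_univ_two] at h
  simpa [add_comm] using h

/-- `f` has degree `-1` and preserves sources and targets. -/
def IsDegNegOne (f : Tot Γ →ₗ[k] TensorAlg Γ) : Prop :=
  ∀ (i : ℤ) (b a : X) (γ : (Γ b a).X i), f (incl Γ i b a γ) ∈ freeHom Γ (i - 1) b a

theorem der_mem {f : Tot Γ →ₗ[k] TensorAlg Γ} (hf : IsDegNegOne f) {d : ℤ} {b a : X}
    {t : TensorAlg Γ} (ht : t ∈ freeHom Γ d b a) : der f t ∈ freeHom Γ (d - 1) b a := by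
  induction ht using Submodule.span_induction with
  | mem w hw =>
    obtain ⟨m, hw⟩ := hw
    induction hw with
    | nil x => rw [der_one]; exact zero_mem _
    | cons h γ hw ih =>
      rw [der_mul, der_gen, signAlg_gen, smul_mul_assoc]
      exact add_mem (freeHom_mul (by lia) (hf _ _ _ γ) hw.mem)
        (zsmul_mem (freeHom_mul (by lia) (gen_mem γ) ih) _)
  | zero => rw [map_zero]; exact zero_mem _
  | add s t _ _ hs ht => rw [map_add]; exact add_mem hs ht
  | smul c t _ ht => rw [map_smul]; exact Submodule.smul_mem _ c ht

theorem der_der {f : Tot Γ →ₗ[k] TensorAlg Γ} (hf : IsDegNegOne f)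
    (h0 : ∀ (i : ℤ) (b a : X) (γ : (Γ b a).X i), der f (f (incl Γ i b a γ)) = 0) {d : ℤ} {b a : X}
    {t : TensorAlg Γ} (ht : t ∈ freeHom Γ d b a) : der f (der f t) = 0 := by
  induction ht using Submodule.span_induction with
  | mem w hw =>
    obtain ⟨m, hw⟩ := hw
    induction hw with
    | nil x => rw [der_one, map_zero]
    | @cons m i j d b x a h γ w hw ih =>
      rw [der_mul, der_gen, signAlg_gen, map_add, der_mul, h0, signAlg_freeHom (hf _ _ _ γ),
        smul_mul_assoc, smul_mul_assoc, map_zsmul, der_mul, ih, der_gen, signAlg_gen, eps_sub_one]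
      simp
  | zero => rw [map_zero, map_zero]
  | add s t _ _ hs ht => rw [map_add, map_add, hs, ht, add_zero]
  | smul c t _ ht => rw [map_smul, map_smul, ht, smul_zero]

theorem der_add (f g : Tot Γ →ₗ[k] TensorAlg Γ) {d : ℤ} {b a : X}
    {t : TensorAlg Γ} (ht : t ∈ freeHom Γ d b a) : der (f + g) t = der f t + der g t := by
  induction ht using Submodule.span_induction with
  | mem w hw =>
    obtain ⟨m, hw⟩ := hw
    induction hw with
    | nil x => simp [der_one]
    | cons h γ hw ih =>
      rw [der_mul, der_mul, der_mul, ih, der_gen, der_gen, der_gen, LinearMap.add_apply, add_mul,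
        mul_add]
      abel
  | zero => simp
  | add s t _ _ hs ht => rw [map_add, map_add, map_add, hs, ht]; abel
  | smul c t _ ht => rw [map_smul, map_smul, map_smul, ht, smul_add]

/-- The component from degree `i` to degree `j` of the derivation extending `f`. -/
def derHom {f : Tot Γ →ₗ[k] TensorAlg Γ} (hf : IsDegNegOne f) (b a : X) (i j : ℤ) :
    ModuleCat.of k (freeHom Γ i b a) ⟶ ModuleCat.of k (freeHom Γ j b a) :=
  if h : j + 1 = i then
    ModuleCat.ofHom ((der f).restrict fun t ht => by
      obtain rfl : j = i - 1 := by lia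
      exact der_mem hf ht)
  else 0

theorem derHom_apply {f : Tot Γ →ₗ[k] TensorAlg Γ} (hf : IsDegNegOne f) (b a : X) {i j : ℤ}
    (h : j + 1 = i) (t : freeHom Γ i b a) :
    (((derHom hf b a i j).hom t : freeHom Γ j b a) : TensorAlg Γ) = der f t := by
  simp [derHom, h]

theorem derHom_shape {f : Tot Γ →ₗ[k] TensorAlg Γ} (hf : IsDegNegOne f) (b a : X) {i j : ℤ}
    (h : j + 1 ≠ i) : derHom hf b a i j = 0 := by
  simp [derHom, h]

variable (Γ)

/-- The internal differential of `Γ`, as a map to the tensor algebra. -/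
def internalD : Tot Γ →ₗ[k] TensorAlg Γ := TensorAlgebra.ι k ∘ₗ totD Γ

theorem internalD_incl {i : ℤ} {b a : X} (γ : (Γ b a).X i) :
    internalD Γ (incl Γ i b a γ) = gen Γ (i - 1) b a (((Γ b a).d i (i - 1)).hom γ) := by
  simp [internalD, gen, totD_incl]

theorem internalD_deg : IsDegNegOne (internalD Γ) := fun i b a γ => by
  rw [internalD_incl]; exact gen_mem _

theorem internalD_sq {d : ℤ} {b a : X} {t : TensorAlg Γ} (ht : t ∈ freeHom Γ d b a) :
    der (internalD Γ) (der (internalD Γ) t) = 0 :=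
  der_der (internalD_deg Γ) (fun i b a γ => by
    rw [internalD_incl, der_gen, internalD_incl, d_d_apply, map_zero]) ht

/-- The hom dg-modules of the free dg-category. -/
def freeGraph : DGGraph k X := fun b a =>
  { X := fun d => ModuleCat.of k (freeHom Γ d b a)
    d := fun i j => derHom (internalD_deg Γ) b a i j
    shape := fun _ _ h => derHom_shape _ b a h
    d_comp_d' := fun i j l hij hjl => by
      ext t
      have h1 : j + 1 = i := hij
      have h2 : l + 1 = j := hjl
      rw [ModuleCat.comp_apply, derHom_apply _ b a h2, derHom_apply _ b a h1]
      exact internalD_sq Γ t.2 }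

/-- Composition in the free dg-category: concatenation of tensors. -/
def freeComp {b x a : X} {i j l : ℤ} (h : i + j = l) :
    freeHom Γ i x a →ₗ[k] freeHom Γ j b x →ₗ[k] freeHom Γ l b a :=
  LinearMap.mk₂ k (fun s t => ⟨s.1 * t.1, freeHom_mul h s.2 t.2⟩)
    (fun _ _ _ => Subtype.ext (add_mul _ _ _))
    (fun _ _ _ => Subtype.ext (smul_mul_assoc _ _ _))
    (fun _ _ _ => Subtype.ext (mul_add _ _ _))
    (fun _ _ _ => Subtype.ext (mul_smul_comm _ _ _))

theorem freeComp_coe {b x a : X} {i j l : ℤ} (h : i + j = l) (s : freeHom Γ i x a)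
    (t : freeHom Γ j b x) : (freeComp Γ h s t : TensorAlg Γ) = s.1 * t.1 := rfl

theorem derHom_comp {f : Tot Γ →ₗ[k] TensorAlg Γ} (hf : IsDegNegOne f) {b x a : X} {i j l : ℤ}
    (h : i + j = l) (s : freeHom Γ i x a) (t : freeHom Γ j b x) :
    (derHom hf b a l (l - 1)).hom (freeComp Γ h s t) =
      freeComp Γ (show i - 1 + j = l - 1 by lia) ((derHom hf x a i (i - 1)).hom s) t +
        eps i • freeComp Γ (show i + (j - 1) = l - 1 by lia) s
          ((derHom hf b x j (j - 1)).hom t) := by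
  apply Subtype.ext
  rw [derHom_apply hf b a (by lia), freeComp_coe, der_mul, signAlg_freeHom s.2, smul_mul_assoc]
  change _ = (freeComp Γ _ _ _ : TensorAlg Γ) + eps i • (freeComp Γ _ _ _ : TensorAlg Γ)
  rw [freeComp_coe, freeComp_coe, derHom_apply hf x a (by lia), derHom_apply hf b x (by lia)]

/-- The free dg-category on a dg-graph. -/
def free : DGCat k X where
  Hom := freeGraph Γ
  comp h := freeComp Γ h
  one x := (⟨1, one_mem_freeHom x⟩ : freeHom Γ 0 x x)
  assoc _ _ _ _ _ _ _ := Subtype.ext (mul_assoc _ _ _)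
  one_comp _ := Subtype.ext (one_mul _)
  comp_one _ := Subtype.ext (mul_one _)
  d_one x := Subtype.ext ((derHom_apply (internalD_deg Γ) x x (by lia) _).trans (der_one _))
  d_comp h f g := derHom_comp Γ (internalD_deg Γ) h f g

/-- The inclusion of the generators `Γ` in the free dg-category. -/
def freeGen (i : ℤ) (b a : X) : (Γ b a).X i →ₗ[k] ((free Γ).Hom b a).X i :=
  (gen Γ i b a).codRestrict (freeHom Γ i b a) fun γ => gen_mem γ

/-- The submodule of decomposable elements of the free dg-category. -/
def Dec (i : ℤ) (b a : X) : Submodule k (((free Γ).Hom b a).X i) :=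
  (decHom Γ i b a).comap (freeHom Γ i b a).subtype

/-- The twisting derivation of the free dg-category given by a map on generators. -/
def freeTwist (f : Tot Γ →ₗ[k] TensorAlg Γ) (hf : IsDegNegOne f)
    (h0 : ∀ (i : ℤ) (b a : X) (γ : (Γ b a).X i),
      der (internalD Γ + f) ((internalD Γ + f) (incl Γ i b a γ)) = 0) :
    TwistingDerivation (free Γ) where
  map b a i j := derHom hf b a i j
  shape b a i j h := derHom_shape hf b a h
  twist b a i j l := by
    change derHom hf b a i j ≫ derHom (internalD_deg Γ) b a j l +
      derHom (internalD_deg Γ) b a i j ≫ derHom hf b a j l +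
      derHom hf b a i j ≫ derHom hf b a j l = 0
    by_cases h1 : j + 1 = i
    · by_cases h2 : l + 1 = j
      · ext t
        have hs : IsDegNegOne (internalD Γ + f) := fun i b a γ =>
          add_mem (internalD_deg Γ i b a γ) (hf i b a γ)
        have key := der_der hs h0 t.2
        have ht : (t : TensorAlg Γ) ∈ freeHom Γ i b a := t.2
        have e0 := internalD_sq Γ ht
        have m1 := der_mem hf ht
        have m2 := der_mem (internalD_deg Γ) ht
        rw [der_add _ _ ht, map_add, der_add _ _ m2, der_add _ _ m1, e0, zero_add] at key
        change ((derHom (internalD_deg Γ) b a j l).hom ((derHom hf b a i j).hom t) :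
            TensorAlg Γ) +
          ((derHom hf b a j l).hom ((derHom (internalD_deg Γ) b a i j).hom t) : TensorAlg Γ) +
          ((derHom hf b a j l).hom ((derHom hf b a i j).hom t) : TensorAlg Γ) = 0
        rw [derHom_apply _ b a h2, derHom_apply _ b a h2, derHom_apply _ b a h2,
          derHom_apply _ b a h1, derHom_apply _ b a h1, ← key]
        abel
      · simp [derHom_shape _ b a h2]
    · simp [derHom_shape _ b a h1]
  derivation h f g := derHom_comp Γ hf h f g

/-- The quasi-free dg-category `(Free Γ, ∂)`. -/
def quasiFree (D : TwistingDerivation (free Γ)) : DGCat k X := (free Γ).twist D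

end Free

/-- A dg-category is quasi-free if it is a twisted dg-category associated to a free
dg-category. -/
def IsQuasiFree {k : Type u} [CommRing k] {X : Type} (Θ : DGCat k X) : Prop :=
  ∃ (Γ : DGGraph k X) (D : TwistingDerivation (free Γ)), Θ = quasiFree Γ D

/-- Minimality of the quasi-free dg-category `(Free Γ, ∂)`: the internal differential of `Γ` is
trivial and `∂` maps the generators to decomposable elements. -/
def IsMinimal {k : Type u} [CommRing k] {X : Type} (Γ : DGGraph k X)
    (D : TwistingDerivation (free Γ)) : Prop :=
  (∀ (b a : X) (i j : ℤ), (Γ b a).d i j = 0) ∧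
    ∀ (b a : X) (i j : ℤ) (γ : (Γ b a).X i),
      (D.map b a i j).hom (freeGen Γ i b a γ) ∈ Dec Γ j b a

/-! ## Dg-cocategories and the cobar construction -/

section Cobar

variable {k : Type u} [CommRing k] {X : Type}

/-- The span, in the tensor square of the total module, of the degree `i` part of the direct sum
over `x` of the tensor products `Γ x a ⊗ Γ b x`. -/
def splitSpan (Γ : DGGraph k X) (i : ℤ) (b a : X) : Submodule k (Tot Γ ⊗[k] Tot Γ) :=
  Submodule.span k {t | ∃ (x : X) (p q : ℤ) (_ : p + q = i) (γ : (Γ x a).X p)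
    (γ' : (Γ b x).X q), t = incl Γ p x a γ ⊗ₜ[k] incl Γ q b x γ'}

/-- A dg-cocategory with set of objects `X`: a dg-graph `Γ` with a coassociative diagonal, of
components `Γ b a → ⨁ x, Γ x a ⊗ Γ b x`, and an augmentation, of components `Γ x x → k`,
satisfying the counit relations; both are morphisms of dg-modules.
The diagonal and the augmentation are gathered in a coalgebra structure on the total module. -/
structure DGCocat (k : Type u) [CommRing k] (X : Type) where
  graph : DGGraph k X
  coalg : Coalgebra k (Tot graph)
  comul_mem : ∀ (i : ℤ) (b a : X) (γ : (graph b a).X i),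
    coalg.comul (incl graph i b a γ) ∈ splitSpan graph i b a
  counit_eq_zero : ∀ (i : ℤ) (b a : X) (γ : (graph b a).X i), ¬ (i = 0 ∧ b = a) →
    coalg.counit (incl graph i b a γ) = 0
  comul_d : ∀ z : Tot graph, coalg.comul (totD graph z) =
    TensorProduct.map (totD graph) LinearMap.id (coalg.comul z) +
      TensorProduct.map (totSign graph) (totD graph) (coalg.comul z)
  counit_d : ∀ z : Tot graph, coalg.counit (totD graph z) = 0

/-- Connected dg-cocategories, with respect to a grading `deg` of the objects: the augmentation
identifies `Γ x x` with `k` (in degree `0`), and `Γ b a = 0` for `b ≠ a` with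
`deg b - deg a ≤ 0`. -/
structure DGCocat.IsConnected (Γ : DGCocat k X) (deg : X → ℕ) : Prop where
  eq_zero_of_ne : ∀ (x : X) (i : ℤ), i ≠ 0 → ∀ γ : (Γ.graph x x).X i, γ = 0
  counit_bijective : ∀ x : X,
    Function.Bijective fun γ : (Γ.graph x x).X 0 => Γ.coalg.counit (incl Γ.graph 0 x x γ)
  eq_zero_of_le : ∀ b a : X, b ≠ a → deg b ≤ deg a → ∀ (i : ℤ) (γ : (Γ.graph b a).X i), γ = 0

/-- The submodule of `(Γ b a)ᵢ` which is zero if `b = a` and everything otherwise. -/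
def reducedSub (Γ : DGGraph k X) (b a : X) (i : ℤ) : Submodule k ((Γ b a).X i) where
  carrier := {γ | b = a → γ = 0}
  zero_mem' := fun _ => rfl
  add_mem' := fun hx hy h => by rw [hx h, hy h, add_zero]
  smul_mem' := fun c x hx h => by rw [hx h, smul_zero]

/-- The reduced dg-graph: `0` if `b = a` and `Γ b a` otherwise. -/
def reduced (Γ : DGGraph k X) : DGGraph k X := fun b a =>
  { X := fun i => ModuleCat.of k (reducedSub Γ b a i)
    d := fun i j => ModuleCat.ofHom (((Γ b a).d i j).hom.restrict fun x hx h => by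
      rw [hx h, map_zero])
    shape := fun i j h => by
      ext x
      change ((Γ b a).d i j).hom x.1 = 0
      rw [(Γ b a).shape i j h]; rfl
    d_comp_d' := fun i j l _ _ => by
      ext x
      exact d_d_apply (Γ b a) i j l x.1 }

/-- The desuspension of a dg-module: `(Σ⁻¹ C)ᵢ = Cᵢ₊₁`, with differential `-δ`. -/
def desuspend (C : ChainComplex (ModuleCat.{u} k) ℤ) : ChainComplex (ModuleCat.{u} k) ℤ where
  X i := C.X (i + 1)
  d i j := - C.d (i + 1) (j + 1)
  shape i j h := by
    rw [C.shape, neg_zero]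
    intro h'
    apply h
    have : j + 1 + 1 = i + 1 := h'
    change j + 1 = i
    lia
  d_comp_d' i j l _ _ := by simp

/-- The dg-graph `Σ⁻¹ Γ~` of generators of the cobar construction, where `Γ~` is the reduced
dg-graph associated to `Γ`. -/
def cobarGraph (Γ : DGGraph k X) : DGGraph k X := fun b a => desuspend (reduced Γ b a)

open Classical in
/-- Projection of `Γ` to its reduced dg-graph. -/
def toReduced (Γ : DGGraph k X) (b a : X) {i j : ℤ} (h : i = j) :
    (Γ b a).X i →ₗ[k] reducedSub Γ b a j :=
  if hab : b = a then 0 else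
    LinearMap.codRestrict (reducedSub Γ b a j) ((Γ b a).XIsoOfEq h).hom.hom
      fun _ h' => absurd h' hab

/-- The map `γ ↦ σ⁻¹ γ~` from `Γ` to the generators of the cobar construction. -/
def toCobar (Γ : DGGraph k X) (b a : X) {i j : ℤ} (h : i = j + 1) :
    (Γ b a).X i →ₗ[k] (cobarGraph Γ b a).X j :=
  toReduced Γ b a h

/-- The inclusion `σ⁻¹ γ ↦ γ` of the reduced dg-graph in `Γ`. -/
def ofCobar (Γ : DGGraph k X) (b a : X) (j : ℤ) :
    (cobarGraph Γ b a).X j →ₗ[k] (Γ b a).X (j + 1) :=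
  (reducedSub Γ b a (j + 1)).subtype

theorem toCobar_ofCobar (Γ : DGGraph k X) {b a : X} {j : ℤ} (γ : (cobarGraph Γ b a).X j) :
    toCobar Γ b a rfl (ofCobar Γ b a j γ) = γ := by
  change toReduced Γ b a (rfl : j + 1 = j + 1) (show reducedSub Γ b a (j + 1) from γ).1 =
    (show reducedSub Γ b a (j + 1) from γ)
  generalize (show reducedSub Γ b a (j + 1) from γ) = γ
  apply Subtype.ext
  by_cases h : b = a
  · simp only [toReduced, h, dite_true]
    exact (γ.2 h).symm
  · simp [toReduced, h]

theorem ofCobar_toCobar (Γ : DGGraph k X) {b a : X} (hab : b ≠ a) {j : ℤ}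
    (γ : (Γ b a).X (j + 1)) : ofCobar Γ b a j (toCobar Γ b a rfl γ) = γ := by
  change (toReduced Γ b a (rfl : j + 1 = j + 1) γ).1 = γ
  simp [toReduced, hab]

theorem toCobar_self (Γ : DGGraph k X) {a : X} {i j : ℤ} (h : i = j + 1) (γ : (Γ a a).X i) :
    toCobar Γ a a h γ = 0 := by
  change toReduced Γ a a h γ = 0
  simp [toReduced]

theorem toCobar_d (Γ : DGGraph k X) {b a : X} (hab : b ≠ a) {i j : ℤ} (γ : (Γ b a).X (i + 1)) :
    ((cobarGraph Γ b a).d i j).hom (toCobar Γ b a rfl γ) =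
      - toCobar Γ b a rfl (((Γ b a).d (i + 1) (j + 1)).hom γ) := by
  have h : Function.Injective (ofCobar Γ b a j) := Subtype.val_injective
  apply h
  rw [map_neg, ofCobar_toCobar Γ hab]
  have h1 : ofCobar Γ b a j (((cobarGraph Γ b a).d i j).hom (toCobar Γ b a rfl γ)) =
    - ((Γ b a).d (i + 1) (j + 1)).hom (ofCobar Γ b a i (toCobar Γ b a rfl γ)) := rfl
  rw [h1, ofCobar_toCobar Γ hab]

/-- The desuspension `γ ↦ σ⁻¹ γ~`, from the total module of `Γ` to the tensor algebra of the
generators of the cobar construction. -/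
def redGen (Γ : DGGraph k X) : Tot Γ →ₗ[k] TensorAlg (cobarGraph Γ) :=
  totLift fun i b a =>
    gen (cobarGraph Γ) (i - 1) b a ∘ₗ toCobar Γ b a (show i = i - 1 + 1 by lia)

theorem redGen_incl (Γ : DGGraph k X) {b a : X} {i j : ℤ} (h : i = j + 1) (γ : (Γ b a).X i) :
    redGen Γ (incl Γ i b a γ) = gen (cobarGraph Γ) j b a (toCobar Γ b a h γ) := by
  obtain rfl : j = i - 1 := by lia
  rw [redGen, totLift_incl, LinearMap.comp_apply]

theorem redGen_self (Γ : DGGraph k X) {a : X} {i : ℤ} (γ : (Γ a a).X i) :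
    redGen Γ (incl Γ i a a γ) = 0 := by
  rw [redGen_incl Γ (show i = i - 1 + 1 by lia), toCobar_self, map_zero]

theorem redGen_mem (Γ : DGGraph k X) {b a : X} {i j : ℤ} (h : j + 1 = i) (γ : (Γ b a).X i) :
    redGen Γ (incl Γ i b a γ) ∈ freeHom (cobarGraph Γ) j b a := by
  rw [redGen_incl Γ h.symm]
  exact gen_mem _

theorem signAlg_redGen (Γ : DGGraph k X) (z : Tot Γ) :
    signAlg (cobarGraph Γ) (redGen Γ z) = - redGen Γ (totSign Γ z) := by
  suffices h : (signAlg (cobarGraph Γ)).toLinearMap ∘ₗ redGen Γ = - (redGen Γ ∘ₗ totSign Γ) from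
    LinearMap.congr_fun h z
  refine tot_ext fun i b a γ => ?_
  have h1 := signAlg_freeHom (redGen_mem Γ (show i - 1 + 1 = i by lia) γ)
  rw [LinearMap.comp_apply, LinearMap.neg_apply, LinearMap.comp_apply, totSign_incl, map_zsmul,
    AlgHom.toLinearMap_apply, h1, eps_sub_one, neg_smul]

/-- The map `γ ⊗ γ' ↦ (-1) ^ deg γ • σ⁻¹ γ~ ⊗ σ⁻¹ γ'~`. -/
def cobarQuad (Γ : DGGraph k X) : Tot Γ ⊗[k] Tot Γ →ₗ[k] TensorAlg (cobarGraph Γ) :=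
  TensorProduct.lift
    ((LinearMap.mul k (TensorAlg (cobarGraph Γ))).compl₁₂ (redGen Γ ∘ₗ totSign Γ) (redGen Γ))

theorem cobarQuad_tmul (Γ : DGGraph k X) (x y : Tot Γ) :
    cobarQuad Γ (x ⊗ₜ y) = redGen Γ (totSign Γ x) * redGen Γ y := by
  simp [cobarQuad]

/-- The twisting map of the cobar construction, on generators: the image of `σ⁻¹ γ` is the sum of
the tensors `(-1) ^ deg γ' • σ⁻¹ γ' ⊗ σ⁻¹ γ''`, where `γ' ⊗ γ''` runs over the terms of the
diagonal of `γ` (projected to the reduced dg-graph). -/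
def cobarMap (Γ : DGCocat k X) : Tot (cobarGraph Γ.graph) →ₗ[k] TensorAlg (cobarGraph Γ.graph) :=
  totLift fun j b a => cobarQuad Γ.graph ∘ₗ Γ.coalg.comul ∘ₗ
    incl Γ.graph (j + 1) b a ∘ₗ ofCobar Γ.graph b a j

theorem cobarMap_incl (Γ : DGCocat k X) {b a : X} {j : ℤ} (γ : (cobarGraph Γ.graph b a).X j) :
    cobarMap Γ (incl (cobarGraph Γ.graph) j b a γ) =
      cobarQuad Γ.graph (Γ.coalg.comul (incl Γ.graph (j + 1) b a (ofCobar Γ.graph b a j γ))) := by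
  rw [cobarMap, totLift_incl]; rfl

theorem cobarQuad_mem (Γ : DGGraph k X) {i j : ℤ} (h : j + 2 = i) {b a : X} {t : Tot Γ ⊗[k] Tot Γ}
    (ht : t ∈ splitSpan Γ i b a) : 
    cobarQuad Γ t ∈ freeHom (cobarGraph Γ) j b a := by
  induction ht using Submodule.span_induction with
  | mem t ht =>
    obtain ⟨x, p, q, hpq, γ, γ', rfl⟩ := ht
    rw [cobarQuad_tmul, totSign_incl, map_zsmul, smul_mul_assoc]
    exact zsmul_mem (freeHom_mul (show p - 1 + (q - 1) = j by lia)
      (redGen_mem Γ (by lia) γ) (redGen_mem Γ (by lia) γ')) _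
  | zero => rw [map_zero]; exact zero_mem _
  | add s t _ _ hs ht => rw [map_add]; exact add_mem hs ht
  | smul c t _ ht => rw [map_smul]; exact Submodule.smul_mem _ c ht

theorem cobarMap_deg (Γ : DGCocat k X) : IsDegNegOne (cobarMap Γ) := fun j b a γ => by
  rw [cobarMap_incl]
  exact cobarQuad_mem Γ.graph (by lia) (Γ.comul_mem _ _ _ _)

theorem cobarQuad_self {Γ : DGCocat k X} {deg : X → ℕ} (hΓ : Γ.IsConnected deg) {a : X} {i : ℤ}
    {t : Tot Γ.graph ⊗[k] Tot Γ.graph} (ht : t ∈ splitSpan Γ.graph i a a) :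
    cobarQuad Γ.graph t = 0 := by
  induction ht using Submodule.span_induction with
  | mem t ht =>
    obtain ⟨x, p, q, hpq, γ, γ', rfl⟩ := ht
    rw [cobarQuad_tmul, totSign_incl, map_zsmul, smul_mul_assoc]
    by_cases hx : x = a
    · subst hx
      rw [redGen_self, zero_mul, smul_zero]
    · rcases le_total (deg x) (deg a) with h | h
      · rw [hΓ.eq_zero_of_le x a hx h p γ]; simp
      · rw [hΓ.eq_zero_of_le a x (Ne.symm hx) h q γ']; simp
  | zero => rw [map_zero]
  | add s t _ _ hs ht => rw [map_add, hs, ht, add_zero]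
  | smul c t _ ht => rw [map_smul, ht, smul_zero]

/-- The total differential of the cobar construction on generators. -/
theorem der_redGen {Γ : DGCocat k X} {deg : X → ℕ} (hΓ : Γ.IsConnected deg) (z : Tot Γ.graph) :
    der (internalD (cobarGraph Γ.graph) + cobarMap Γ) (redGen Γ.graph z) =
      - redGen Γ.graph (totD Γ.graph z) + cobarQuad Γ.graph (Γ.coalg.comul z) := by
  suffices h : der (internalD (cobarGraph Γ.graph) + cobarMap Γ) ∘ₗ redGen Γ.graph =
      - (redGen Γ.graph ∘ₗ totD Γ.graph) + cobarQuad Γ.graph ∘ₗ Γ.coalg.comul from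
    LinearMap.congr_fun h z
  refine tot_ext fun i b a γ => ?_
  simp only [LinearMap.comp_apply, LinearMap.add_apply, LinearMap.neg_apply]
  obtain ⟨j, rfl⟩ : ∃ j, i = j + 1 := ⟨i - 1, by lia⟩
  by_cases hab : b = a
  · subst hab
    rw [redGen_self, totD_incl, redGen_self, cobarQuad_self hΓ (Γ.comul_mem _ _ _ _)]
    simp
  · rw [redGen_incl _ rfl, der_gen, LinearMap.add_apply, internalD_incl, cobarMap_incl,
      totD_incl' _ (show j - 1 + 1 + 1 = j + 1 by lia), redGen_incl _ rfl, ← map_neg,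
      ofCobar_toCobar _ hab, toCobar_d _ hab]

theorem comul_totSign (Γ : DGCocat k X) (z : Tot Γ.graph) :
    Γ.coalg.comul (totSign Γ.graph z) =
      TensorProduct.map (totSign Γ.graph) (totSign Γ.graph) (Γ.coalg.comul z) := by
  suffices h : Γ.coalg.comul ∘ₗ totSign Γ.graph =
      TensorProduct.map (totSign Γ.graph) (totSign Γ.graph) ∘ₗ Γ.coalg.comul from
    LinearMap.congr_fun h z
  refine tot_ext fun i b a γ => ?_
  rw [LinearMap.comp_apply, LinearMap.comp_apply, totSign_incl, map_zsmul]
  have h := Γ.comul_mem i b a γ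
  generalize Γ.coalg.comul (incl Γ.graph i b a γ) = t at h
  induction h using Submodule.span_induction with
  | mem t ht =>
    obtain ⟨x, p, q, hpq, γ, γ', rfl⟩ := ht
    rw [TensorProduct.map_tmul, totSign_incl, totSign_incl, ← hpq, eps_add,
      ← TensorProduct.smul_tmul', TensorProduct.tmul_smul, smul_smul]
  | zero => simp
  | add s t _ _ hs ht => rw [smul_add, hs, ht, map_add]
  | smul c t _ ht => rw [smul_comm, ht, map_smul]

/-- The map `γ ⊗ γ' ⊗ γ'' ↦ (-1) ^ deg γ' • σ⁻¹ γ~ ⊗ σ⁻¹ γ'~ ⊗ σ⁻¹ γ''~`. -/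
def cobarCubic (Γ : DGGraph k X) :
    Tot Γ ⊗[k] (Tot Γ ⊗[k] Tot Γ) →ₗ[k] TensorAlg (cobarGraph Γ) :=
  TensorProduct.lift
    ((LinearMap.mul k (TensorAlg (cobarGraph Γ))).compl₁₂ (redGen Γ) (cobarQuad Γ))

theorem cobarCubic_tmul (Γ : DGGraph k X) (x : Tot Γ) (t : Tot Γ ⊗[k] Tot Γ) :
    cobarCubic Γ (x ⊗ₜ t) = redGen Γ x * cobarQuad Γ t := by
  simp [cobarCubic]

theorem cobarCubic_assoc (Γ : DGGraph k X) (t : Tot Γ ⊗[k] Tot Γ) (y : Tot Γ) :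
    cobarCubic Γ (TensorProduct.assoc k _ _ _ (t ⊗ₜ y)) =
      cobarQuad Γ (TensorProduct.map (totSign Γ) (totSign Γ) t) * redGen Γ y := by
  induction t using TensorProduct.induction_on with
  | zero => simp
  | tmul u v =>
    rw [TensorProduct.assoc_tmul, cobarCubic_tmul, TensorProduct.map_tmul, cobarQuad_tmul,
      cobarQuad_tmul, totSign_totSign, mul_assoc]
  | add s t hs ht => rw [TensorProduct.add_tmul, map_add, map_add, hs, ht, map_add, map_add,
      add_mul]

theorem der_cobarQuad {Γ : DGCocat k X} {deg : X → ℕ} (hΓ : Γ.IsConnected deg)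
    (t : Tot Γ.graph ⊗[k] Tot Γ.graph) :
    der (internalD (cobarGraph Γ.graph) + cobarMap Γ) (cobarQuad Γ.graph t) =
      cobarQuad Γ.graph (TensorProduct.map (totD Γ.graph) LinearMap.id t +
        TensorProduct.map (totSign Γ.graph) (totD Γ.graph) t) +
      (cobarCubic Γ.graph
        (TensorProduct.assoc k _ _ _ (LinearMap.rTensor _ Γ.coalg.comul t)) -
        cobarCubic Γ.graph (LinearMap.lTensor _ Γ.coalg.comul t)) := by
  induction t using TensorProduct.induction_on with
  | zero => simp
  | tmul x y =>
    rw [cobarQuad_tmul, der_mul, signAlg_redGen, totSign_totSign, der_redGen hΓ, der_redGen hΓ,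
      LinearMap.rTensor_tmul, LinearMap.lTensor_tmul, cobarCubic_assoc, cobarCubic_tmul,
      TensorProduct.map_tmul, TensorProduct.map_tmul, map_add, cobarQuad_tmul, cobarQuad_tmul,
      totSign_totSign, comul_totSign, totD_totSign, LinearMap.id_apply, map_neg]
    noncomm_ring
  | add s t hs ht =>
    simp only [map_add] at hs ht ⊢
    rw [hs, ht]; abel

theorem der_cobar {Γ : DGCocat k X} {deg : X → ℕ} (hΓ : Γ.IsConnected deg) (j : ℤ) (b a : X)
    (γ : (cobarGraph Γ.graph b a).X j) :
    der (internalD (cobarGraph Γ.graph) + cobarMap Γ)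
      ((internalD (cobarGraph Γ.graph) + cobarMap Γ) (incl (cobarGraph Γ.graph) j b a γ)) = 0 := by
  rw [← der_gen, ← toCobar_ofCobar Γ.graph γ, ← redGen_incl Γ.graph rfl, der_redGen hΓ, map_add, map_neg, der_redGen hΓ, der_cobarQuad hΓ,
    totD_totD, ← Γ.comul_d]
  have h := LinearMap.congr_fun Γ.coalg.coassoc
    (incl Γ.graph (j + 1) b a (ofCobar Γ.graph b a j γ))
  simp only [LinearMap.comp_apply, LinearEquiv.coe_coe] at h
  rw [h]
  simp

/-- The twisting derivation of the cobar construction. -/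
def cobarTwist {Γ : DGCocat k X} {deg : X → ℕ} (hΓ : Γ.IsConnected deg) :
    TwistingDerivation (free (cobarGraph Γ.graph)) :=
  freeTwist (cobarGraph Γ.graph) (cobarMap Γ) (cobarMap_deg Γ) (der_cobar hΓ)

/-- The cobar construction `(Free (Σ⁻¹ Γ~), ∂)` of a connected dg-cocategory. -/
def cobar {Γ : DGCocat k X} {deg : X → ℕ} (hΓ : Γ.IsConnected deg) : DGCat k X :=
  quasiFree (cobarGraph Γ.graph) (cobarTwist hΓ)

end Cobar

/-! ## The category of pruned trees -/

/-- An object of the category of pruned trees with `n` levels: a sequence of non-decreasing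
surjections `t₀ → t₁ → ⋯ → tₙ = *` between the ordered sets `{1 < ⋯ < tᵢ}`. -/
structure PTree (n : ℕ) where
  size : Fin (n + 1) → ℕ
  map : ∀ i : Fin n, Fin (size i.castSucc) → Fin (size i.succ)
  mono : ∀ i : Fin n, Monotone (map i)
  surj : ∀ i : Fin n, Function.Surjective (map i)
  size_last : size (Fin.last n) = 1

namespace PTree

variable {n : ℕ}

/-- A morphism of pruned trees: surjections `tᵢ → sᵢ` commuting with the structure maps, and
non-decreasing on the fibers of the structure maps of the source. -/
@[ext]
structure Hom (τ σ : PTree n) where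
  app : ∀ i : Fin (n + 1), Fin (τ.size i) → Fin (σ.size i)
  surj : ∀ i : Fin (n + 1), Function.Surjective (app i)
  comm : ∀ (i : Fin n) (x : Fin (τ.size i.castSucc)),
    σ.map i (app i.castSucc x) = app i.succ (τ.map i x)
  mono : ∀ (i : Fin n) (x y : Fin (τ.size i.castSucc)), τ.map i x = τ.map i y → x ≤ y →
    app i.castSucc x ≤ app i.castSucc y

instance : Category (PTree n) where
  Hom := Hom
  id τ :=
    { app := fun _ => id
      surj := fun _ => Function.surjective_id
      comm := fun _ _ => rfl
      mono := fun _ _ _ _ h => h }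
  comp f g :=
    { app := fun i => g.app i ∘ f.app i
      surj := fun i => (g.surj i).comp (f.surj i)
      comm := fun i x => by simp [g.comm, f.comm]
      mono := fun i x y h hxy => g.mono i _ _ (by rw [f.comm, f.comm, h]) (f.mono i x y h hxy) }

/-- The degree of a tree: its number of vertices at the levels `i < n`. -/
def deg (τ : PTree n) : ℕ := ∑ i : Fin n, τ.size i.castSucc

theorem hom_ext {τ σ : PTree n} {f g : τ ⟶ σ} (h : ∀ i x, f.app i x = g.app i x) : f = g :=
  Hom.ext (funext fun i => funext fun x => h i x)

theorem size_le {τ σ : PTree n} (f : τ ⟶ σ) (i : Fin (n + 1)) : σ.size i ≤ τ.size i := by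
  simpa using Fintype.card_le_of_surjective _ (f.surj i)

theorem deg_le {τ σ : PTree n} (f : τ ⟶ σ) : σ.deg ≤ τ.deg :=
  Finset.sum_le_sum fun i _ => size_le f i.castSucc

theorem size_eq {τ σ : PTree n} (f : τ ⟶ σ) (h : τ.deg ≤ σ.deg) (i : Fin (n + 1)) :
    σ.size i = τ.size i := by
  have h1 := (Finset.sum_eq_sum_iff_of_le (s := Finset.univ) (f := fun i : Fin n =>
    σ.size i.castSucc) (g := fun i : Fin n => τ.size i.castSucc)
    (fun i _ => size_le f i.castSucc)).1 (le_antisymm (deg_le f) h)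
  induction i using Fin.lastCases with
  | last => rw [τ.size_last, σ.size_last]
  | cast i => exact h1 i (Finset.mem_univ i)

theorem app_injective {τ σ : PTree n} (f : τ ⟶ σ) (h : τ.deg ≤ σ.deg) (i : Fin (n + 1)) :
    Function.Injective (f.app i) :=
  ((Fintype.bijective_iff_surjective_and_card _).2 ⟨f.surj i, by simp [size_eq f h i]⟩).1

theorem app_strictMono {τ σ : PTree n} (f : τ ⟶ σ) (h : τ.deg ≤ σ.deg) (i : Fin (n + 1)) :
    StrictMono (f.app i) := by
  induction i using Fin.reverseInduction with
  | last =>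
    intro x y hxy
    have := τ.size_last
    exfalso
    have := x.2
    have := y.2
    have : x.1 < y.1 := hxy
    lia
  | cast i ih =>
    intro x y hxy
    rcases (τ.mono i hxy.le).lt_or_eq with h1 | h1
    · have h2 := ih h1
      rw [← f.comm, ← f.comm] at h2
      by_contra h3
      exact absurd (σ.mono i (not_lt.1 h3)) (not_le.2 h2)
    · exact lt_of_le_of_ne (f.mono i x y h1 hxy.le)
        fun h2 => hxy.ne (app_injective f h i.castSucc h2)

theorem val_eq_of_strictMono {m m' : ℕ} (h : m' = m) {f : Fin m → Fin m'} (hf : StrictMono f)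
    (hs : Function.Surjective f) (x : Fin m) : (f x).val = x.val := by
  subst h
  have := (hf.range_inj strictMono_id).1 (by rw [hs.range_eq, Set.range_id])
  rw [this]; rfl

theorem app_val {τ σ : PTree n} (f : τ ⟶ σ) (h : τ.deg ≤ σ.deg) (i : Fin (n + 1))
    (x : Fin (τ.size i)) : (f.app i x).val = x.val :=
  val_eq_of_strictMono (size_eq f h i) (app_strictMono f h i) (f.surj i) x

theorem eq_of_deg_le {τ σ : PTree n} (f : τ ⟶ σ) (h : τ.deg ≤ σ.deg) : τ = σ := by
  have h1 := funext (size_eq f h)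
  have h2 := app_val f h
  have h3 := f.comm
  obtain ⟨s, m, _, _, _⟩ := τ
  obtain ⟨s', m', _, _, _⟩ := σ
  obtain rfl : s' = s := h1
  have h4 : ∀ i x, f.app i x = x := fun i x => Fin.ext (h2 i x)
  obtain rfl : m' = m := by
    funext i x
    have := h3 i x
    rw [h4, h4] at this
    exact this
  rfl

theorem end_eq_id {τ : PTree n} (f : τ ⟶ τ) : f = 𝟙 τ :=
  hom_ext fun i x => Fin.ext (app_val f le_rfl i x)

instance finite_hom (τ σ : PTree n) : Finite (τ ⟶ σ) :=
  Finite.of_injective (fun f : τ ⟶ σ => f.app) fun _ _ h => Hom.ext h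

theorem finite_bounded (N : ℕ) : Finite {θ : PTree n // ∀ i, θ.size i ≤ N} := by
  let F : {θ : PTree n // ∀ i, θ.size i ≤ N} →
      Σ s : Fin (n + 1) → Fin (N + 1), ∀ i : Fin n, Fin (s i.castSucc) → Fin (s i.succ) :=
    fun θ => ⟨fun i => ⟨θ.1.size i, Nat.lt_succ_of_le (θ.2 i)⟩, θ.1.map⟩
  refine Finite.of_injective F ?_
  rintro ⟨⟨s, m, _, _, _⟩, _⟩ ⟨⟨s', m', _, _, _⟩, _⟩ h
  have h1 := congrArg Sigma.fst h
  obtain rfl : s = s' := funext fun i => congrArg Fin.val (congrFun h1 i)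
  obtain rfl : m = m' := eq_of_heq (Sigma.mk.inj h).2
  rfl

instance finite_under (τ : PTree n) : Finite {θ : PTree n // Nonempty (τ ⟶ θ)} := by
  have := finite_bounded (n := n) (∑ i, τ.size i)
  refine Finite.of_injective (β := {θ : PTree n // ∀ i, θ.size i ≤ ∑ i, τ.size i})
    (fun θ => ⟨θ.1, fun i => ?_⟩) fun θ θ' h => Subtype.ext (Subtype.mk.inj h)
  obtain ⟨_, ⟨f⟩⟩ := θ
  exact (size_le f i).trans (Finset.single_le_sum (fun _ _ => Nat.zero_le _) (Finset.mem_univ i))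

/-- A factorization `u = v w` of a morphism of pruned trees. -/
structure Fact {τ σ : PTree n} (u : τ ⟶ σ) where
  mid : PTree n
  w : τ ⟶ mid
  v : mid ⟶ σ
  comp_eq : w ≫ v = u

instance {τ σ : PTree n} (u : τ ⟶ σ) : Finite (Fact u) := by
  let F : (Σ θ : {θ : PTree n // Nonempty (τ ⟶ θ)},
      {p : (τ ⟶ θ.1) × (θ.1 ⟶ σ) // p.1 ≫ p.2 = u}) → Fact u :=
    fun p => ⟨p.1.1, p.2.1.1, p.2.1.2, p.2.2⟩
  refine Finite.of_surjective F ?_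
  rintro ⟨θ, w, v, h⟩
  exact ⟨⟨⟨θ, ⟨w⟩⟩, ⟨(w, v), h⟩⟩, rfl⟩

instance {τ σ : PTree n} (u : τ ⟶ σ) : Fintype (Fact u) := Fintype.ofFinite _

/-- Associativity of factorizations. -/
def factAssoc {τ σ : PTree n} (u : τ ⟶ σ) :
    (Σ f : Fact u, Fact f.v) ≃ (Σ f : Fact u, Fact f.w) where
  toFun p := ⟨⟨p.2.mid, p.1.w ≫ p.2.w, p.2.v, by
    rw [Category.assoc, p.2.comp_eq, p.1.comp_eq]⟩, ⟨p.1.mid, p.1.w, p.2.w, rfl⟩⟩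
  invFun p := ⟨⟨p.2.mid, p.2.w, p.2.v ≫ p.1.v, by
    rw [← Category.assoc, p.2.comp_eq, p.1.comp_eq]⟩, ⟨p.1.mid, p.2.v, p.1.v, rfl⟩⟩
  left_inv := by
    rintro ⟨⟨θ, w, v, rfl⟩, g⟩
    change Fact v at g
    obtain ⟨θ', w', v', rfl⟩ := g
    rfl
  right_inv := by
    rintro ⟨⟨θ, w, v, rfl⟩, g⟩
    change Fact w at g
    obtain ⟨θ', w', v', rfl⟩ := g
    rfl

/-! ### Signs of morphisms of degree one -/

/-- The vertices of a tree at the levels `i < n`. -/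
abbrev Vertex (τ : PTree n) : Type := Σ i : Fin n, Fin (τ.size i.castSucc)

/-- `Anc τ x y`: the vertex `y` (at level `j`) is on the path from the vertex `x` (at level
`i ≤ j`) to the root. -/
inductive Anc (τ : PTree n) : ∀ {i j : Fin (n + 1)}, Fin (τ.size i) → Fin (τ.size j) → Prop
  | refl {i : Fin (n + 1)} (x : Fin (τ.size i)) : Anc τ x x
  | step {i : Fin (n + 1)} {j : Fin n} {x : Fin (τ.size i)} {y : Fin (τ.size j.castSucc)}
      (h : Anc τ x y) : Anc τ x (τ.map j y)

/-- The total order on vertices obtained by running over the tree along the edges, from bottom to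
top and then from left to right (depth-first order): `v` is before `w` if `v` is on the path from
`w` to the root, or if the path from `v` to the root is, at some level, strictly on the left of the
path from `w` to the root. -/
def Before (τ : PTree n) (v w : Vertex τ) : Prop :=
  (v ≠ w ∧ Anc τ w.2 v.2) ∨
    ∃ (j : Fin (n + 1)) (y z : Fin (τ.size j)), y < z ∧ Anc τ v.2 y ∧ Anc τ w.2 z

/-- The map on vertices given by a morphism. -/
def onVertex {τ σ : PTree n} (u : τ ⟶ σ) (v : Vertex τ) : Vertex σ := ⟨v.1, u.app _ v.2⟩

/-- The vertices of the source which are merged with another vertex. -/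
def Merged {τ σ : PTree n} (u : τ ⟶ σ) (v : Vertex τ) : Prop :=
  ∃ w, w ≠ v ∧ onVertex u w = onVertex u v

/-- The sign of a morphism `u` of degree one (junk on other morphisms).  To each vertex is associated
a symbol of degree one, and the symbols are ordered by the depth-first order.  The sign is the
product of the sign of the permutation moving the two merged vertices in front of the tensor of the
source, and of the sign of the permutation putting the result (the merged vertex followed by the
other ones) in the order of the target. The three terms count the inversions: of the first
permutation; of the second one, for pairs containing the merged vertex; of the second one, for the
other pairs. -/
def sgn {τ σ : PTree n} (u : τ ⟶ σ) : ℤ :=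
  (-1) ^ ({p : Vertex τ × Vertex τ | ¬ Merged u p.1 ∧ Merged u p.2 ∧ Before τ p.1 p.2}.ncard +
    {v : Vertex τ | ¬ Merged u v ∧
      ∃ m, Merged u m ∧ Before σ (onVertex u v) (onVertex u m)}.ncard +
    {p : Vertex τ × Vertex τ | ¬ Merged u p.1 ∧ ¬ Merged u p.2 ∧ Before τ p.1 p.2 ∧
      Before σ (onVertex u p.2) (onVertex u p.1)}.ncard)

end PTree

/-! ## The category of pruned trees as a dg-category -/

section Omega

variable (k : Type u) [CommRing k] (n : ℕ)

/-- The hom dg-modules of the `k`-linear category of pruned trees: free `k`-modules on the sets of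
morphisms, concentrated in degree `0`. -/
def omegaGraph : DGGraph k (PTree n) := fun τ σ =>
  { X := fun i => ModuleCat.of k ({_u : τ ⟶ σ // i = 0} →₀ k)
    d := fun _ _ => 0 }

/-- The bilinear extension of the composition of morphisms of pruned trees. -/
def omegaComp {τ θ σ : PTree n} {i j l : ℤ} (h : i + j = l) :
    ({_u : θ ⟶ σ // i = 0} →₀ k) →ₗ[k] ({_u : τ ⟶ θ // j = 0} →₀ k) →ₗ[k]
      ({_u : τ ⟶ σ // l = 0} →₀ k) :=
  Finsupp.linearCombination k fun v => Finsupp.linearCombination k fun w =>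
    Finsupp.single ⟨w.1 ≫ v.1, by have := v.2; have := w.2; lia⟩ 1

theorem omegaComp_single {τ θ σ : PTree n} {i j l : ℤ} (h : i + j = l)
    (v : {_u : θ ⟶ σ // i = 0}) (w : {_u : τ ⟶ θ // j = 0}) (r s : k) :
    omegaComp k n h (Finsupp.single v r) (Finsupp.single w s) =
      Finsupp.single ⟨w.1 ≫ v.1, by have := v.2; have := w.2; lia⟩ (r * s) := by
  simp [omegaComp]

theorem omegaComp_assoc {τ θ θ' σ : PTree n} {i j l p q r : ℤ} (hp : i + j = p) (hr : p + l = r)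
    (hq : j + l = q) (hr' : i + q = r) (f : {_u : θ' ⟶ σ // i = 0} →₀ k)
    (g : {_u : θ ⟶ θ' // j = 0} →₀ k) (h : {_u : τ ⟶ θ // l = 0} →₀ k) :
    omegaComp k n hr (omegaComp k n hp f g) h = omegaComp k n hr' f (omegaComp k n hq g h) := by
  induction f using Finsupp.induction_linear with
  | zero => simp
  | add f f' hf hf' => simp only [map_add, LinearMap.add_apply, hf, hf']
  | single u a =>
    induction g using Finsupp.induction_linear with
    | zero => simp
    | add f f' hf hf' => simp only [map_add, LinearMap.add_apply, hf, hf']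
    | single v b =>
      induction h using Finsupp.induction_linear with
      | zero => simp
      | add f f' hf hf' => simp only [map_add, hf, hf']
      | single w c => simp only [omegaComp_single, mul_assoc, Category.assoc]

theorem omegaComp_one_left {τ σ : PTree n} {i : ℤ} (f : {_u : τ ⟶ σ // i = 0} →₀ k) :
    omegaComp k n (zero_add i) (Finsupp.single ⟨𝟙 σ, rfl⟩ 1) f = f := by
  induction f using Finsupp.induction_linear with
  | zero => simp
  | add f f' hf hf' => rw [map_add, hf, hf']
  | single u a => simp [omegaComp_single]

theorem omegaComp_one_right {τ σ : PTree n} {i : ℤ} (f : {_u : τ ⟶ σ // i = 0} →₀ k) :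
    omegaComp k n (add_zero i) f (Finsupp.single ⟨𝟙 τ, rfl⟩ 1) = f := by
  induction f using Finsupp.induction_linear with
  | zero => simp
  | add f f' hf hf' => rw [map_add, LinearMap.add_apply, hf, hf']
  | single u a => simp [omegaComp_single]

theorem omegaComp_zero {τ θ σ : PTree n} {i j l i' j' : ℤ} (h : i' + j = l) (h' : i + j' = l)
    (f : {_u : θ ⟶ σ // i = 0} →₀ k) (g : {_u : τ ⟶ θ // j = 0} →₀ k) (c : ℤ) :
    omegaComp k n h 0 g + c • omegaComp k n h' f 0 = 0 := by
  rw [map_zero, map_zero, LinearMap.zero_apply, smul_zero, add_zero]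

/-- The `k`-linear category of pruned trees, as a dg-category concentrated in degree `0`. -/
def omega : DGCat k (PTree n) where
  Hom := omegaGraph k n
  comp h := omegaComp k n h
  one σ := (Finsupp.single ⟨𝟙 σ, rfl⟩ 1 : {_u : σ ⟶ σ // (0 : ℤ) = 0} →₀ k)
  assoc hp hr hq hr' f g h := omegaComp_assoc k n hp hr hq hr' f g h
  one_comp f := omegaComp_one_left k n f
  comp_one f := omegaComp_one_right k n f
  d_one _ := rfl
  d_comp _ f g := (omegaComp_zero k n _ _ f g _).symm

end Omega

/-! ## The Koszul construction -/

section Koszul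

open PTree

variable (k : Type u) [CommRing k] (n : ℕ)

/-- The dg-graph of the Koszul construction: the free `k`-modules on the sets of morphisms of pruned
trees `u : τ ⟶ σ`, with `deg u = deg τ - deg σ`, and a trivial differential. -/
def koszulGraph : DGGraph k (PTree n) := fun τ σ =>
  { X := fun i => ModuleCat.of k ({_u : τ ⟶ σ // (τ.deg : ℤ) - σ.deg = i} →₀ k)
    d := fun _ _ => 0 }

variable {n}

/-- The generators `{u}` of the Koszul construction. -/
def koszulGen {τ σ : PTree n} (u : τ ⟶ σ) : Tot (koszulGraph k n) :=
  incl (koszulGraph k n) ((τ.deg : ℤ) - σ.deg) τ σ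
    (Finsupp.single ⟨u, rfl⟩ 1 : {_u : τ ⟶ σ // (τ.deg : ℤ) - σ.deg = τ.deg - σ.deg} →₀ k)

variable {k}

/-- A map on the total module of the Koszul construction given on generators. -/
def koszulLift {N : Type*} [AddCommGroup N] [Module k N] (f : ∀ {τ σ : PTree n}, (τ ⟶ σ) → N) :
    Tot (koszulGraph k n) →ₗ[k] N :=
  totLift fun i τ σ => (Finsupp.linearCombination k fun u => f u.1 :
    ({_u : τ ⟶ σ // (τ.deg : ℤ) - σ.deg = i} →₀ k) →ₗ[k] N)

theorem koszulLift_incl {N : Type*} [AddCommGroup N] [Module k N]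
    (f : ∀ {τ σ : PTree n}, (τ ⟶ σ) → N) {τ σ : PTree n} {i : ℤ}
    (x : {_u : τ ⟶ σ // (τ.deg : ℤ) - σ.deg = i} →₀ k) :
    koszulLift f (incl (koszulGraph k n) i τ σ x) =
      Finsupp.linearCombination k (fun u : {_u : τ ⟶ σ // (τ.deg : ℤ) - σ.deg = i} => f u.1) x :=
  totLift_incl _ _ _ _ _

theorem koszulLift_gen {N : Type*} [AddCommGroup N] [Module k N]
    (f : ∀ {τ σ : PTree n}, (τ ⟶ σ) → N) {τ σ : PTree n} (u : τ ⟶ σ) :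
    koszulLift f (koszulGen k u) = f u := by
  rw [koszulGen, koszulLift_incl]; simp

theorem koszul_ext {N : Type*} [AddCommGroup N] [Module k N] {f g : Tot (koszulGraph k n) →ₗ[k] N}
    (h : ∀ {τ σ : PTree n} (u : τ ⟶ σ), f (koszulGen k u) = g (koszulGen k u)) : f = g := by
  refine tot_ext fun i τ σ x => ?_
  suffices h' : f ∘ₗ incl (koszulGraph k n) i τ σ = g ∘ₗ incl (koszulGraph k n) i τ σ from
    LinearMap.congr_fun h' x
  refine Finsupp.lhom_ext' fun u => LinearMap.ext_ring ?_
  obtain ⟨u, rfl⟩ := u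
  exact h u

variable (k n)

open Classical in
/-- The coalgebra structure of the Koszul construction.  The diagonal maps `{u}` to the sum of the
tensors `{v} ⊗ {w}` over the factorizations `u = v w`, and the augmentation maps the identities
to `1`. -/
abbrev koszulCoalgebra : Coalgebra k (Tot (koszulGraph k n)) where
  comul := koszulLift fun u => ∑ f : Fact u, koszulGen k f.v ⊗ₜ[k] koszulGen k f.w
  counit := koszulLift fun {τ σ} _ => if τ = σ then 1 else 0
  coassoc := by
    refine koszul_ext fun {τ σ} u => ?_
    simp only [LinearMap.comp_apply, koszulLift_gen, map_sum, LinearMap.rTensor_tmul,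
      LinearMap.lTensor_tmul, TensorProduct.sum_tmul, TensorProduct.tmul_sum,
      LinearEquiv.coe_coe, TensorProduct.assoc_tmul]
    rw [← Fintype.sum_sigma', ← Fintype.sum_sigma']
    exact Fintype.sum_equiv (factAssoc u) _ _ fun _ => rfl
  rTensor_counit_comp_comul := by
    refine koszul_ext fun {τ σ} u => ?_
    simp only [LinearMap.comp_apply, koszulLift_gen, map_sum, LinearMap.rTensor_tmul]
    rw [Fintype.sum_eq_single (⟨σ, u, 𝟙 σ, Category.comp_id u⟩ : Fact u)]
    · simp
    · rintro ⟨θ, w, v, rfl⟩ h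
      rw [if_neg, TensorProduct.zero_tmul]
      rintro (rfl : θ = σ)
      apply h
      obtain rfl := end_eq_id v
      simp
  lTensor_counit_comp_comul := by
    refine koszul_ext fun {τ σ} u => ?_
    simp only [LinearMap.comp_apply, koszulLift_gen, map_sum, LinearMap.lTensor_tmul]
    rw [Fintype.sum_eq_single (⟨τ, 𝟙 τ, u, Category.id_comp u⟩ : Fact u)]
    · simp
    · rintro ⟨θ, w, v, rfl⟩ h
      rw [if_neg, TensorProduct.tmul_zero]
      rintro (rfl : τ = θ)
      apply h
      obtain rfl := end_eq_id w
      simp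

theorem totD_koszul (z : Tot (koszulGraph k n)) : totD (koszulGraph k n) z = 0 := by
  suffices h : totD (koszulGraph k n) = 0 by rw [h, LinearMap.zero_apply]
  refine tot_ext fun i τ σ x => ?_
  rw [totD_incl, LinearMap.zero_apply]
  exact map_zero _

/-- The Koszul construction of the category of pruned trees, as a dg-cocategory. -/
abbrev koszul : DGCocat k (PTree n) where
  graph := koszulGraph k n
  coalg := koszulCoalgebra k n
  comul_mem i τ σ x := by
    change {_u : τ ⟶ σ // (τ.deg : ℤ) - σ.deg = i} →₀ k at x
    change koszulLift _ (incl _ _ _ _ _) ∈ _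
    refine (congrArg (· ∈ splitSpan (koszulGraph k n) i τ σ) (koszulLift_incl _ x)).mpr ?_
    rw [Finsupp.linearCombination_apply]
    refine Submodule.sum_mem _ fun u _ => Submodule.smul_mem _ _ (Submodule.sum_mem _ fun f _ => ?_)
    refine Submodule.subset_span ⟨f.mid, _, _, ?_, _, _, rfl⟩
    have := u.2
    lia
  counit_eq_zero i τ σ x h := by
    change {_u : τ ⟶ σ // (τ.deg : ℤ) - σ.deg = i} →₀ k at x
    change koszulLift _ (incl _ _ _ _ _) = _
    refine (koszulLift_incl _ x).trans ?_
    rw [Finsupp.linearCombination_apply]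
    refine Finset.sum_eq_zero fun u _ => ?_
    have hne : τ ≠ σ := by
      rintro rfl
      exact h ⟨by have := u.2; lia, rfl⟩
    simp [hne]
  comul_d z := by
    rw [totD_koszul, map_zero]
    have : totD (koszulGraph k n) = 0 := LinearMap.ext (totD_koszul k n)
    simp [this]
  counit_d z := by rw [totD_koszul, map_zero]

theorem koszul_isConnected : (koszul k n).IsConnected PTree.deg where
  eq_zero_of_ne τ i hi x := by
    change {_u : τ ⟶ τ // (τ.deg : ℤ) - τ.deg = i} →₀ k at x
    refine Finsupp.ext fun u => ?_
    have := u.2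
    exact absurd (by lia) hi
  counit_bijective τ := by
    have h : ∀ x : {_u : τ ⟶ τ // (τ.deg : ℤ) - τ.deg = 0} →₀ k,
        (koszul k n).coalg.counit (incl (koszulGraph k n) 0 τ τ x) = x ⟨𝟙 τ, sub_self _⟩ := by
      intro x
      refine (koszulLift_incl _ x).trans ?_
      induction x using Finsupp.induction_linear with
      | zero => simp
      | add x y hx hy => rw [map_add, hx, hy, Finsupp.add_apply]
      | single u a =>
        obtain ⟨u, hu⟩ := u
        obtain rfl := end_eq_id u
        simp
    constructor
    · intro x y hxy
      have h1 : x = y := by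
        change {_u : τ ⟶ τ // (τ.deg : ℤ) - τ.deg = 0} →₀ k at x y
        refine Finsupp.ext fun u => ?_
        obtain ⟨u, hu⟩ := u
        obtain rfl := end_eq_id u
        exact (h x).symm.trans (Eq.trans hxy (h y))
      exact h1
    · intro r
      exact ⟨(Finsupp.single ⟨𝟙 τ, sub_self _⟩ r : {_u : τ ⟶ τ // (τ.deg : ℤ) - τ.deg = 0} →₀ k),
        (h _).trans (by simp)⟩
  eq_zero_of_le τ σ hne hle i x := by
    change {_u : τ ⟶ σ // (τ.deg : ℤ) - σ.deg = i} →₀ k at x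
    exact Finsupp.ext fun u => absurd (eq_of_deg_le u.1 hle) hne

/-- The dg-category `Res(Ω) = Bᶜ(K(Ω))`: the cobar construction of the Koszul construction of the
category of pruned trees. -/
def res : DGCat k (PTree n) := cobar (koszul_isConnected k n)

variable {n}

/-- The generator `{u}` of the cobar construction associated to a non-identity morphism `u`,
in degree `j = deg u - 1`. -/
def resGen {τ σ : PTree n} (u : τ ⟶ σ) (j : ℤ) (hj : (τ.deg : ℤ) - σ.deg = j + 1) :
    ((res k n).Hom τ σ).X j :=
  freeGen (cobarGraph (koszul k n).graph) j τ σ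
    (toCobar (koszulGraph k n) τ σ (rfl : j + 1 = j + 1)
      (Finsupp.single ⟨u, hj⟩ 1 : {_u : τ ⟶ σ // (τ.deg : ℤ) - σ.deg = j + 1} →₀ k))

/-- The value of the augmentation on the generator `{u}` of degree `j = deg u - 1`: `sgn u • {u}` if
`deg u = 1` and `0` otherwise. -/
def augGen {τ σ : PTree n} (u : τ ⟶ σ) (j : ℤ) : ((omega k n).Hom τ σ).X j :=
  if hj : j = 0 then
    (Finsupp.single ⟨u, hj⟩ (PTree.sgn u : k) : {_u : τ ⟶ σ // j = 0} →₀ k)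
  else (0 : {_u : τ ⟶ σ // j = 0} →₀ k)

end Koszul

end

end PrunedTree

set_option linter.unusedSectionVars false

/-! Quasi-freeness is built into the cobar construction, and minimality is immediate: `Σ⁻¹K~` has no
internal differential and `∂` is quadratic on generators. The content is that `ε` exists and is a
weak equivalence, i.e. that the category of pruned trees is Koszul, over an arbitrary ring and with
the stated signs.

Combinatorial core. Fix `u : τ ⟶ σ`. A factorization `u = v w` is encoded by a "local preorder" on
the nodes of `τ`: it compares nodes with the same image under `u` whose parents are identified by
`w`, according to the order of their images under `w`. This identifies factorizations, ordered by
refinement of the middle tree, with all local preorders extending the given order on the fibres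
(`exists_hom_of_factOrder_le`, `factOrder_injective`, `exists_factOrder_eq`). If `u` is not an
identity, some fibre contains two siblings; colour the descendants of the first node of such a fibre
blue, the rest red. A pivot class is then either split into its blue and red halves or merged with
the blue class just before it. The pivot only sees pairs that these moves do not alter, so the moves
are mutually inverse. They form a perfect matching, acyclic for the rank counting the related pairs
that are not (red, blue) (`exists_factMatching`).

Signs. A morphism of degree two has exactly two factorizations into morphisms of degree one, namely
the mates of the two trivial factorizations (`exists_two_mids`). Inversion counts modulo 2 show that
their sign products are opposite (`sgn_mul_sgn_of_ne`). Hence the signed complex of functions on the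
factorizations of `u` squares to zero, and `ε` commutes with differentials. As matched coefficients
are `±1`, the matching makes that complex exact (`koszulDiff_exact`).

From the Koszul complex to the cobar construction. An element of the cobar construction from `τ` to
`σ ≠ τ` is uniquely a sum of products `{v} s_v`, with `v` the factor on the target side. Filter by
`deg v` and induct on `deg τ - deg σ`: by induction the coordinates `s_v` have homology only in
degree `0`, detected by `ε`, and what remains on these classes is the Koszul complex of each `u`.
Exactness first moves all coordinates of a cycle into `ker ε` (`exists_cobarD_eq_of_ne`), after
which they are killed one degree of `v` at a time (`exists_cobarD_eq_of_coord`). Surjectivity of `ε`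
in degree `0` holds because every morphism is a composite of morphisms of degree one
(`exists_fact_deg`). -/

namespace PrunedTree

/-! ## Local preorders on a fibred set and a matching of their poset -/

section Matching

variable {V Z : Type}

/-- A family of total preorders on the sets of elements with the same image under `π` and with
equivalent parents, extending the relation `F`. -/
structure LocalOrder (par : V → V) (π : V → Z) (F : V → V → Prop) (T : V → V → Prop) : Prop where
  refl : ∀ x, T x x
  trans : ∀ {x y z}, T x y → T y z → T x z
  dom : ∀ {x y}, T x y → π x = π y ∧ T (par x) (par y) ∧ T (par y) (par x)
  total : ∀ {x y}, π x = π y → T (par x) (par y) → T (par y) (par x) → T x y ∨ T y x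
  fib : ∀ {x y}, F x y → T x y

/-- A colouring of the elements (blue or not) compatible with the parent map. -/
structure Coloring (par : V → V) (π : V → Z) (F : V → V → Prop) (lev : V → ℕ) (blue : V → Prop) :
    Prop where
  fib : ∀ {x y}, F x y → blue y → blue x
  par_eq : ∀ {x y}, F x y → par x = par y
  inherit : ∀ {x y}, blue y → π (par x) = π y → (blue x ↔ blue (par x))
  lev_eq : ∀ {x y}, π x = π y → lev x = lev y
  lev_par : ∀ x, lev x < lev (par x) ∨ (par x = x ∧ ∀ y, π y = π x → y = x)
  exists_pair : ∃ x y, blue y ∧ ¬ blue x ∧ F y x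

/-- The local preorders `T` and `T'` agree except possibly on pairs (red, blue). -/
def AgreeOff (blue : V → Prop) (T T' : V → V → Prop) : Prop :=
  ∀ x y, (blue x ∨ ¬ blue y) → (T x y ↔ T' x y)

/-- The red elements which are the first ones weakly after some blue element. -/
def Toggles (blue : V → Prop) (T : V → V → Prop) (x : V) : Prop :=
  ¬ blue x ∧ ∃ y, blue y ∧ T y x ∧ ∀ z, ¬ blue z → T y z → T x z

/-- A chosen toggle of minimal level. -/
noncomputable def pivot [Nonempty V] (lev : V → ℕ) (blue : V → Prop) (T : V → V → Prop) : V :=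
  Classical.epsilon fun x => Toggles blue T x ∧ ∀ z, Toggles blue T z → lev x ≤ lev z

/-- The class of the pivot is mixed. -/
def Mixed [Nonempty V] (lev : V → ℕ) (blue : V → Prop) (T : V → V → Prop) : Prop :=
  ∃ y, blue y ∧ T y (pivot lev blue T) ∧ T (pivot lev blue T) y

/-- `x` is red, `y` is blue, and both are in the class of the pivot. -/
def Cut [Nonempty V] (lev : V → ℕ) (blue : V → Prop) (T : V → V → Prop) (x y : V) : Prop :=
  ¬ blue x ∧ blue y ∧ (T x (pivot lev blue T) ∧ T (pivot lev blue T) x) ∧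
    T y (pivot lev blue T) ∧ T (pivot lev blue T) y

/-- The local preorder obtained by splitting the class of the pivot. -/
def split [Nonempty V] (par : V → V) (lev : V → ℕ) (blue : V → Prop) (T : V → V → Prop)
    (x y : V) : Prop :=
  T x y ∧ ¬ Cut lev blue T x y ∧ ¬ Cut lev blue T (par x) (par y)

/-- The blue elements which immediately precede the pivot. -/
def Precedes [Nonempty V] (lev : V → ℕ) (blue : V → Prop) (T : V → V → Prop) (y : V) : Prop :=
  blue y ∧ T y (pivot lev blue T) ∧
    ∀ z, T y z → T z (pivot lev blue T) → T z y ∨ T (pivot lev blue T) z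

/-- `x` is in the class of the pivot, and `y` immediately precedes it. -/
def Glue [Nonempty V] (lev : V → ℕ) (blue : V → Prop) (T : V → V → Prop) (x y : V) : Prop :=
  (T x (pivot lev blue T) ∧ T (pivot lev blue T) x) ∧ Precedes lev blue T y

/-- The local preorder obtained by merging the class of the pivot with the previous one. -/
def merge [Nonempty V] (par : V → V) (π : V → Z) (lev : V → ℕ) (blue : V → Prop)
    (T : V → V → Prop) (x y : V) : Prop :=
  T x y ∨ Glue lev blue T x y ∨ (π x = π y ∧ Glue lev blue T (par x) (par y))

/-! ### Toggles and the pivot. -/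

theorem AgreeOff.symm {blue : V → Prop} {T T' : V → V → Prop} (h : AgreeOff blue T T') :
    AgreeOff blue T' T := fun x y hxy => (h x y hxy).symm

/-- The definition of a toggle tests `T` only on pairs whose first member is blue or whose second
member is red, which are exactly the pairs where agreement is assumed. -/
theorem AgreeOff.toggles {blue : V → Prop} {T T' : V → V → Prop} (h : AgreeOff blue T T') (x : V) :
    Toggles blue T x ↔ Toggles blue T' x := by
  unfold Toggles
  refine and_congr_right fun hx => exists_congr fun y => and_congr_right fun hy => ?_
  rw [h y x (Or.inl hy)]
  refine and_congr_right fun _ => forall_congr' fun z => ?_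
  refine imp_congr_right fun hz => ?_
  rw [h y z (Or.inl hy), h x z (Or.inr hz)]

variable [Nonempty V]

/-- The pivot is an epsilon term in the predicate `Toggles`, so equal predicates give literally the
same node and no tie-breaking rule is needed. This is what makes splitting and merging inverse to
each other. -/
theorem AgreeOff.pivot_eq {lev : V → ℕ} {blue : V → Prop} {T T' : V → V → Prop}
    (h : AgreeOff blue T T') : pivot lev blue T = pivot lev blue T' := by
  unfold pivot
  congr 1
  funext x
  simp only [h.toggles]

variable [Finite V] {par : V → V} {π : V → Z} {F : V → V → Prop} {lev : V → ℕ} {blue : V → Prop}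
  {T T' : V → V → Prop}

/-- A nonempty set of pairwise comparable elements has a first element. -/
theorem LocalOrder.exists_first (hT : LocalOrder par π F T) {A : V → Prop} {a : V} (ha : A a)
    (hA : ∀ x y, A x → A y → T x y ∨ T y x) : ∃ x, A x ∧ ∀ y, A y → T x y := by
  -- Take the element of `A` with the fewest predecessors in `A`; anything before it would have the
  -- same set of predecessors, hence be equivalent to it.
  obtain ⟨x, hx, hmin⟩ := (Set.toFinite {x | A x}).exists_minimalFor
    (fun x => {z | A z ∧ T z x}.ncard) _ ⟨a, ha⟩
  refine ⟨x, hx, fun y hy => ?_⟩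
  rcases hA x y hx hy with h | h
  · exact h
  · have h1 : {z | A z ∧ T z y} ⊆ {z | A z ∧ T z x} := fun z hz => ⟨hz.1, hT.trans hz.2 h⟩
    have h2 := hmin hy (Set.ncard_le_ncard h1 (Set.toFinite _))
    have h3 := Set.eq_of_subset_of_ncard_le h1 h2 (Set.toFinite _)
    have : x ∈ {z | A z ∧ T z y} := h3 ▸ (⟨hx, hT.refl x⟩ : x ∈ {z | A z ∧ T z x})
    exact this.2

/-- Being comparable means having the same image and equivalent parents, and this is an equivalence
relation. -/
theorem LocalOrder.comparable (hT : LocalOrder par π F T) {x y z : V} (h1 : T x y ∨ T y x)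
    (h2 : T x z ∨ T z x) : T y z ∨ T z y := by
  have e : ∀ {a b}, T a b ∨ T b a → π a = π b ∧ T (par a) (par b) ∧ T (par b) (par a) := by
    rintro a b (h | h)
    · exact hT.dom h
    · obtain ⟨p, q, r⟩ := hT.dom h; exact ⟨p.symm, r, q⟩
  obtain ⟨p1, q1, r1⟩ := e h1
  obtain ⟨p2, q2, r2⟩ := e h2
  exact hT.total (p1.symm.trans p2) (hT.trans r1 q2) (hT.trans r2 q1)

/-- The first red element after the blue `y` is a toggle. So a fibre contains a toggle as soon as
some blue element lies weakly before some red one. -/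
theorem Coloring.exists_toggle (hT : LocalOrder par π F T) {x y : V} (hy : blue y)
    (hx : ¬ blue x) (h : T y x) : ∃ z, Toggles blue T z ∧ π z = π x := by
  obtain ⟨z, ⟨hz, hyz⟩, hmin⟩ := hT.exists_first (A := fun z => ¬ blue z ∧ T y z) ⟨hx, h⟩
    fun a b ha hb => hT.comparable (Or.inl ha.2) (Or.inl hb.2)
  exact ⟨z, ⟨hz, y, hy, hyz, fun w hw hyw => hmin w ⟨hw, hyw⟩⟩,
    (hT.dom hyz).1.symm.trans (hT.dom h).1⟩

theorem Coloring.pivot_spec (hc : Coloring par π F lev blue) (hT : LocalOrder par π F T) :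
    Toggles blue T (pivot lev blue T) ∧ ∀ z, Toggles blue T z → lev (pivot lev blue T) ≤ lev z := by
  obtain ⟨x, y, hy, hx, h⟩ := hc.exists_pair
  obtain ⟨z, hz, -⟩ := Coloring.exists_toggle hT hy hx (hT.fib h)
  obtain ⟨w, hw, hmin⟩ := (Set.toFinite {x | Toggles blue T x}).exists_minimalFor lev _ ⟨z, hz⟩
  refine Classical.epsilon_spec
    (p := fun x => Toggles blue T x ∧ ∀ z, Toggles blue T z → lev x ≤ lev z) ⟨w, hw, fun z hz => ?_⟩
  rcases le_total (lev w) (lev z) with h | h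
  · exact h
  · exact hmin hz h

theorem Coloring.pivot_red (hc : Coloring par π F lev blue) (hT : LocalOrder par π F T) :
    ¬ blue (pivot lev blue T) := (hc.pivot_spec hT).1.1

theorem Coloring.le_of_bad (hc : Coloring par π F lev blue) (hT : LocalOrder par π F T) {x y : V}
    (hy : blue y) (hx : ¬ blue x) (h : T y x) : lev (pivot lev blue T) ≤ lev x := by
  obtain ⟨z, hz, hzx⟩ := Coloring.exists_toggle hT hy hx h
  rw [← hc.lev_eq hzx]
  exact (hc.pivot_spec hT).2 z hz

theorem Coloring.exists_blue (hc : Coloring par π F lev blue) (hT : LocalOrder par π F T) :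
    ∃ y, blue y ∧ π y = π (pivot lev blue T) := by
  obtain ⟨-, y, hy, h, -⟩ := (hc.pivot_spec hT).1
  exact ⟨y, hy, (hT.dom h).1⟩

theorem Coloring.lev_lt (hc : Coloring par π F lev blue) (hT : LocalOrder par π F T) {z : V}
    (h : π (par z) = π (pivot lev blue T)) : lev z < lev (pivot lev blue T) := by
  rcases hc.lev_par z with h1 | ⟨h1, h2⟩
  · rwa [hc.lev_eq h] at h1
  -- Otherwise `z` is its own parent and alone in its fibre; but the fibre of the pivot contains
  -- both the red pivot and a blue element.
  · obtain ⟨y, hy, hy'⟩ := hc.exists_blue hT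
    rw [h1] at h
    have e1 := h2 _ h.symm
    have e2 := h2 y (hy'.trans h.symm)
    rw [e2, ← e1] at hy
    exact absurd hy (hc.pivot_red hT)

theorem Coloring.par_pivot_ne (hc : Coloring par π F lev blue) (hT : LocalOrder par π F T) {z : V}
    (h : π z = π (pivot lev blue T)) : π (par z) ≠ π (pivot lev blue T) := fun h' =>
  (hc.lev_lt hT h').ne (hc.lev_eq h)

theorem Coloring.blue_par (hc : Coloring par π F lev blue) (hT : LocalOrder par π F T) {z : V}
    (h : π (par z) = π (pivot lev blue T)) : blue z ↔ blue (par z) := by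
  obtain ⟨y, hy, hy'⟩ := hc.exists_blue hT
  exact hc.inherit hy (h.trans hy'.symm)

/-! ### Splitting -/

theorem Cut.left (hT : LocalOrder par π F T) {x y : V} (h : Cut lev blue T x y) :
    π x = π (pivot lev blue T) := (hT.dom h.2.2.1.1).1

theorem Cut.right (hT : LocalOrder par π F T) {x y : V} (h : Cut lev blue T x y) :
    π y = π (pivot lev blue T) := (hT.dom h.2.2.2.1).1

/-- A blue element weakly before a red one among these children would create a toggle of level
smaller than that of the pivot. This is the reason for choosing the pivot of minimal level, i.e. as
far from the root as possible. -/
theorem Coloring.not_bad_below (hc : Coloring par π F lev blue) (hT : LocalOrder par π F T)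
    {x y : V} (hx : π (par x) = π (pivot lev blue T)) (hb : ¬ blue x) (hy : blue y) : ¬ T y x :=
  fun h => (hc.le_of_bad hT hy hb h).not_gt (hc.lev_lt hT hx)

/-- If `par x` and `par y` are separated by a splitting, then `x` is red and `y` is blue. -/
theorem Coloring.cut_par (hc : Coloring par π F lev blue) (hT : LocalOrder par π F T) {x y : V}
    (h : Cut lev blue T (par x) (par y)) : ¬ blue x ∧ blue y ∧ ¬ T y x := by
  have hx : ¬ blue x := (hc.blue_par hT (h.left hT)).not.2 h.1
  have hy : blue y := (hc.blue_par hT (h.right hT)).2 h.2.1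
  exact ⟨hx, hy, hc.not_bad_below hT (h.left hT) hx hy⟩

theorem Cut.trans (hT : LocalOrder par π F T) {x y z : V} (h : Cut lev blue T x z)
    (h1 : T x y) (h2 : T y z) : Cut lev blue T x y ∨ Cut lev blue T y z := by
  have hy : T y (pivot lev blue T) ∧ T (pivot lev blue T) y :=
    ⟨hT.trans h2 h.2.2.2.1, hT.trans h.2.2.1.2 h1⟩
  by_cases hb : blue y
  · exact Or.inl ⟨h.1, hb, h.2.2.1, hy⟩
  · exact Or.inr ⟨hb, h.2.1, hy, h.2.2.2⟩

theorem Coloring.not_cut_par_par (hc : Coloring par π F lev blue) (hT : LocalOrder par π F T)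
    {x y : V} (h1 : T x y) : ¬ Cut lev blue T (par (par x)) (par (par y)) := fun h =>
  (hc.cut_par hT h).2.2 (hT.dom h1).2.2

/-- Splitting puts the blue half of the pivot class strictly before the red half. Children of
separated nodes no longer have equivalent parents, so their comparisons must disappear too; by
`cut_par` these all go strictly from red to blue. Hence no equivalence below the pivot is destroyed
and grandchildren need no correction. -/
theorem Coloring.split_localOrder (hc : Coloring par π F lev blue) (hT : LocalOrder par π F T) :
    LocalOrder par π F (split par lev blue T) where
  refl x := ⟨hT.refl x, fun h => h.1 h.2.1, fun h => h.1 h.2.1⟩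
  trans {x y z} h1 h2 := by
    refine ⟨hT.trans h1.1 h2.1, fun h => ?_, fun h => ?_⟩
    · exact (h.trans hT h1.1 h2.1).elim h1.2.1 h2.2.1
    · exact (h.trans hT (hT.dom h1.1).2.1 (hT.dom h2.1).2.1).elim h1.2.2 h2.2.2
  dom {x y} h := by
    obtain ⟨p, q, r⟩ := hT.dom h.1
    refine ⟨p, ⟨q, h.2.2, hc.not_cut_par_par hT h.1⟩, r, fun h' => ?_, fun h' => ?_⟩
    · exact (hc.cut_par hT h').2.2 h.1
    · exact (hc.cut_par hT h').2.2 q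
  total {x y} p q r := by
    rcases hT.total p q.1 r.1 with h | h
    · by_cases hC : Cut lev blue T x y
      · exact Or.inr ⟨hT.trans hC.2.2.2.1 hC.2.2.1.2, fun h' => h'.1 hC.2.1, r.2.1⟩
      · exact Or.inl ⟨h, hC, q.2.1⟩
    · by_cases hC : Cut lev blue T y x
      · exact Or.inl ⟨hT.trans hC.2.2.2.1 hC.2.2.1.2, fun h' => h'.1 hC.2.1, q.2.1⟩
      · exact Or.inr ⟨h, hC, r.2.1⟩
  fib {x y} h := by
    refine ⟨hT.fib h, fun h' => h'.1 (hc.fib h h'.2.1), fun h' => ?_⟩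
    rw [hc.par_eq h] at h'
    exact h'.1 h'.2.1

theorem Coloring.split_agreeOff (hc : Coloring par π F lev blue) (hT : LocalOrder par π F T) :
    AgreeOff blue T (split par lev blue T) := by
  intro x y hxy
  refine ⟨fun h => ⟨h, fun h' => ?_, fun h' => ?_⟩, fun h => h.1⟩
  · exact hxy.elim h'.1 fun h => h h'.2.1
  · have h2 := hc.cut_par hT h'
    exact hxy.elim h2.1 fun h => h h2.2.1

theorem Coloring.split_not_mixed (hc : Coloring par π F lev blue) (hT : LocalOrder par π F T) :
    ¬ Mixed lev blue (split par lev blue T) := by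
  rintro ⟨y, hy, h1, h2⟩
  rw [← (hc.split_agreeOff hT).pivot_eq] at h1 h2
  exact h2.2.1 ⟨hc.pivot_red hT, hy, ⟨hT.refl _, hT.refl _⟩, h1.1, h2.1⟩

/-! ### Merging -/

theorem Coloring.exists_precedes (hc : Coloring par π F lev blue) (hT : LocalOrder par π F T)
    (hM : ¬ Mixed lev blue T) : ∃ y, Precedes lev blue T y := by
  obtain ⟨hx, y, hy, hyx, hmin⟩ := (hc.pivot_spec hT).1
  set x := pivot lev blue T with hxdef
  have hxy : ¬ T x y := fun h => hM ⟨y, hy, hyx, h⟩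
  -- `z` is a last element of the half-open interval from `y` to the pivot, found by minimizing the
  -- number of successors. It cannot be red, because the pivot is the first red element after `y`.
  obtain ⟨z, ⟨hz1, hz2, hz3⟩, hmax⟩ :=
    (Set.toFinite {z | T y z ∧ T z x ∧ ¬ T x z}).exists_minimalFor
      (fun z => {w | T z w}.ncard) _ ⟨y, hT.refl y, hyx, hxy⟩
  refine ⟨z, by_contra fun hb => hz3 (hmin z hb hz1), hz2, fun w hzw hwx => ?_⟩
  by_contra! hcon
  have h1 : {v | T w v} ⊆ {v | T z v} := fun v hv => hT.trans hzw hv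
  have h2 := hmax ⟨hT.trans hz1 hzw, hwx, hcon.2⟩ (Set.ncard_le_ncard h1 (Set.toFinite _))
  have h3 := Set.eq_of_subset_of_ncard_le h1 h2 (Set.toFinite _)
  have : z ∈ {v | T w v} := h3 ▸ (hT.refl z : z ∈ {v | T z v})
  exact hcon.1 this

theorem Precedes.not_le (hM : ¬ Mixed lev blue T) {y : V} (hy : Precedes lev blue T y) :
    ¬ T (pivot lev blue T) y := fun h => hM ⟨y, hy.1, hy.2.1, h⟩

/-- The class just before a non-mixed pivot is entirely blue: a red member would lie after the blue
witness of the toggle, and so already be after the pivot. -/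
theorem Precedes.of_equiv (hT : LocalOrder par π F T) (hc : Coloring par π F lev blue)
    (hM : ¬ Mixed lev blue T) {y z : V}
    (hy : Precedes lev blue T y) (h1 : T y z) (h2 : T z y) : Precedes lev blue T z := by
  refine ⟨?_, hT.trans h2 hy.2.1, fun w hzw hwx => ?_⟩
  · by_contra hb
    obtain ⟨-, y', hy', hyx', hmin'⟩ := (hc.pivot_spec hT).1
    have h3 : ¬ T (pivot lev blue T) y' := fun h => hM ⟨y', hy', hyx', h⟩
    rcases hT.comparable (Or.inr hy.2.1) (Or.inr hyx') with h4 | h4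
    · rcases hy.2.2 y' h4 hyx' with h5 | h5
      · exact hy.not_le hM (hT.trans (hmin' z hb (hT.trans h5 h1)) h2)
      · exact h3 h5
    · exact hy.not_le hM (hT.trans (hmin' z hb (hT.trans h4 h1)) h2)
  · exact (hy.2.2 w (hT.trans h1 hzw) hwx).imp_left fun h => hT.trans h h1

theorem Glue.le (hT : LocalOrder par π F T) {x y : V} (h : Glue lev blue T x y) : T y x :=
  hT.trans h.2.2.1 h.1.2

theorem Glue.left (hT : LocalOrder par π F T) {x y : V} (h : Glue lev blue T x y) :
    π x = π (pivot lev blue T) := (hT.dom h.1.1).1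

theorem Glue.right (hT : LocalOrder par π F T) {x y : V} (h : Glue lev blue T x y) :
    π y = π (pivot lev blue T) := (hT.dom h.2.2.1).1

theorem Glue.not_le (hT : LocalOrder par π F T) (hM : ¬ Mixed lev blue T) {x y : V}
    (h : Glue lev blue T x y) : ¬ T x y := fun h' =>
  h.2.not_le hM (hT.trans h.1.2 h')

theorem Glue.red (hM : ¬ Mixed lev blue T) {x y : V} (h : Glue lev blue T x y) : ¬ blue x :=
  fun h' => hM ⟨x, h', h.1⟩

/-- Once the two classes are glued, children of a red and of a blue node in them acquire equivalent
parents and have to be compared. Putting red children before blue ones is the choice that only adds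
(red, blue) pairs. Most impossible combinations below would make a node both red and blue, or put a
node and its parent in the fibre of the pivot. -/
theorem Coloring.merge_localOrder (hc : Coloring par π F lev blue) (hT : LocalOrder par π F T)
    (hM : ¬ Mixed lev blue T) : LocalOrder par π F (merge par π lev blue T) where
  refl x := Or.inl (hT.refl x)
  trans {x y z} h1 h2 := by
    rcases h1 with h1 | h1 | ⟨e1, h1⟩ <;> rcases h2 with h2 | h2 | ⟨e2, h2⟩
    · exact Or.inl (hT.trans h1 h2)
    · have hx : T x (pivot lev blue T) := hT.trans h1 h2.1.1
      by_cases hx' : T (pivot lev blue T) x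
      · exact Or.inr (Or.inl ⟨⟨hx, hx'⟩, h2.2⟩)
      · rcases hT.comparable (Or.inr hx) (Or.inr h2.2.2.1) with h | h
        · exact Or.inl h
        · exact Or.inl ((h2.2.2.2 x h hx).resolve_right hx')
    · obtain ⟨e, q, r⟩ := hT.dom h1
      exact Or.inr (Or.inr ⟨e.trans e2, ⟨hT.trans q h2.1.1, hT.trans h2.1.2 r⟩, h2.2⟩)
    · by_cases hzy : T z y
      · exact Or.inr (Or.inl ⟨h1.1, h1.2.of_equiv hT hc hM h2 hzy⟩)
      · rcases hT.comparable (Or.inl h1.2.2.1) (Or.inl h2) with h | h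
        · exact Or.inl (hT.trans h1.1.1 h)
        · exact (h1.2.2.2 z h2 h).elim (absurd · hzy) fun h' => Or.inl (hT.trans h1.1.1 h')
    · exact absurd (h1.2.1) (h2.red hM)
    · exact absurd (h2.left hT) (hc.par_pivot_ne hT (h1.right hT))
    · obtain ⟨e, q, r⟩ := hT.dom h2
      exact Or.inr (Or.inr ⟨e1.trans e, h1.1, h1.2.of_equiv hT hc hM q r⟩)
    · exact absurd (h1.right hT) (hc.par_pivot_ne hT (h2.left hT))
    · exact absurd (h1.2.1) (h2.red hM)
  dom {x y} h := by
    rcases h with h | h | ⟨e, h⟩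
    · obtain ⟨p, q, r⟩ := hT.dom h
      exact ⟨p, Or.inl q, Or.inl r⟩
    · obtain ⟨p, q, r⟩ := hT.dom (h.le hT)
      exact ⟨p.symm, Or.inl r, Or.inl q⟩
    · exact ⟨e, Or.inr (Or.inl h), Or.inl (h.le hT)⟩
  total {x y} p q r := by
    rcases q with q | q | ⟨e1, q⟩ <;> rcases r with r | r | ⟨e2, r⟩
    · exact (hT.total p q r).imp Or.inl Or.inl
    · exact Or.inr (Or.inr (Or.inr ⟨p.symm, r⟩))
    · exact absurd (hT.dom q).2.2 (r.not_le hT hM)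
    · exact Or.inl (Or.inr (Or.inr ⟨p, q⟩))
    · exact absurd (q.2.1) (r.red hM)
    · exact absurd (r.left hT) (hc.par_pivot_ne hT (q.right hT))
    · exact absurd (hT.dom r).2.2 (q.not_le hT hM)
    · exact absurd (q.left hT) (hc.par_pivot_ne hT (r.right hT))
    · exact absurd (q.2.1) (r.red hM)
  fib h := Or.inl (hT.fib h)

theorem Coloring.merge_agreeOff (hc : Coloring par π F lev blue) (hT : LocalOrder par π F T)
    (hM : ¬ Mixed lev blue T) : AgreeOff blue T (merge par π lev blue T) := by
  intro x y hxy
  refine ⟨Or.inl, ?_⟩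
  rintro (h | h | ⟨e, h⟩)
  · exact h
  · exact absurd hxy (by simp [h.red hM, h.2.1])
  · have hx : ¬ blue x := (hc.blue_par hT (h.left hT)).not.2 (h.red hM)
    have hy : blue y := (hc.blue_par hT (h.right hT)).2 h.2.1
    exact absurd hxy (by simp [hx, hy])

theorem Coloring.merge_mixed (hc : Coloring par π F lev blue) (hT : LocalOrder par π F T)
    (hM : ¬ Mixed lev blue T) : Mixed lev blue (merge par π lev blue T) := by
  obtain ⟨y, hy⟩ := hc.exists_precedes hT hM
  refine ⟨y, hy.1, ?_, ?_⟩ <;> rw [← (hc.merge_agreeOff hT hM).pivot_eq]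
  · exact Or.inl hy.2.1
  · exact Or.inr (Or.inl ⟨⟨hT.refl _, hT.refl _⟩, hy⟩)

/-- A comparison inside `T` from the red to the blue half of the common pivot class would close a
cycle through the pivot and make `T` itself mixed. -/
theorem Coloring.not_cut_of_le (hc : Coloring par π F lev blue) (hT : LocalOrder par π F T)
    (hM : ¬ Mixed lev blue T) (hG : AgreeOff blue T T') {x y : V} (h : T x y) :
    ¬ Cut lev blue T' x y := by
  rintro ⟨hx, hy, h1, h2⟩
  rw [← hG.pivot_eq] at h1 h2
  have hr := hc.pivot_red hT
  have h3 : T (pivot lev blue T) x := (hG _ _ (Or.inr hx)).2 h1.2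
  have h4 : T y (pivot lev blue T) := (hG _ _ (Or.inl hy)).2 h2.1
  exact hM ⟨y, hy, h4, hT.trans h3 h⟩

/-- A non-mixed local preorder contained in a mixed one, with the same pivot, is contained in its
splitting. -/
theorem Coloring.le_split (hc : Coloring par π F lev blue) (hT : LocalOrder par π F T)
    (hM : ¬ Mixed lev blue T) (hG : AgreeOff blue T T') (hle : ∀ x y, T x y → T' x y) :
    ∀ x y, T x y → split par lev blue T' x y := fun x y h =>
  ⟨hle x y h, hc.not_cut_of_le hT hM hG h, hc.not_cut_of_le hT hM hG (hT.dom h).2.1⟩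

/-- Merging is the least way to make the pivot class mixed without touching the pairs that are not
(red, blue). Combined with a count of classes, this gives the uniqueness that makes the matching
acyclic. -/
theorem Coloring.merge_le (hc : Coloring par π F lev blue) (hT : LocalOrder par π F T)
    (hM : ¬ Mixed lev blue T) (hT' : LocalOrder par π F T') (hM' : Mixed lev blue T')
    (hG : AgreeOff blue T T') (hle : ∀ x y, T x y → T' x y) :
    ∀ x y, merge par π lev blue T x y → T' x y := by
  have key : ∀ x y, Glue lev blue T x y → T' x y := by
    intro x y h
    obtain ⟨y', hy', h1, h2⟩ := hM'
    rw [← hG.pivot_eq] at h1 h2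
    have h3 : T y' (pivot lev blue T) := (hG _ _ (Or.inl hy')).2 h1
    have h4 : T y' y := by
      rcases hT.comparable (Or.inr h3) (Or.inr h.2.2.1) with h5 | h5
      · exact h5
      · exact (h.2.2.2 y' h5 h3).resolve_right fun h6 => hM ⟨y', hy', h3, h6⟩
    exact hT'.trans (hle _ _ h.1.1) (hT'.trans h2 (hle _ _ h4))
  rintro x y (h | h | ⟨e, h⟩)
  · exact hle x y h
  · exact key x y h
  -- The parents are equivalent in `T'`, so the children are comparable there. The opposite order
  -- would start at a blue node, hence already hold in `T`, where the parents are not equivalent.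
  · refine (hT'.total e (key _ _ h) (hle _ _ (h.le hT))).resolve_right fun h1 => ?_
    have hy : blue y := (hc.blue_par hT (h.right hT)).2 h.2.1
    have h2 := (hG y x (Or.inl hy)).2 h1
    exact h.not_le hT hM (hT.dom h2).2.2

theorem Coloring.split_merge (hc : Coloring par π F lev blue) (hT : LocalOrder par π F T)
    (hM : ¬ Mixed lev blue T) : split par lev blue (merge par π lev blue T) = T := by
  have hG := hc.merge_agreeOff hT hM
  have key : ∀ x y, Glue lev blue T x y → Cut lev blue (merge par π lev blue T) x y := by
    intro x y h
    refine ⟨h.red hM, h.2.1, ?_, ?_⟩ <;> rw [← hG.pivot_eq]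
    · exact ⟨Or.inl h.1.1, Or.inl h.1.2⟩
    · exact ⟨Or.inl h.2.2.1, Or.inr (Or.inl ⟨⟨hT.refl _, hT.refl _⟩, h.2⟩)⟩
  funext x y
  refine propext ⟨?_, fun h => hc.le_split hT hM hG (fun _ _ => Or.inl) x y h⟩
  rintro ⟨h | h | ⟨-, h⟩, h1, h2⟩
  · exact h
  · exact absurd (key x y h) h1
  · exact absurd (key _ _ h) h2

/-! ### Counting classes -/

/-- The equivalence relation associated to a local preorder. -/
def LocalOrder.setoid (hT : LocalOrder par π F T) : Setoid V where
  r x y := T x y ∧ T y x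
  iseqv := ⟨fun x => ⟨hT.refl x, hT.refl x⟩, fun h => ⟨h.2, h.1⟩,
    fun h h' => ⟨hT.trans h.1 h'.1, hT.trans h'.2 h.2⟩⟩

/-- The number of classes of a local preorder. -/
noncomputable def LocalOrder.numClasses (hT : LocalOrder par π F T) : ℕ :=
  Nat.card (Quotient hT.setoid)

/-- Enlarging a local preorder maps its classes onto the new ones. If no class is lost, both have
the same equivalence, hence the same comparable pairs, and totality of the smaller one leaves no
room for further relations. -/
theorem LocalOrder.eq_of_le (hT : LocalOrder par π F T) (hT' : LocalOrder par π F T')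
    (hle : ∀ x y, T x y → T' x y) (hn : hT.numClasses ≤ hT'.numClasses) : T = T' := by
  let f : Quotient hT.setoid → Quotient hT'.setoid :=
    Quotient.map' id fun x y h => ⟨hle x y h.1, hle y x h.2⟩
  have hf : Function.Surjective f := by
    rintro ⟨x⟩; exact ⟨Quotient.mk _ x, rfl⟩
  have hi : Function.Injective f := by
    have h1 : Nat.card (Quotient hT'.setoid) ≤ Nat.card (Quotient hT.setoid) :=
      Nat.card_le_card_of_surjective f hf
    exact ((Nat.bijective_iff_surjective_and_card f).2 ⟨hf, le_antisymm hn h1⟩).1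
  have hE : ∀ {x y}, T' x y → T' y x → T x y ∧ T y x := fun {x y} h1 h2 =>
    Quotient.exact (hi (Quotient.sound (s := hT'.setoid) (a := x) (b := y) ⟨h1, h2⟩ :
      f (Quotient.mk _ x) = f (Quotient.mk _ y)))
  funext x y
  refine propext ⟨hle x y, fun h => ?_⟩
  obtain ⟨e, q, r⟩ := hT'.dom h
  obtain ⟨q', r'⟩ := hE q r
  rcases hT.total e q' r' with h1 | h1
  · exact h1
  · exact (hE h (hle _ _ h1)).1

/-- A surjection between finite types which identifies exactly two elements. -/
theorem card_eq_succ_of_collision {A B : Type*} [Finite A] (f : A → B)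
    (hf : Function.Surjective f) {a b : A} (hab : a ≠ b) (h : f a = f b)
    (h' : ∀ x y, f x = f y → x = y ∨ (x = a ∧ y = b) ∨ (x = b ∧ y = a)) :
    Nat.card A = Nat.card B + 1 := by
  classical
  have : Fintype A := Fintype.ofFinite A
  have e : Nat.card {x // x ≠ a} = Nat.card B := by
    refine Nat.card_congr (Equiv.ofBijective (fun x : {x // x ≠ a} => f x.1) ⟨?_, ?_⟩)
    · rintro ⟨x, hx⟩ ⟨y, hy⟩ hxy
      rcases h' x y hxy with h1 | h1 | h1
      · exact Subtype.ext h1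
      · exact absurd h1.1 hx
      · exact absurd h1.2 hy
    · intro z
      obtain ⟨x, rfl⟩ := hf z
      by_cases hx : x = a
      · exact ⟨⟨b, hab.symm⟩, by rw [hx]; exact h.symm⟩
      · exact ⟨⟨x, hx⟩, rfl⟩
  have h2 : 0 < Fintype.card A := Fintype.card_pos_iff.2 ⟨a⟩
  rw [← e, Nat.card_eq_fintype_card, Nat.card_eq_fintype_card, Fintype.card_subtype_compl,
    Fintype.card_subtype_eq]
  omega

/-- Only the pivot class breaks, into one red and one blue class, so the projection between the
quotients identifies exactly one pair. In terms of trees, the middle tree gains one vertex. -/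
theorem Coloring.numClasses_split (hc : Coloring par π F lev blue) (hT : LocalOrder par π F T)
    (hM : Mixed lev blue T) :
    (hc.split_localOrder hT).numClasses = hT.numClasses + 1 := by
  obtain ⟨y, hy, h1, h2⟩ := hM
  let f : Quotient (hc.split_localOrder hT).setoid → Quotient hT.setoid :=
    Quotient.map' id fun x y h => ⟨h.1.1, h.2.1⟩
  have hr := hc.pivot_red hT
  have hm : ∀ {x y}, (T x (pivot lev blue T) ∧ T (pivot lev blue T) x) →
      (T y (pivot lev blue T) ∧ T (pivot lev blue T) y) → (blue x ↔ blue y) →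
      split par lev blue T x y := fun {x y} hx hy hxy =>
    ⟨hT.trans hx.1 hy.2, fun h => h.1 (hxy.2 h.2.1), fun h =>
      hc.par_pivot_ne hT (hT.dom hx.1).1 (h.left hT)⟩
  refine card_eq_succ_of_collision f (by rintro ⟨x⟩; exact ⟨Quotient.mk _ x, rfl⟩)
    (a := Quotient.mk _ (pivot lev blue T)) (b := Quotient.mk _ y) ?_ ?_ ?_
  · intro h
    exact (Quotient.exact h).1.2.1 ⟨hr, hy, ⟨hT.refl _, hT.refl _⟩, h1, h2⟩
  · exact Quotient.sound (s := hT.setoid) ⟨h2, h1⟩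
  · rintro ⟨x⟩ ⟨z⟩ h
    obtain ⟨hxz, hzx⟩ : T x z ∧ T z x := Quotient.exact h
    have hp : ∀ {a b}, T a b → T b a → ¬ Cut lev blue T (par a) (par b) := fun _ hba h' =>
      (hc.cut_par hT h').2.2 hba
    have eP : (T (pivot lev blue T) (pivot lev blue T) ∧ T (pivot lev blue T) (pivot lev blue T)) :=
      ⟨hT.refl _, hT.refl _⟩
    by_cases c1 : Cut lev blue T x z
    · refine Or.inr (Or.inl ⟨Quotient.sound ⟨?_, ?_⟩, Quotient.sound ⟨?_, ?_⟩⟩)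
      · exact hm c1.2.2.1 eP (by simp [c1.1, hr])
      · exact hm eP c1.2.2.1 (by simp [c1.1, hr])
      · exact hm c1.2.2.2 ⟨h1, h2⟩ (by simp [c1.2.1, hy])
      · exact hm ⟨h1, h2⟩ c1.2.2.2 (by simp [c1.2.1, hy])
    · by_cases c2 : Cut lev blue T z x
      · refine Or.inr (Or.inr ⟨Quotient.sound ⟨?_, ?_⟩, Quotient.sound ⟨?_, ?_⟩⟩)
        · exact hm c2.2.2.2 ⟨h1, h2⟩ (by simp [c2.2.1, hy])
        · exact hm ⟨h1, h2⟩ c2.2.2.2 (by simp [c2.2.1, hy])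
        · exact hm c2.2.2.1 eP (by simp [c2.1, hr])
        · exact hm eP c2.2.2.1 (by simp [c2.1, hr])
      · exact Or.inl (Quotient.sound ⟨⟨hxz, c1, hp hxz hzx⟩, ⟨hzx, c2, hp hzx hxz⟩⟩)

end Matching

/-! ## Nodes of trees -/

namespace PTree

variable {n : ℕ}

/-- The vertices of a tree at all levels (including the root). -/
abbrev Node (τ : PTree n) : Type := Σ i : Fin (n + 1), Fin (τ.size i)

/-- The parent of a node (the root is its own parent). -/
def par (τ : PTree n) (v : Node τ) : Node τ :=
  Fin.lastCases (motive := fun i => Fin (τ.size i) → Node τ) (fun x => ⟨Fin.last n, x⟩)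
    (fun i x => ⟨i.succ, τ.map i x⟩) v.1 v.2

theorem par_castSucc (τ : PTree n) (i : Fin n) (x : Fin (τ.size i.castSucc)) :
    par τ ⟨i.castSucc, x⟩ = ⟨i.succ, τ.map i x⟩ := by
  simp [par]

theorem par_last (τ : PTree n) (x : Fin (τ.size (Fin.last n))) :
    par τ ⟨Fin.last n, x⟩ = ⟨Fin.last n, x⟩ := by
  simp [par]

theorem root_unique (τ : PTree n) (x y : Fin (τ.size (Fin.last n))) : x = y := by
  have := τ.size_last
  apply Fin.ext
  have := x.2
  have := y.2
  omega

/-- The map on nodes given by a morphism. -/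
def onNode {τ σ : PTree n} (u : τ ⟶ σ) (v : Node τ) : Node σ := ⟨v.1, u.app _ v.2⟩

section

variable {τ σ θ : PTree n}

theorem onNode_par (u : τ ⟶ σ) (v : Node τ) : onNode u (par τ v) = par σ (onNode u v) := by
  obtain ⟨i, x⟩ := v
  induction i using Fin.lastCases with
  | last =>
    rw [par_last]
    change _ = par σ ⟨Fin.last n, u.app _ x⟩
    rw [par_last]
    rfl
  | cast i =>
    rw [par_castSucc]
    change _ = par σ ⟨i.castSucc, u.app _ x⟩
    rw [par_castSucc, u.comm]
    rfl

theorem onNode_surjective (u : τ ⟶ σ) : Function.Surjective (onNode u) := by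
  rintro ⟨i, y⟩
  obtain ⟨x, rfl⟩ := u.surj i y
  exact ⟨⟨i, x⟩, rfl⟩

theorem onNode_comp (u : τ ⟶ θ) (v : θ ⟶ σ) (x : Node τ) :
    onNode (u ≫ v) x = onNode v (onNode u x) := rfl

theorem hom_ext_node {u v : τ ⟶ σ} (h : ∀ x, onNode u x = onNode v x) : u = v :=
  hom_ext fun i x => by simpa [onNode] using h ⟨i, x⟩

theorem node_le_iff {i : Fin (n + 1)} {x y : Fin (τ.size i)} :
    (⟨i, x⟩ : Node τ) ≤ ⟨i, y⟩ ↔ x ≤ y := Sigma.mk_le_mk_iff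

theorem level_eq_of_le {v w : Node τ} (h : v ≤ w) : v.1 = w.1 := by
  rcases h with ⟨i, a, b, h⟩; rfl

theorem node_le_total {v w : Node τ} (h : v.1 = w.1) : v ≤ w ∨ w ≤ v := by
  obtain ⟨i, x⟩ := v
  obtain ⟨j, y⟩ := w
  obtain rfl : i = j := h
  simp only [node_le_iff]
  exact le_total x y

theorem par_mono {v w : Node τ} (h : v ≤ w) : par τ v ≤ par τ w := by
  rcases h with ⟨i, a, b, h⟩
  induction i using Fin.lastCases with
  | last => rw [root_unique τ a b]
  | cast i => rw [par_castSucc, par_castSucc, node_le_iff]; exact τ.mono i h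

theorem onNode_mono (u : τ ⟶ σ) {v w : Node τ} (hp : par τ v = par τ w) (h : v ≤ w) :
    onNode u v ≤ onNode u w := by
  rcases h with ⟨i, a, b, h⟩
  induction i using Fin.lastCases with
  | last => rw [root_unique τ a b]
  | cast i =>
    rw [par_castSucc, par_castSucc] at hp
    exact node_le_iff.2 (u.mono i a b (by simpa using hp) h)

theorem level_eq_of_onNode_eq (u : τ ⟶ σ) {v w : Node τ} (h : onNode u v = onNode u w) :
    v.1 = w.1 :=
  congrArg (fun z : Node σ => z.1) h

theorem level_par_eq {v w : Node τ} (h : v.1 = w.1) : (par τ v).1 = (par τ w).1 := by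
  obtain ⟨i, x⟩ := v
  obtain ⟨j, y⟩ := w
  obtain rfl : i = j := h
  induction i using Fin.lastCases with
  | last => rw [root_unique τ x y]
  | cast i => rw [par_castSucc, par_castSucc]

/-- A morphism given by its action on nodes. -/
theorem exists_hom (g : Node τ → Node σ) (hl : ∀ v, (g v).1 = v.1) (hs : Function.Surjective g)
    (hp : ∀ v, g (par τ v) = par σ (g v))
    (hm : ∀ v w, par τ v = par τ w → v ≤ w → g v ≤ g w) : ∃ u : τ ⟶ σ, ∀ v, onNode u v = g v := by
  have h : ∀ i (x : Fin (τ.size i)), ∃ y : Fin (σ.size i), g ⟨i, x⟩ = ⟨i, y⟩ := by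
    intro i x
    have h1 := hl ⟨i, x⟩
    generalize g ⟨i, x⟩ = z at h1
    obtain ⟨j, y⟩ := z
    obtain rfl : j = i := h1
    exact ⟨y, rfl⟩
  choose f hf using h
  refine ⟨⟨f, ?_, ?_, ?_⟩, fun v => (hf v.1 v.2).symm⟩
  · intro i y
    obtain ⟨⟨j, x⟩, hx⟩ := hs ⟨i, y⟩
    obtain rfl : j = i := by
      have := hl ⟨j, x⟩
      rw [hx] at this
      exact this.symm
    rw [hf] at hx
    exact ⟨x, by simpa using hx⟩
  · intro i x
    have h1 := hp ⟨i.castSucc, x⟩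
    rw [par_castSucc, hf, hf, par_castSucc] at h1
    simpa using h1.symm
  · intro i x y h1 h2
    have h3 := hm ⟨i.castSucc, x⟩ ⟨i.castSucc, y⟩ (by rw [par_castSucc, par_castSucc, h1])
      (node_le_iff.2 h2)
    rwa [hf, hf, node_le_iff] at h3

/-- The extra unit is the root, which `deg` does not count. -/
theorem card_node (τ : PTree n) : Nat.card (Node τ) = τ.deg + 1 := by
  rw [Nat.card_eq_fintype_card, Fintype.card_sigma]
  simp [Fin.sum_univ_castSucc, deg, τ.size_last]

/-! ### Factorizations as local preorders. -/

/-- Elements with the same parent and the same image, in non-decreasing order. -/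
def FibLE (u : τ ⟶ σ) (x y : Node τ) : Prop :=
  par τ x = par τ y ∧ x ≤ y ∧ onNode u x = onNode u y

/-- The local preorder associated to a factorization. -/
def factOrder {u : τ ⟶ σ} (f : Fact u) (x y : Node τ) : Prop :=
  onNode u x = onNode u y ∧ onNode f.w (par τ x) = onNode f.w (par τ y) ∧
    onNode f.w x ≤ onNode f.w y

/-- The local preorders on the nodes of the source of `u`. -/
abbrev IsLocalOrder (u : τ ⟶ σ) (T : Node τ → Node τ → Prop) : Prop :=
  LocalOrder (par τ) (onNode u) (FibLE u) T

theorem Fact.onNode_v {u : τ ⟶ σ} (f : Fact u) (x : Node τ) :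
    onNode f.v (onNode f.w x) = onNode u x := by
  rw [← onNode_comp, f.comp_eq]

theorem factOrder_localOrder {u : τ ⟶ σ} (f : Fact u) : IsLocalOrder u (factOrder f) where
  refl x := ⟨rfl, rfl, le_rfl⟩
  trans h h' := ⟨h.1.trans h'.1, h.2.1.trans h'.2.1, h.2.2.trans h'.2.2⟩
  dom {x y} h := by
    have h1 : onNode u (par τ x) = onNode u (par τ y) := by rw [onNode_par, onNode_par, h.1]
    have h2 : onNode f.w (par τ (par τ x)) = onNode f.w (par τ (par τ y)) := by
      rw [onNode_par _ (par τ x), onNode_par _ (par τ y), h.2.1]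
    exact ⟨h.1, ⟨h1, h2, h.2.1.le⟩, ⟨h1.symm, h2.symm, h.2.1.ge⟩⟩
  total {x y} h h1 h2 := by
    have h3 := le_antisymm h1.2.2 h2.2.2
    have h4 : (onNode f.w x).1 = (onNode f.w y).1 := level_eq_of_onNode_eq u h
    exact (node_le_total h4).imp (fun h5 => ⟨h, h3, h5⟩) fun h5 => ⟨h.symm, h3.symm, h5⟩
  fib h := ⟨h.2.2, by rw [h.1], onNode_mono f.w h.1 h.2.1⟩

theorem factOrder_equiv {u : τ ⟶ σ} (f : Fact u) {x y : Node τ} :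
    (factOrder f x y ∧ factOrder f y x) ↔ onNode f.w x = onNode f.w y := by
  refine ⟨fun h => le_antisymm h.1.2.2 h.2.2.2, fun h => ?_⟩
  have h1 : onNode u x = onNode u y := by rw [← f.onNode_v, ← f.onNode_v, h]
  have h2 : onNode f.w (par τ x) = onNode f.w (par τ y) := by rw [onNode_par, onNode_par, h]
  exact ⟨⟨h1, h2, h.le⟩, ⟨h1.symm, h2.symm, h.ge⟩⟩

theorem numClasses_factOrder {u : τ ⟶ σ} (f : Fact u) :
    (factOrder_localOrder f).numClasses = f.mid.deg + 1 := by
  rw [← card_node]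
  refine Nat.card_congr (Equiv.ofBijective (Quotient.lift (onNode f.w) fun x y h =>
    (factOrder_equiv f).1 h) ⟨?_, ?_⟩)
  · rintro ⟨x⟩ ⟨y⟩ h
    exact Quotient.sound ((factOrder_equiv f).2 h)
  · intro y
    obtain ⟨x, rfl⟩ := onNode_surjective f.w y
    exact ⟨Quotient.mk _ x, rfl⟩

instance epi_hom (u : τ ⟶ σ) : Epi u where
  left_cancellation g h e := hom_ext_node fun y => by
    obtain ⟨x, rfl⟩ := onNode_surjective u y
    rw [← onNode_comp, ← onNode_comp, e]

/-- Inclusion of preorders makes `g.w` constant on the fibres of `f.w`, so it descends to a map `z`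
of nodes; the triangle with the second factors follows since `f.w` is epi. The delicate point is
monotonicity of `z` on siblings. -/
theorem exists_hom_of_factOrder_le {u : τ ⟶ σ} {f g : Fact u}
    (h : ∀ x y, factOrder f x y → factOrder g x y) :
    ∃ z : f.mid ⟶ g.mid, f.w ≫ z = g.w ∧ z ≫ g.v = f.v := by
  have hE : ∀ {x y}, onNode f.w x = onNode f.w y → onNode g.w x = onNode g.w y := fun {x y} e => by
    rw [← factOrder_equiv] at e ⊢
    exact ⟨h _ _ e.1, h _ _ e.2⟩
  let r := Function.surjInv (onNode_surjective f.w)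
  have hr : ∀ a, onNode f.w (r a) = a := Function.surjInv_eq _
  have hz : ∀ x, onNode g.w (r (onNode f.w x)) = onNode g.w x := fun x => hE (hr _)
  obtain ⟨z, hz'⟩ := exists_hom (fun a => onNode g.w (r a))
    (fun a => congrArg Sigma.fst (hr a))
    (fun b => by
      obtain ⟨x, rfl⟩ := onNode_surjective g.w b
      exact ⟨onNode f.w x, hz x⟩)
    (fun a => by
      obtain ⟨x, rfl⟩ := onNode_surjective f.w a
      rw [hz, ← onNode_par, hz, onNode_par])
    (fun a b hp hab => by
      obtain ⟨x, rfl⟩ := onNode_surjective f.w a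
      obtain ⟨y, rfl⟩ := onNode_surjective f.w b
      rw [hz, hz]
      have h1 : onNode f.w (par τ x) = onNode f.w (par τ y) := by
        rw [onNode_par, onNode_par, hp]
      have h2 : onNode u x ≤ onNode u y := by
        have := onNode_mono f.v hp hab
        rwa [f.onNode_v, f.onNode_v] at this
      by_cases e : onNode u x = onNode u y
      · exact (h x y ⟨e, h1, hab⟩).2.2
      -- The local preorder says nothing about nodes with different images under `u`. There `f.v`
      -- and `g.v` are both non-decreasing on siblings, so the order in `σ` dictates the order in
      -- both middle trees.
      · have h3 : (onNode g.w x).1 = (onNode g.w y).1 :=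
          level_eq_of_le (v := onNode u x) (w := onNode u y) h2
        refine (node_le_total h3).resolve_right fun h4 => e (le_antisymm h2 ?_)
        have h5 : par g.mid (onNode g.w y) = par g.mid (onNode g.w x) := by
          rw [← onNode_par, ← onNode_par, hE h1]
        have := onNode_mono g.v h5 h4
        rwa [g.onNode_v, g.onNode_v] at this)
  have e1 : f.w ≫ z = g.w := hom_ext_node fun x => by rw [onNode_comp, hz', hz]
  refine ⟨z, e1, ?_⟩
  rw [← cancel_epi f.w, ← Category.assoc, e1, g.comp_eq, f.comp_eq]

theorem factOrder_le_of_hom {u : τ ⟶ σ} {f g : Fact u} (z : f.mid ⟶ g.mid)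
    (h1 : f.w ≫ z = g.w) :
    ∀ x y, factOrder f x y → factOrder g x y := by
  intro x y h
  have hw : ∀ x, onNode g.w x = onNode z (onNode f.w x) := fun x => by
    rw [← onNode_comp, h1]
  refine ⟨h.1, ?_, ?_⟩
  · rw [hw, hw, h.2.1]
  · rw [hw, hw]
    refine onNode_mono z ?_ h.2.2
    rw [← onNode_par, ← onNode_par, h.2.1]

/-- Comparison morphisms exist both ways; since degrees cannot increase along a morphism, the middle
trees are equal, and an endomorphism of a tree is the identity. -/
theorem factOrder_injective {u : τ ⟶ σ} {f g : Fact u} (h : factOrder f = factOrder g) :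
    f = g := by
  obtain ⟨z, hz1, hz2⟩ := exists_hom_of_factOrder_le (f := f) (g := g) (by rw [h]; exact fun _ _ => id)
  obtain ⟨z', -, -⟩ := exists_hom_of_factOrder_le (f := g) (g := f) (by rw [h]; exact fun _ _ => id)
  obtain ⟨θ, w, v, e⟩ := f
  obtain ⟨θ', w', v', e'⟩ := g
  obtain rfl : θ = θ' := eq_of_deg_le z (deg_le z')
  obtain rfl := end_eq_id z
  simp only [Category.comp_id, Category.id_comp] at hz1 hz2
  subst hz1 hz2
  rfl

/-! ### Trees from local preorders -/

/-- Compresses the values of a numerical key to an initial segment, to obtain the levels of a tree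
in the form `Fin s`. -/
theorem exists_rank {m : ℕ} (K : Fin m → ℕ) : ∃ (s : ℕ) (r : Fin m → Fin s),
    Function.Surjective r ∧ ∀ x y, r x ≤ r y ↔ K x ≤ K y := by
  let A := Finset.univ.image K
  let e := A.orderIsoOfFin rfl
  have hA : ∀ x, K x ∈ A := fun x => Finset.mem_image_of_mem _ (Finset.mem_univ x)
  refine ⟨A.card, fun x => e.symm ⟨K x, hA x⟩, fun c => ?_, fun x y => ?_⟩
  · obtain ⟨x, -, hx⟩ := Finset.mem_image.1 (e c).2
    refine ⟨x, ?_⟩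
    rw [OrderIso.symm_apply_eq]
    exact Subtype.ext hx
  · rw [e.symm.le_iff_le, Subtype.mk_le_mk]

/-- The preorder on siblings given by a local preorder and the order of the target. -/
def SibLE (u : τ ⟶ σ) (T : Node τ → Node τ → Prop) (x y : Node τ) : Prop :=
  (T (par τ x) (par τ y) ∧ T (par τ y) (par τ x)) ∧ onNode u x ≤ onNode u y ∧
    (onNode u x = onNode u y → T x y)

theorem SibLE.trans {u : τ ⟶ σ} {T : Node τ → Node τ → Prop} (hT : IsLocalOrder u T)
    {x y z : Node τ} (h : SibLE u T x y) (h' : SibLE u T y z) : SibLE u T x z := by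
  refine ⟨⟨hT.trans h.1.1 h'.1.1, hT.trans h'.1.2 h.1.2⟩, h.2.1.trans h'.2.1, fun e => ?_⟩
  have e1 : onNode u x = onNode u y := le_antisymm h.2.1 (e ▸ h'.2.1)
  exact hT.trans (h.2.2 e1) (h'.2.2 (e1.symm.trans e))

theorem SibLE.total {u : τ ⟶ σ} {T : Node τ → Node τ → Prop} (hT : IsLocalOrder u T)
    {x y : Node τ} (hl : x.1 = y.1) (h : T (par τ x) (par τ y) ∧ T (par τ y) (par τ x)) :
    SibLE u T x y ∨ SibLE u T y x := by
  by_cases e : onNode u x = onNode u y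
  · exact (hT.total e h.1 h.2).imp (fun h1 => ⟨h, e.le, fun _ => h1⟩)
      fun h1 => ⟨h.symm, e.ge, fun _ => h1⟩
  · exact (node_le_total (τ := σ) (v := onNode u x) (w := onNode u y) hl).imp
      (fun h1 => ⟨h, h1, fun e' => absurd e' e⟩) fun h1 => ⟨h.symm, h1, fun e' => absurd e'.symm e⟩

/-- The number of strict predecessors of a node among its siblings. -/
noncomputable def sibRank (u : τ ⟶ σ) (T : Node τ → Node τ → Prop) (x : Node τ) : ℕ :=
  {y | SibLE u T y x ∧ ¬ SibLE u T x y}.ncard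

theorem sibRank_le_iff {u : τ ⟶ σ} {T : Node τ → Node τ → Prop} (hT : IsLocalOrder u T)
    {x y : Node τ} (hl : x.1 = y.1) (h : T (par τ x) (par τ y) ∧ T (par τ y) (par τ x)) :
    sibRank u T x ≤ sibRank u T y ↔ SibLE u T x y := by
  have mono : ∀ {x y}, SibLE u T x y → {z | SibLE u T z x ∧ ¬ SibLE u T x z} ⊆
      {z | SibLE u T z y ∧ ¬ SibLE u T y z} := fun {x y} h1 z hz =>
    ⟨hz.1.trans hT h1, fun h2 => hz.2 (h1.trans hT h2)⟩
  refine ⟨fun h1 => ?_, fun h1 => Set.ncard_le_ncard (mono h1) (Set.toFinite _)⟩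
  by_contra h2
  have h3 := (SibLE.total hT hl h).resolve_left h2
  refine h1.not_gt (Set.ncard_lt_ncard ⟨mono h3, fun h4 => ?_⟩ (Set.toFinite _))
  exact (h4 (⟨h3, h2⟩ : y ∈ {z | SibLE u T z x ∧ ¬ SibLE u T x z})).2
    (h4 (⟨h3, h2⟩ : y ∈ {z | SibLE u T z x ∧ ¬ SibLE u T x z})).1

theorem sibRank_lt (u : τ ⟶ σ) (T : Node τ → Node τ → Prop) (x : Node τ) :
    sibRank u T x < Nat.card (Node τ) + 1 := by
  have h := Set.ncard_le_ncard (Set.subset_univ {y | SibLE u T y x ∧ ¬ SibLE u T x y})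
    (Set.toFinite _)
  rw [Set.ncard_univ] at h
  exact Nat.lt_succ_of_le h

/-- A numerical key for the order on nodes given by a local preorder. -/
noncomputable def key (u : τ ⟶ σ) (T : Node τ → Node τ → Prop) (i : Fin (n + 1)) :
    Fin (τ.size i) → ℕ :=
  Fin.reverseInduction (motive := fun i => Fin (τ.size i) → ℕ) (fun _ => 0)
    (fun i K x => sibRank u T ⟨i.castSucc, x⟩ + (Nat.card (Node τ) + 1) * K (τ.map i x)) i

theorem key_castSucc (u : τ ⟶ σ) (T : Node τ → Node τ → Prop) (i : Fin n)
    (x : Fin (τ.size i.castSucc)) : key u T i.castSucc x =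
      sibRank u T ⟨i.castSucc, x⟩ + (Nat.card (Node τ) + 1) * key u T i.succ (τ.map i x) := by
  simp [key]

/-- Lexicographic comparison encoded by two digits in base `N`; it orders the nodes of a level first
by their parents, then among siblings. -/
theorem lex_le_iff {a b p q N : ℕ} (ha : a < N) (hb : b < N) :
    a + N * p ≤ b + N * q ↔ p < q ∨ (p = q ∧ a ≤ b) := by
  rcases lt_trichotomy p q with h | h | h
  · have : N * (p + 1) ≤ N * q := Nat.mul_le_mul_left _ h
    rw [mul_add] at this
    simp only [h, true_or, iff_true]
    omega
  · subst h; simp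
  · have : N * (q + 1) ≤ N * p := Nat.mul_le_mul_left _ h
    rw [mul_add] at this
    simp only [h.not_gt, h.ne', false_and, or_false, iff_false]
    omega

theorem key_castSucc_le_iff (u : τ ⟶ σ) (T : Node τ → Node τ → Prop) (i : Fin n)
    (x y : Fin (τ.size i.castSucc)) : key u T i.castSucc x ≤ key u T i.castSucc y ↔
      key u T i.succ (τ.map i x) < key u T i.succ (τ.map i y) ∨
      (key u T i.succ (τ.map i x) = key u T i.succ (τ.map i y) ∧
        sibRank u T ⟨i.castSucc, x⟩ ≤ sibRank u T ⟨i.castSucc, y⟩) := by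
  rw [key_castSucc, key_castSucc, lex_le_iff (sibRank_lt u T _) (sibRank_lt u T _)]

/-- Starting from the root, equal keys mean equivalent parents and equal rank among siblings.
Siblings of equal rank have the same image under `u`, since that image is compared first, and are
then equivalent under `T`. -/
theorem key_eq_iff {u : τ ⟶ σ} {T : Node τ → Node τ → Prop} (hT : IsLocalOrder u T)
    (i : Fin (n + 1)) (x y : Fin (τ.size i)) :
    key u T i x = key u T i y ↔ (T ⟨i, x⟩ ⟨i, y⟩ ∧ T ⟨i, y⟩ ⟨i, x⟩) := by
  induction i using Fin.reverseInduction with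
  | last => rw [root_unique τ x y]; simp [hT.refl]
  | cast i ih =>
    have e : key u T i.castSucc x = key u T i.castSucc y ↔
        key u T i.succ (τ.map i x) = key u T i.succ (τ.map i y) ∧
        (sibRank u T ⟨i.castSucc, x⟩ ≤ sibRank u T ⟨i.castSucc, y⟩ ∧
          sibRank u T ⟨i.castSucc, y⟩ ≤ sibRank u T ⟨i.castSucc, x⟩) := by
      rw [le_antisymm_iff, key_castSucc_le_iff, key_castSucc_le_iff]
      omega
    rw [e, ih]
    constructor
    · rintro ⟨h1, h2, h3⟩
      rw [← par_castSucc, ← par_castSucc] at h1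
      rw [sibRank_le_iff hT (by rfl) h1] at h2
      rw [sibRank_le_iff hT (by rfl) h1.symm] at h3
      have h4 := le_antisymm h2.2.1 h3.2.1
      exact ⟨h2.2.2 h4, h3.2.2 h4.symm⟩
    · rintro ⟨h1, h2⟩
      obtain ⟨h3, h4⟩ := hT.dom h1
      refine ⟨by rw [← par_castSucc, ← par_castSucc]; exact h4, ?_, ?_⟩
      · exact (sibRank_le_iff hT (by rfl) h4).2 ⟨h4, h3.le, fun _ => h1⟩
      · exact (sibRank_le_iff hT (by rfl) h4.symm).2 ⟨h4.symm, h3.ge, fun _ => h2⟩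

theorem key_castSucc_le_iff' {u : τ ⟶ σ} {T : Node τ → Node τ → Prop} (hT : IsLocalOrder u T)
    (i : Fin n) (x y : Fin (τ.size i.castSucc)) :
    key u T i.castSucc x ≤ key u T i.castSucc y ↔
      key u T i.succ (τ.map i x) < key u T i.succ (τ.map i y) ∨
      SibLE u T ⟨i.castSucc, x⟩ ⟨i.castSucc, y⟩ := by
  rw [key_castSucc_le_iff]
  refine or_congr_right ⟨fun h => ?_, fun h => ?_⟩
  · have h1 := (key_eq_iff hT _ _ _).1 h.1
    rw [← par_castSucc, ← par_castSucc] at h1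
    exact (sibRank_le_iff hT (by rfl) h1).1 h.2
  · refine ⟨(key_eq_iff hT _ _ _).2 ?_, (sibRank_le_iff hT (by rfl) h.1).2 h⟩
    have := h.1
    rwa [par_castSucc, par_castSucc] at this

/-- Every local preorder comes from a factorization. -/
theorem exists_factOrder_eq {u : τ ⟶ σ} {T : Node τ → Node τ → Prop} (hT : IsLocalOrder u T) :
    ∃ f : Fact u, factOrder f = T := by
  -- Level `i` of the middle tree is the ordered set of values of the key on level `i` of `τ`, and
  -- `r` is the first factor.
  choose s r hs hr using fun i => exists_rank (key u T i)
  have hre : ∀ i x y, r i x = r i y ↔ (T ⟨i, x⟩ ⟨i, y⟩ ∧ T ⟨i, y⟩ ⟨i, x⟩) := fun i x y => by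
    rw [← key_eq_iff hT, le_antisymm_iff, le_antisymm_iff, hr, hr]
  have hpar : ∀ (i : Fin n) x y, r i.castSucc x = r i.castSucc y →
      r i.succ (τ.map i x) = r i.succ (τ.map i y) := fun i x y h => by
    rw [hre] at h ⊢
    have := (hT.dom h.1).2
    rwa [par_castSucc, par_castSucc] at this
  have hu : ∀ i x y, r i x = r i y → u.app i x = u.app i y := fun i x y h => by
    rw [hre] at h
    simpa [onNode] using (hT.dom h.1).1
  -- An arbitrary section of `r`: by `hpar` and `hu` the structure maps and `u` are constant on the
  -- fibres of `r`, so the choice does not matter.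
  let q : ∀ i, Fin (s i) → Fin (τ.size i) := fun i => Function.surjInv (hs i)
  have hq : ∀ i c, r i (q i c) = c := fun i c => Function.surjInv_eq _ _
  let θ : PTree n :=
    { size := s
      map := fun i c => r i.succ (τ.map i (q i.castSucc c))
      mono := fun i c c' hcc => by
        rw [← hq _ c, ← hq _ c', hr, key_castSucc_le_iff] at hcc
        rw [hr]
        omega
      surj := fun i d => by
        obtain ⟨x, rfl⟩ := hs _ d
        obtain ⟨y, rfl⟩ := τ.surj i x
        exact ⟨r i.castSucc y, hpar i _ _ (hq _ _)⟩
      size_last := by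
        have h1 := Fintype.card_le_of_surjective _ (hs (Fin.last n))
        simp only [Fintype.card_fin, τ.size_last] at h1
        have h2 := (r (Fin.last n) ⟨0, by rw [τ.size_last]; exact one_pos⟩).2
        omega }
  let w : τ ⟶ θ :=
    { app := r
      surj := hs
      comm := fun i x => hpar i _ _ (hq _ _)
      mono := fun i x y h1 h2 => by
        rw [hr, key_castSucc_le_iff' hT]
        right
        have hp : par τ ⟨i.castSucc, x⟩ = par τ ⟨i.castSucc, y⟩ := by
          rw [par_castSucc, par_castSucc, h1]
        refine ⟨?_, onNode_mono u hp (node_le_iff.2 h2), fun e =>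
          hT.fib ⟨hp, node_le_iff.2 h2, e⟩⟩
        rw [hp]
        exact ⟨hT.refl _, hT.refl _⟩ }
  let v : θ ⟶ σ :=
    { app := fun i c => u.app i (q i c)
      surj := fun i z => by
        obtain ⟨x, rfl⟩ := u.surj i z
        exact ⟨r i x, hu i _ _ (hq _ _)⟩
      comm := fun i c => by
        rw [u.comm]
        exact hu _ _ _ (hq _ _).symm
      mono := fun i c c' h1 h2 => by
        rw [← hq _ c, ← hq _ c', hr, key_castSucc_le_iff' hT] at h2
        -- Equal parents in the middle tree exclude a strict inequality of parent keys, so the order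
        -- comes from `SibLE`, which respects the order of `σ`.
        have h3 : r i.succ (τ.map i (q i.castSucc c)) = r i.succ (τ.map i (q i.castSucc c')) := h1
        rw [hre, ← key_eq_iff hT] at h3
        exact node_le_iff.1 (h2.resolve_left h3.not_lt).2.1 }
  refine ⟨⟨θ, w, v, hom_ext fun i x => hu _ _ _ (hq _ _)⟩, ?_⟩
  funext x y
  apply propext
  obtain ⟨i, x⟩ := x
  obtain ⟨j, y⟩ := y
  by_cases hij : i = j
  · subst hij
    have hw : ∀ i x, onNode w ⟨i, x⟩ = ⟨i, r i x⟩ := fun _ _ => rfl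
    unfold factOrder
    change (_ ∧ onNode w _ = onNode w _ ∧ onNode w _ ≤ onNode w _) ↔ _
    induction i using Fin.lastCases with
    | last => rw [root_unique τ x y]; simp [hT.refl]
    | cast i =>
      have e1 : onNode w (par τ ⟨i.castSucc, x⟩) = onNode w (par τ ⟨i.castSucc, y⟩) ↔
          (T (par τ ⟨i.castSucc, x⟩) (par τ ⟨i.castSucc, y⟩) ∧
            T (par τ ⟨i.castSucc, y⟩) (par τ ⟨i.castSucc, x⟩)) := by
        rw [par_castSucc, par_castSucc, hw, hw, ← hre]
        simp
      have e2 : onNode w ⟨i.castSucc, x⟩ ≤ onNode w ⟨i.castSucc, y⟩ ↔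
          key u T i.castSucc x ≤ key u T i.castSucc y := by
        rw [hw, hw, ← hr]
        exact Sigma.mk_le_mk_iff
      rw [e1, e2, key_castSucc_le_iff' hT]
      constructor
      · rintro ⟨h1, h2, h3 | h3⟩
        · rw [par_castSucc, par_castSucc, ← key_eq_iff hT] at h2
          omega
        · exact h3.2.2 h1
      · intro h
        obtain ⟨h1, h2⟩ := hT.dom h
        exact ⟨h1, h2, Or.inr ⟨h2, h1.le, fun _ => h⟩⟩
  · refine ⟨fun h => absurd (level_eq_of_onNode_eq u h.1) hij, fun h => absurd
      (level_eq_of_onNode_eq u (hT.dom h).1) hij⟩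

end

end PTree

/-! ## Signs and inversions -/

section Inversions

open Finset

variable {V W Z : Type} [Fintype V] [Fintype W] [Fintype Z]

/-- An asymmetric total relation. -/
structure IsTournament (r : V → V → Prop) : Prop where
  asymm : ∀ x y, r x y → ¬ r y x
  total : ∀ x y, x ≠ y → r x y ∨ r y x

/-- A surjection which identifies exactly the two elements `a` and `b`. -/
structure Collision (f : V → W) (a b : V) : Prop where
  surj : Function.Surjective f
  ne : a ≠ b
  eq : f a = f b
  uniq : ∀ x y, f x = f y → x = y ∨ (x = a ∧ y = b) ∨ (x = b ∧ y = a)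

open Classical in
/-- The truth value of a proposition modulo `2`. -/
noncomputable def ind (P : Prop) : ZMod 2 := if P then 1 else 0

theorem ind_true {P : Prop} (h : P) : ind P = 1 := if_pos h

theorem ind_false {P : Prop} (h : ¬ P) : ind P = 0 := if_neg h

theorem ind_and (P Q : Prop) : ind (P ∧ Q) = ind P * ind Q := by
  by_cases hP : P <;> by_cases hQ : Q <;> simp [ind, hP, hQ]

theorem natCast_ncard (P : V → Prop) : (({x | P x}.ncard : ℕ) : ZMod 2) = ∑ x, ind (P x) := by
  classical
  rw [Set.ncard_eq_toFinset_card', Set.toFinset_ofPred, natCast_card_filter]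
  exact sum_congr rfl fun x _ => by unfold ind; congr

theorem zmod_two_add_self (x : ZMod 2) : x + x = 0 := CharTwo.add_self_eq_zero x

theorem IsTournament.irrefl {r : V → V → Prop} (h : IsTournament r) (x : V) : ¬ r x x :=
  fun h' => h.asymm x x h' h'

theorem IsTournament.ind_swap {r : V → V → Prop} (h : IsTournament r) {x y : V} (hxy : x ≠ y) :
    ind (r y x) = 1 + ind (r x y) := by
  rcases h.total x y hxy with h1 | h1
  · rw [ind_true h1, ind_false (h.asymm _ _ h1)]; rfl
  · rw [ind_true h1, ind_false (h.asymm _ _ h1)]; rfl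

theorem Collision.symm {f : V → W} {a b : V} (h : Collision f a b) : Collision f b a :=
  ⟨h.surj, h.ne.symm, h.eq.symm, fun x y e => (h.uniq x y e).imp_right Or.symm⟩

theorem exists_collision {f : V → W} (hf : Function.Surjective f)
    (hc : Fintype.card V = Fintype.card W + 1) : ∃ a b, Collision f a b := by
  classical
  have h1 : ¬ Function.Injective f := fun h => by
    have := Fintype.card_le_of_injective f h
    omega
  simp only [Function.Injective, not_forall] at h1
  obtain ⟨a, b, hab, hne⟩ := h1
  have h2 : Function.Surjective fun x : {x // x ≠ a} => f x.1 := by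
    intro z
    obtain ⟨x, rfl⟩ := hf z
    by_cases hx : x = a
    · exact ⟨⟨b, Ne.symm hne⟩, by rw [hx, hab]⟩
    · exact ⟨⟨x, hx⟩, rfl⟩
  have h3 := ((Fintype.bijective_iff_surjective_and_card _).2 ⟨h2, by
    rw [Fintype.card_subtype_compl, Fintype.card_subtype_eq]; omega⟩).1
  have h4 : ∀ x y, x ≠ a → y ≠ a → f x = f y → x = y := fun x y hx hy e =>
    congrArg Subtype.val (@h3 ⟨x, hx⟩ ⟨y, hy⟩ e)
  refine ⟨a, b, hf, hne, hab, fun x y e => ?_⟩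
  by_cases hx : x = a
  · by_cases hy : y = a
    · exact Or.inl (hx.trans hy.symm)
    · exact Or.inr (Or.inl ⟨hx, h4 y b hy (Ne.symm hne) (by rw [← e, hx, hab])⟩)
  · by_cases hy : y = a
    · exact Or.inr (Or.inr ⟨h4 x b hx (Ne.symm hne) (by rw [e, hy, hab]), hy⟩)
    · exact Or.inl (h4 x y hx hy e)

/-- Every element of the target has one preimage, except the merged one, which has two. -/
theorem Collision.sum_comp {f : V → W} {a b : V} (h : Collision f a b) (φ : W → ZMod 2) :
    ∑ x, φ (f x) = ∑ p, φ p + φ (f a) := by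
  classical
  rw [← add_sum_erase univ _ (mem_univ a), add_comm]
  congr 1
  refine sum_bij (fun x _ => f x) (fun _ _ => mem_univ _) ?_ ?_ fun _ _ => rfl
  · intro x hx y hy e
    rcases h.uniq x y e with h1 | h1 | h1
    · exact h1
    · exact absurd h1.1 (ne_of_mem_erase hx)
    · exact absurd h1.2 (ne_of_mem_erase hy)
  · intro z _
    obtain ⟨x, rfl⟩ := h.surj z
    by_cases hx : x = a
    · exact ⟨b, mem_erase.2 ⟨h.ne.symm, mem_univ _⟩, by rw [hx, h.eq]⟩
    · exact ⟨x, mem_erase.2 ⟨hx, mem_univ _⟩, rfl⟩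

/-- The elements identified with another one. -/
def IsMerged (f : V → W) (v : V) : Prop := ∃ w, w ≠ v ∧ f w = f v

theorem Collision.isMerged {f : V → W} {a b : V} (h : Collision f a b) (v : V) :
    IsMerged f v ↔ v = a ∨ v = b := by
  constructor
  · rintro ⟨w, hw, e⟩
    rcases h.uniq w v e with h1 | h1 | h1
    · exact absurd h1 hw
    · exact Or.inr h1.2
    · exact Or.inl h1.2
  · rintro (rfl | rfl)
    · exact ⟨b, h.ne.symm, h.eq.symm⟩
    · exact ⟨a, h.ne, h.eq⟩

theorem Collision.sum_split {f : V → W} {a b : V} (h : Collision f a b) (φ : V → ZMod 2) :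
    ∑ x, φ x = ∑ x, ind (¬ IsMerged f x) * φ x + (φ a + φ b) := by
  classical
  have h1 : ∀ x, φ x = ind (¬ IsMerged f x) * φ x + ((if x = a then φ a else 0) +
      if x = b then φ b else 0) := by
    intro x
    rw [h.isMerged]
    by_cases hx : x = a
    · subst hx; simp [ind, h.ne]
    · by_cases hy : x = b
      · subst hy; simp [ind, hx]
      · simp [ind, hx, hy]
  rw [sum_congr rfl fun x _ => h1 x, sum_add_distrib, sum_add_distrib]
  simp

/-- The number of inversions. -/
noncomputable def inv (r : V → V → Prop) (s : W → W → Prop) (f : V → W) : ZMod 2 :=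
  ∑ x, ∑ y, ind (r x y) * ind (s (f y) (f x))

/-- The number of elements before `c`. -/
noncomputable def rk (s : W → W → Prop) (c : W) : ZMod 2 := ∑ q, ind (s q c)

/-- The exponent of the sign of a map identifying two elements. -/
noncomputable def sgnExp (r : V → V → Prop) (s : W → W → Prop) (f : V → W) : ℕ :=
  {p : V × V | ¬ IsMerged f p.1 ∧ IsMerged f p.2 ∧ r p.1 p.2}.ncard +
    {v : V | ¬ IsMerged f v ∧ ∃ m, IsMerged f m ∧ s (f v) (f m)}.ncard +
    {p : V × V | ¬ IsMerged f p.1 ∧ ¬ IsMerged f p.2 ∧ r p.1 p.2 ∧ s (f p.2) (f p.1)}.ncard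

/-- Replaces the three counts defining the sign by a symmetric formula: inversions of `f` over all
pairs, plus the position of the merged element in the target. The first and third counts together
give the inversions, the second gives the position. -/
theorem Collision.sgnExp_eq {f : V → W} {a b : V} (h : Collision f a b) {r : V → V → Prop}
    {s : W → W → Prop} (hr : IsTournament r) (hs : IsTournament s) :
    (sgnExp r s f : ZMod 2) = inv r s f + rk s (f a) := by
  have hm : ∀ x, ¬ IsMerged f x → x ≠ a ∧ x ≠ b ∧ f x ≠ f a := fun x hx => by
    rw [h.isMerged, not_or] at hx
    refine ⟨hx.1, hx.2, fun e => ?_⟩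
    rcases h.uniq x a e with h1 | h1 | h1
    · exact hx.1 h1
    · exact hx.1 h1.1
    · exact hx.2 h1.1
  have e2 : ∑ x, ind (¬ IsMerged f x ∧ ∃ m, IsMerged f m ∧ s (f x) (f m)) = rk s (f a) := by
    have h1 : ∀ x, ind (¬ IsMerged f x ∧ ∃ m, IsMerged f m ∧ s (f x) (f m)) =
        ind (¬ IsMerged f x) * ind (s (f x) (f a)) := fun x => by
      rw [← ind_and]
      congr 1
      apply propext
      refine and_congr_right fun _ => ⟨?_, fun h1 => ⟨a, (h.isMerged a).2 (Or.inl rfl), h1⟩⟩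
      rintro ⟨m, hm, h1⟩
      rcases (h.isMerged m).1 hm with rfl | rfl
      · exact h1
      · rwa [h.eq]
    have h2 := h.sum_comp fun q => ind (s q (f a))
    rw [ind_false (hs.irrefl (f a)), add_zero, h.sum_split, ← h.eq,
      ind_false (hs.irrefl (f a)), add_zero, add_zero] at h2
    rw [sum_congr rfl fun x _ => h1 x, h2]
    rfl
  have e1 : ∑ p : V × V, ind (¬ IsMerged f p.1 ∧ IsMerged f p.2 ∧ r p.1 p.2) =
      ∑ x, ind (¬ IsMerged f x) * (ind (r x a) + ind (r x b)) := by
    rw [Fintype.sum_prod_type]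
    refine sum_congr rfl fun x _ => ?_
    simp only [ind_and, ← mul_sum]
    congr 1
    rw [h.sum_split]
    simp only [ind_true ((h.isMerged a).2 (Or.inl rfl)), ind_true ((h.isMerged b).2 (Or.inr rfl)),
      one_mul]
    refine add_eq_right.2 (sum_eq_zero fun y _ => ?_)
    by_cases hy : IsMerged f y
    · rw [ind_false (not_not.2 hy), zero_mul]
    · rw [ind_false hy, zero_mul, mul_zero]
  have e3 : ∑ p : V × V, ind (¬ IsMerged f p.1 ∧ ¬ IsMerged f p.2 ∧ r p.1 p.2 ∧ s (f p.2) (f p.1)) =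
      ∑ x, ind (¬ IsMerged f x) * ∑ y, ind (¬ IsMerged f y) *
        (ind (r x y) * ind (s (f y) (f x))) := by
    rw [Fintype.sum_prod_type]
    simp only [ind_and, mul_sum]
  have e4 : inv r s f = (∑ x, ind (¬ IsMerged f x) * ∑ y, ind (¬ IsMerged f y) *
        (ind (r x y) * ind (s (f y) (f x)))) +
      ∑ x, ind (¬ IsMerged f x) * (ind (r x a) + ind (r x b)) := by
    have haa := ind_false (hs.irrefl (f a))
    have h1 : ∀ x, ∑ y, ind (r x y) * ind (s (f y) (f x)) =
        ∑ y, ind (¬ IsMerged f y) * (ind (r x y) * ind (s (f y) (f x))) +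
          (ind (r x a) + ind (r x b)) * ind (s (f a) (f x)) := fun x => by
      rw [h.sum_split, ← h.eq, add_mul]
    unfold inv
    rw [h.sum_split]
    simp only [h1]
    simp only [← h.eq, haa, mul_zero, add_zero, mul_add (ind (¬ IsMerged f _)),
      sum_add_distrib, add_assoc]
    congr 1
    rw [← sum_add_distrib, ← sum_add_distrib, ← sum_add_distrib]
    refine sum_congr rfl fun x _ => ?_
    by_cases hx : IsMerged f x
    · simp [ind_false (not_not.2 hx)]
    -- Against the unmerged `x`, the elements `a` and `b` contribute `p + t` and `q + t` modulo 2,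
    -- with `t` recording whether `f x` precedes the merged element; so `t` cancels.
    · obtain ⟨hxa, hxb, hfx⟩ := hm x hx
      rw [ind_true hx, hr.ind_swap hxa, hr.ind_swap hxb, hs.ind_swap hfx]
      generalize ind (r x a) = p
      generalize ind (r x b) = q
      generalize ind (s (f x) (f a)) = t
      revert p q t
      decide
  unfold sgnExp
  rw [Nat.cast_add, Nat.cast_add, natCast_ncard, natCast_ncard, natCast_ncard, e1, e2, e3, e4]
  ring

/-- The number of inversions, by `f`, of pairs of elements which have the same image by `h`. -/
noncomputable def innerInv (r : V → V → Prop) (s : W → W → Prop) (f : V → W) (h : V → Z) : ZMod 2 :=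
  ∑ x, ∑ y, ind (r x y) * (ind (h x = h y) * ind (s (f y) (f x)))

/-- A tournament picks one orientation of each pair, and a symmetric weight does not see which. The
discrepancies of `(x, y)` and `(y, x)` cancel modulo 2. -/
theorem sum_tournament_congr {r s : V → V → Prop} (F : V → V → ZMod 2)
    (hF : ∀ x y, F x y = F y x) (h0 : ∀ x, F x x = 0)
    (hrs : ∀ x y, F x y ≠ 0 → ind (r x y) + ind (r y x) = ind (s x y) + ind (s y x)) :
    ∑ x, ∑ y, ind (r x y) * F x y = ∑ x, ∑ y, ind (s x y) * F x y := by
  classical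
  rw [← sub_eq_zero, ← sum_sub_distrib]
  simp only [← sum_sub_distrib, ← sub_mul]
  rw [← Fintype.sum_prod_type' (f := fun x y => (ind (r x y) - ind (s x y)) * F x y)]
  refine sum_involution (fun p _ => p.swap) ?_ ?_ (fun _ _ => mem_univ _) fun _ _ => Prod.swap_swap _
  · rintro ⟨x, y⟩ -
    simp only [Prod.swap]
    rw [hF y x]
    by_cases h : F x y = 0
    · simp [h]
    · have := hrs x y h
      linear_combination F x y * this
  · rintro ⟨x, y⟩ - h1 h2
    obtain rfl : y = x := congrArg Prod.fst h2
    simp [h0] at h1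

/-- For bijections, inversion numbers are additive modulo 2. Here there are two defects: pairs with
the same final image can be inverted by `f` without being inverted by `g ∘ f` (`innerInv`), and
summing over `V` instead of `W` counts the point `f a` twice (the bracket). -/
theorem inv_comp {f : V → W} {g : W → Z} {a b : V} {p q : W} (hf : Collision f a b)
    (hg : Collision g p q) {r : V → V → Prop} {s : W → W → Prop} {t : Z → Z → Prop}
    (hr : IsTournament r) (hs : IsTournament s) (ht : IsTournament t) :
    inv r t (g ∘ f) = inv r s f + inv s t g + innerInv r s f (g ∘ f) + (rk s (f a) +
      (rk t (g (f a)) + ind (t (g p) (g (f a)))) +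
        ∑ y, ind (g y = g (f a)) * ind (s y (f a))) := by
  -- `F x y` records whether `g` inverts the unordered pair; it is symmetric, hence summable against
  -- any tournament.
  let F : W → W → ZMod 2 := fun x y =>
    ind (s x y) * ind (t (g y) (g x)) + ind (s y x) * ind (t (g x) (g y))
  have hF : ∀ x y, F x y = F y x := fun x y => add_comm _ _
  have hF0 : ∀ x y, g x = g y → F x y = 0 := fun x y e => by
    simp only [F, e, ind_false (ht.irrefl _), mul_zero, add_zero]
  have k1 : ∀ x y, ind (r x y) * ind (t (g (f y)) (g (f x))) = ind (r x y) * ind (s (f y) (f x)) +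
      ind (r x y) * F (f x) (f y) + ind (r x y) * (ind ((g ∘ f) x = (g ∘ f) y) *
        ind (s (f y) (f x))) := by
    intro x y
    simp only [← mul_add]
    congr 1
    by_cases e : g (f x) = g (f y)
    · rw [hF0 _ _ e, ind_true (show (g ∘ f) x = (g ∘ f) y from e), e,
        ind_false (ht.irrefl _), add_zero, one_mul, zmod_two_add_self]
    · have e' : f x ≠ f y := fun h => e (congrArg g h)
      rw [ind_false (show ¬ (g ∘ f) x = (g ∘ f) y from e), zero_mul, add_zero]
      simp only [F]
      rw [hs.ind_swap e', ht.ind_swap e]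
      generalize ind (s (f x) (f y)) = A
      generalize ind (t (g (f x)) (g (f y))) = B
      revert A B
      decide
  have k2 : ∑ x, ∑ y, ind (r x y) * F (f x) (f y) =
      ∑ x, ∑ y, ind (s (f x) (f y)) * F (f x) (f y) := by
    refine sum_tournament_congr (r := r) (s := fun x y => s (f x) (f y))
      (fun x y => F (f x) (f y)) (fun x y => hF _ _)
      (fun x => hF0 _ _ rfl) fun x y hxy => ?_
    have h1 : f x ≠ f y := fun e => hxy (hF0 _ _ (congrArg g e))
    have h2 : x ≠ y := fun e => h1 (congrArg f e)
    rw [hr.ind_swap h2, hs.ind_swap h1]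
    generalize ind (r x y) = A
    generalize ind (s (f x) (f y)) = B
    revert A B
    decide
  have k3 : ∀ x y, ind (s x y) * F x y = ind (s x y) * ind (t (g y) (g x)) := by
    intro x y
    by_cases e : x = y
    · subst e; simp [ind_false (hs.irrefl _)]
    · simp only [F]
      rw [hs.ind_swap e]
      generalize ind (s x y) = A
      generalize ind (t (g x) (g y)) = B
      generalize ind (t (g y) (g x)) = C
      revert A B C
      decide
  -- Pulling the double sum back along `f` repeats the row and the column of `f a`; the corner term
  -- is zero by irreflexivity.
  have k4 : ∑ x, ∑ y, ind (s (f x) (f y)) * ind (t (g (f y)) (g (f x))) =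
      inv s t g + (∑ y, (ind (s (f a) y) * ind (t (g y) (g (f a))) +
        ind (s y (f a)) * ind (t (g (f a)) (g y)))) := by
    have h1 : ∀ x, ∑ y, ind (s (f x) (f y)) * ind (t (g (f y)) (g (f x))) =
        ∑ y, ind (s (f x) y) * ind (t (g y) (g (f x))) +
          ind (s (f x) (f a)) * ind (t (g (f a)) (g (f x))) := fun x =>
      hf.sum_comp fun y => ind (s (f x) y) * ind (t (g y) (g (f x)))
    rw [sum_congr rfl fun x _ => h1 x, hf.sum_comp fun x =>
      ∑ y, ind (s x y) * ind (t (g y) (g x)) + ind (s x (f a)) * ind (t (g (f a)) (g x)),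
      sum_add_distrib, sum_add_distrib, ind_false (hs.irrefl (f a))]
    unfold inv
    ring
  have k5 : ∀ y, ind (s (f a) y) * ind (t (g y) (g (f a))) +
        ind (s y (f a)) * ind (t (g (f a)) (g y)) = ind (s y (f a)) + ind (t (g y) (g (f a))) +
      ind (g y = g (f a)) * ind (s y (f a)) := by
    intro y
    by_cases e : g y = g (f a)
    · rw [ind_true e, e, ind_false (ht.irrefl _)]
      simp [zmod_two_add_self]
    · have e' : y ≠ f a := fun h => e (congrArg g h)
      rw [ind_false e, hs.ind_swap e', ht.ind_swap e]
      generalize ind (s y (f a)) = A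
      generalize ind (t (g y) (g (f a))) = B
      revert A B
      decide
  have k6 : ∑ y, ind (t (g y) (g (f a))) = rk t (g (f a)) + ind (t (g p) (g (f a))) :=
    hg.sum_comp fun z => ind (t z (g (f a)))
  have k7 : inv r t (g ∘ f) = inv r s f + ∑ x, ∑ y, ind (r x y) * F (f x) (f y) +
      innerInv r s f (g ∘ f) := by
    unfold inv innerInv
    simp only [Function.comp_apply] at k1 ⊢
    simp only [k1, sum_add_distrib]
  rw [k7, k2]
  simp only [k3]
  rw [k4, sum_congr rfl fun y _ => k5 y, sum_add_distrib, sum_add_distrib, k6]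
  unfold rk
  ring

/-- The exponent of the product of the signs of `f` and `g`. -/
theorem sgnExp_add {f : V → W} {g : W → Z} {a b : V} {p q : W} (hf : Collision f a b)
    (hg : Collision g p q) {r : V → V → Prop} {s : W → W → Prop} {t : Z → Z → Prop}
    (hr : IsTournament r) (hs : IsTournament s) (ht : IsTournament t) :
    ((sgnExp r s f + sgnExp s t g : ℕ) : ZMod 2) = inv r t (g ∘ f) + innerInv r s f (g ∘ f) +
      rk t (g (f a)) + rk t (g p) + ind (t (g p) (g (f a))) +
        ∑ y, ind (g y = g (f a)) * ind (s y (f a)) := by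
  -- This eliminates the inversion numbers of `f` and `g` separately. What is left depends on `g ∘
  -- f` and on a few local terms, so two factorizations of one map can be compared.
  rw [Nat.cast_add, hf.sgnExp_eq hr hs, hg.sgnExp_eq hs ht, inv_comp hf hg hr hs ht]
  generalize inv r s f = A
  generalize inv s t g = B
  generalize innerInv r s f (g ∘ f) = C
  generalize rk s (f a) = D
  have h1 := zmod_two_add_self C
  have h2 := zmod_two_add_self D
  have h3 := zmod_two_add_self (rk t (g (f a)))
  have h4 := zmod_two_add_self (ind (t (g p) (g (f a))))
  have h5 := zmod_two_add_self (∑ y, ind (g y = g (f a)) * ind (s y (f a)))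
  linear_combination -h1 - h3 - h4 - h5

end Inversions

theorem neg_one_pow_eq_neg {m m' : ℕ} (h : (m : ZMod 2) = m' + 1) :
    (-1 : ℤ) ^ m = -(-1) ^ m' := by
  have h1 : (m : ZMod 2) = ((m' + 1 : ℕ) : ZMod 2) := by rw [h, Nat.cast_add, Nat.cast_one]
  rw [ZMod.natCast_eq_natCast_iff'] at h1
  rw [neg_one_pow_eq_pow_mod_two, h1, ← neg_one_pow_eq_pow_mod_two, pow_succ]
  ring

/-- The merged pair is unique up to order, so any two distinct identified elements may name it. -/
theorem Collision.rebase {V W : Type} [Fintype V] [Fintype W] {f : V → W} {a b x y : V} (h : Collision f a b)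
    (hxy : x ≠ y) (e : f x = f y) : Collision f x y := by
  rcases h.uniq x y e with h1 | ⟨rfl, rfl⟩ | ⟨rfl, rfl⟩
  · exact absurd h1 hxy
  · exact h
  · exact h.symm

namespace PTree

variable {n : ℕ} {τ σ : PTree n}

/-! ### The depth-first order -/

theorem level_par (v : Node τ) :
    (par τ v).1.val = v.1.val + 1 ∨ (par τ v = v ∧ v.1 = Fin.last n) := by
  obtain ⟨i, x⟩ := v
  induction i using Fin.lastCases with
  | last => exact Or.inr ⟨par_last τ x, rfl⟩
  | cast i => left; rw [par_castSucc]; rfl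

theorem node_root_unique {v w : Node τ} (hv : v.1 = Fin.last n) (hw : w.1 = Fin.last n) :
    v = w := by
  obtain ⟨i, x⟩ := v
  obtain ⟨j, y⟩ := w
  obtain rfl : i = Fin.last n := hv
  obtain rfl : j = Fin.last n := hw
  rw [root_unique τ x y]

/-- Levels increase towards the root, and the truncation at `n` reflects that the root is its own
parent. -/
theorem level_iterate (m : ℕ) (v : Node τ) :
    ((par τ)^[m] v).1.val = min (v.1.val + m) n := by
  induction m with
  | zero => simp; omega
  | succ m ih =>
    rw [Function.iterate_succ_apply']
    rcases level_par ((par τ)^[m] v) with h | ⟨h1, h2⟩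
    · have := ((par τ) ((par τ)^[m] v)).1.2
      omega
    · rw [h1]
      have := congrArg Fin.val h2
      simp only [Fin.val_last] at this
      omega

theorem iterate_eq_self {m : ℕ} {v : Node τ} (h : ((par τ)^[m] v).1.val = v.1.val) :
    (par τ)^[m] v = v := by
  cases m with
  | zero => rfl
  | succ m =>
    rw [level_iterate] at h
    have hv : v.1 = Fin.last n := Fin.ext (by have := v.1.2; simp only [Fin.val_last]; omega)
    refine node_root_unique (Fin.ext ?_) hv
    rw [level_iterate, hv]
    simp

theorem iterate_eq_iterate {m m' : ℕ} {v : Node τ}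
    (h : ((par τ)^[m] v).1 = ((par τ)^[m'] v).1) : (par τ)^[m] v = (par τ)^[m'] v := by
  wlog hm : m ≤ m' generalizing m m'
  · exact (this h.symm (by omega)).symm
  · obtain ⟨d, rfl⟩ := Nat.exists_eq_add_of_le' hm
    rw [Function.iterate_add_apply] at h ⊢
    exact (iterate_eq_self (congrArg Fin.val h).symm).symm

theorem iterate_mono {v w : Node τ} (h : v ≤ w) (m : ℕ) : (par τ)^[m] v ≤ (par τ)^[m] w := by
  induction m with
  | zero => exact h
  | succ m ih =>
    rw [Function.iterate_succ_apply', Function.iterate_succ_apply']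
    exact par_mono ih

/-- The depth-first order on nodes. -/
def NodeBefore (τ : PTree n) (v w : Node τ) : Prop :=
  (v ≠ w ∧ ∃ m, (par τ)^[m] w = v) ∨ ∃ m m', (par τ)^[m] v < (par τ)^[m'] w

/-- Since `par` is monotone, a path strictly to the left at one level stays weakly to the left at
all levels closer to the root, so it cannot be strictly to the right there. -/
theorem nodeBefore_not_lt_of_level_le {v w : Node τ} {m m' p q : ℕ}
    (h : (par τ)^[m] v < (par τ)^[m'] w) (h' : (par τ)^[p] w < (par τ)^[q] v)
    (hl : ((par τ)^[m] v).1.val ≤ ((par τ)^[p] w).1.val) : False := by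
  have hl1 := congrArg Fin.val (level_eq_of_le h.le)
  have hl2 := congrArg Fin.val (level_eq_of_le h'.le)
  obtain ⟨d, hd⟩ := Nat.exists_eq_add_of_le hl
  have h1 := iterate_mono h.le d
  rw [← Function.iterate_add_apply, ← Function.iterate_add_apply] at h1
  have e1 : (par τ)^[d + m] v = (par τ)^[q] v := by
    apply iterate_eq_iterate
    apply Fin.ext
    rw [← hl2, hd, Function.iterate_add_apply, level_iterate]
    have := ((par τ)^[p] w).1.2
    omega
  have e2 : (par τ)^[d + m'] w = (par τ)^[p] w := by
    apply iterate_eq_iterate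
    apply Fin.ext
    rw [Function.iterate_add_apply, level_iterate]
    have := ((par τ)^[p] w).1.2
    omega
  rw [e1, e2] at h1
  exact h'.not_ge h1

theorem nodeBefore_tournament (τ : PTree n) : IsTournament (NodeBefore τ) where
  asymm := by
    rintro v w (⟨hne, m, hm⟩ | ⟨m, m', h⟩) (⟨hne', p, hp⟩ | ⟨p, q, h'⟩)
    · rw [← hm, ← Function.iterate_add_apply] at hp
      have h1 := level_iterate m w
      have h2 : ((par τ)^[p + m] w).1.val = w.1.val := by rw [hp]
      rw [level_iterate] at h2
      apply hne
      rw [← hm]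
      exact iterate_eq_self (by rw [h1]; omega)
    · rw [← hm, ← Function.iterate_add_apply] at h'
      exact h'.ne (iterate_eq_iterate (level_eq_of_le h'.le))
    · rw [← hp, ← Function.iterate_add_apply] at h
      exact h.ne (iterate_eq_iterate (level_eq_of_le h.le))
    · rcases le_total ((par τ)^[m] v).1.val ((par τ)^[p] w).1.val with hl | hl
      · exact nodeBefore_not_lt_of_level_le h h' hl
      · exact nodeBefore_not_lt_of_level_le h' h hl
  total := by
    intro v w hne
    wlog hl : v.1.val ≤ w.1.val generalizing v w
    · exact (this w v hne.symm (by omega)).symm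
    -- Climb from `v` to the level of `w`: either `w` is reached, so `w` is an ancestor of `v`, or
    -- the two nodes of that level are compared.
    · obtain ⟨d, hd⟩ := Nat.exists_eq_add_of_le hl
      have hlev : ((par τ)^[d] v).1 = w.1 := by
        apply Fin.ext
        rw [level_iterate]
        have := w.1.2
        omega
      by_cases e : (par τ)^[d] v = w
      · exact Or.inr (Or.inl ⟨hne.symm, d, e⟩)
      · rcases node_le_total hlev with h | h
        · exact Or.inl (Or.inr ⟨d, 0, lt_of_le_of_ne h e⟩)
        · exact Or.inr (Or.inr ⟨0, d, lt_of_le_of_ne h (Ne.symm e)⟩)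

theorem nodeBefore_iff_lt {v w : Node τ} (h : v.1 = w.1) : NodeBefore τ v w ↔ v < w := by
  have h1 : ∀ {a b : Node τ}, a < b → NodeBefore τ a b := fun hab => Or.inr ⟨0, 0, hab⟩
  refine ⟨fun hb => ?_, h1⟩
  have hne : v ≠ w := fun e => (nodeBefore_tournament τ).irrefl w (e ▸ hb)
  rcases node_le_total h with h2 | h2
  · exact lt_of_le_of_ne h2 hne
  · exact absurd (h1 (lt_of_le_of_ne h2 hne.symm)) ((nodeBefore_tournament τ).asymm _ _ hb)

theorem anc_par {i : Fin (n + 1)} {x : Fin (τ.size i)} (z : Node τ) (h : Anc τ x z.2) :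
    Anc τ x (par τ z).2 := by
  obtain ⟨j, y⟩ := z
  induction j using Fin.lastCases with
  | last => rw [par_last]; exact h
  | cast j => rw [par_castSucc]; exact Anc.step h

theorem anc_iff {i j : Fin (n + 1)} {x : Fin (τ.size i)} {y : Fin (τ.size j)} :
    Anc τ x y ↔ ∃ m, (par τ)^[m] ⟨i, x⟩ = ⟨j, y⟩ := by
  constructor
  · intro h
    induction h with
    | refl x => exact ⟨0, rfl⟩
    | step h ih =>
      obtain ⟨m, hm⟩ := ih
      exact ⟨m + 1, by rw [Function.iterate_succ_apply', hm, par_castSucc]⟩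
  · rintro ⟨m, hm⟩
    have h : Anc τ x ((par τ)^[m] ⟨i, x⟩).2 := by
      clear hm
      induction m with
      | zero => exact Anc.refl x
      | succ m ih =>
        rw [Function.iterate_succ_apply']
        exact anc_par _ ih
    rw [hm] at h
    exact h

/-- The inclusion of the vertices of level less than `n` in the nodes. -/
def toNode (v : Vertex τ) : Node τ := ⟨v.1.castSucc, v.2⟩

theorem toNode_injective : Function.Injective (toNode (τ := τ)) := by
  rintro ⟨i, x⟩ ⟨j, y⟩ h
  have h1 : i = j := Fin.castSucc_injective n (congrArg (fun z : Node τ => z.1) h)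
  subst h1
  simpa [toNode] using h

theorem before_iff (v w : Vertex τ) : Before τ v w ↔ NodeBefore τ (toNode v) (toNode w) := by
  unfold Before NodeBefore
  rw [anc_iff, toNode_injective.ne_iff]
  refine or_congr Iff.rfl ⟨?_, ?_⟩
  · rintro ⟨j, y, z, hyz, h1, h2⟩
    obtain ⟨m, hm⟩ := anc_iff.1 h1
    obtain ⟨m', hm'⟩ := anc_iff.1 h2
    refine ⟨m, m', ?_⟩
    unfold toNode
    rw [hm, hm']
    exact Sigma.mk_lt_mk_iff.2 hyz
  · rintro ⟨m, m', h⟩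
    generalize hy : (par τ)^[m] (toNode v) = y at h
    generalize hz : (par τ)^[m'] (toNode w) = z at h
    rcases h with ⟨j, a, b, hab⟩
    exact ⟨j, a, b, hab, anc_iff.2 ⟨m, hy⟩, anc_iff.2 ⟨m', hz⟩⟩

theorem before_tournament (τ : PTree n) : IsTournament (Before τ) where
  asymm v w h h' := by
    rw [before_iff] at h h'
    exact (nodeBefore_tournament τ).asymm _ _ h h'
  total v w h := by
    rw [before_iff, before_iff]
    exact (nodeBefore_tournament τ).total _ _ (toNode_injective.ne h)

/-! ### The sign in terms of nodes -/

/-- The root of a tree. -/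
def root (τ : PTree n) : Node τ := ⟨Fin.last n, ⟨0, by rw [τ.size_last]; exact one_pos⟩⟩

theorem eq_root_or (v : Node τ) : v = root τ ∨ ∃ w, toNode w = v := by
  obtain ⟨i, x⟩ := v
  induction i using Fin.lastCases with
  | last => exact Or.inl (node_root_unique rfl rfl)
  | cast i => exact Or.inr ⟨⟨i, x⟩, rfl⟩

theorem toNode_ne_root (v : Vertex τ) : toNode v ≠ root τ := fun h =>
  (Fin.castSucc_lt_last v.1).ne (congrArg (fun z : Node τ => z.1) h)

theorem sum_node (φ : Node τ → ZMod 2) : ∑ v, φ v = ∑ v : Vertex τ, φ (toNode v) + φ (root τ) := by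
  rw [Fintype.sum_sigma, Fin.sum_univ_castSucc, Fintype.sum_sigma]
  congr 1
  rw [Fintype.sum_eq_single ⟨0, by rw [τ.size_last]; exact one_pos⟩
    fun x hx => absurd (root_unique τ _ _) hx]
  rfl

theorem root_nodeBefore (v : Vertex τ) : NodeBefore τ (root τ) (toNode v) := by
  refine Or.inl ⟨(toNode_ne_root v).symm, n, node_root_unique (Fin.ext ?_) rfl⟩
  rw [level_iterate]
  simp

theorem onNode_toNode (u : τ ⟶ σ) (v : Vertex τ) : onNode u (toNode v) = toNode (onVertex u v) :=
  rfl

theorem onNode_root (u : τ ⟶ σ) : onNode u (root τ) = root σ := node_root_unique rfl rfl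

theorem inv_node (u : τ ⟶ σ) :
    inv (NodeBefore τ) (NodeBefore σ) (onNode u) = inv (Before τ) (Before σ) (onVertex u) := by
  unfold inv
  have h : ∀ w : Vertex σ, ind (NodeBefore σ (toNode w) (root σ)) = 0 := fun w =>
    ind_false ((nodeBefore_tournament σ).asymm _ _ (root_nodeBefore w))
  have h' : ∀ w : Vertex τ, ind (NodeBefore τ (toNode w) (root τ)) = 0 := fun w =>
    ind_false ((nodeBefore_tournament τ).asymm _ _ (root_nodeBefore w))
  rw [sum_node]
  simp only [sum_node, onNode_root, onNode_toNode, h, h', mul_zero, zero_mul, add_zero,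
    Finset.sum_const_zero, ind_false ((nodeBefore_tournament σ).irrefl (root σ)), before_iff]

theorem rk_node (v : Vertex τ) : rk (NodeBefore τ) (toNode v) = rk (Before τ) v + 1 := by
  unfold rk
  rw [sum_node, ind_true (root_nodeBefore v)]
  simp only [before_iff]

theorem collision_onVertex {u : τ ⟶ σ} {a b : Node τ} (h : Collision (onNode u) a b) :
    ∃ v w : Vertex τ, toNode v = a ∧ toNode w = b ∧ Collision (onVertex u) v w := by
  have hr : ∀ {x y : Node τ}, x ≠ y → onNode u x = onNode u y → ∃ v, toNode v = x := by
    intro x y hxy e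
    refine (eq_root_or x).resolve_left fun hx => hxy ?_
    rw [hx]
    refine node_root_unique rfl ?_
    rw [← level_eq_of_onNode_eq u e, hx]
    rfl
  obtain ⟨v, rfl⟩ := hr h.ne h.eq
  obtain ⟨w, rfl⟩ := hr h.ne.symm h.eq.symm
  refine ⟨v, w, rfl, rfl, ?_, fun e => h.ne (congrArg toNode e), ?_, fun x y e => ?_⟩
  · rintro ⟨i, z⟩
    obtain ⟨x, rfl⟩ := u.surj _ z
    exact ⟨⟨i, x⟩, rfl⟩
  · exact toNode_injective h.eq
  · have := h.uniq (toNode x) (toNode y) (congrArg toNode e)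
    simpa only [toNode_injective.eq_iff] using this

/-- Including the root in the count adds no inversion, as the root comes first in both trees, but
raises the position of the merged vertex by one. The resulting global sign is harmless in products
of two signs. -/
theorem sgn_eq {u : τ ⟶ σ} {a b : Node τ} (h : Collision (onNode u) a b) :
    sgn u = -(-1) ^ sgnExp (NodeBefore τ) (NodeBefore σ) (onNode u) := by
  obtain ⟨v, w, rfl, rfl, h'⟩ := collision_onVertex h
  change (-1 : ℤ) ^ sgnExp (Before τ) (Before σ) (onVertex u) = _
  apply neg_one_pow_eq_neg
  rw [h.sgnExp_eq (nodeBefore_tournament τ) (nodeBefore_tournament σ),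
    h'.sgnExp_eq (before_tournament τ) (before_tournament σ), inv_node, onNode_toNode, rk_node,
    add_assoc, add_assoc, zmod_two_add_self, add_zero]

/-! ### Factorizations of morphisms of degree two -/

theorem exists_collision_onNode (u : τ ⟶ σ) (h : τ.deg = σ.deg + 1) :
    ∃ a b, Collision (onNode u) a b := by
  refine exists_collision (onNode_surjective u) ?_
  rw [← Nat.card_eq_fintype_card, ← Nat.card_eq_fintype_card, card_node, card_node, h]

section

variable {u : τ ⟶ σ}

/-- A factorization in two morphisms which identify exactly two nodes. -/
structure IsMid (f : Fact u) : Prop where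
  left : ∃ a b, Collision (onNode f.w) a b
  right : ∃ p q, Collision (onNode f.v) p q

theorem node_eq_of_level_par {x y : Node τ} (h : (par τ x).1 = x.1) (hl : x.1 = y.1) : x = y := by
  have hx : x.1 = Fin.last n := by
    rcases level_par x with h1 | h1
    · rw [h] at h1; omega
    · exact h1.2
  exact node_root_unique hx (hl ▸ hx)

/-- If `f.w` separated the parents it would separate `x` and `y` as well, and `f.v` would have to
merge two pairs lying at consecutive levels, whereas it merges only one. At the root there is only
one node. -/
theorem IsMid.par_eq {f : Fact u} (hf : IsMid f) {x y : Node τ} (h : onNode u x = onNode u y) :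
    onNode f.w (par τ x) = onNode f.w (par τ y) := by
  obtain ⟨p, q, hpq⟩ := hf.right
  by_contra hne
  have hl := level_eq_of_onNode_eq u h
  have h1 : onNode f.w x ≠ onNode f.w y := fun e => hne (by rw [onNode_par, onNode_par, e])
  have h2 := hpq.rebase h1 (by rw [f.onNode_v, f.onNode_v, h])
  have h3 : onNode f.v (onNode f.w (par τ x)) = onNode f.v (onNode f.w (par τ y)) := by
    rw [f.onNode_v, f.onNode_v, onNode_par, onNode_par, h]
  have h4 : (par τ x).1 = x.1 := by
    rcases h2.uniq _ _ h3 with e | e | e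
    · exact absurd e hne
    · exact level_eq_of_onNode_eq f.w e.1
    · exact (level_eq_of_onNode_eq f.w e.1).trans hl.symm
  exact h1 (congrArg _ (node_eq_of_level_par h4 hl))

theorem IsMid.factOrder_iff {f : Fact u} (hf : IsMid f) {x y : Node τ} :
    factOrder f x y ↔ onNode u x = onNode u y ∧ onNode f.w x ≤ onNode f.w y :=
  ⟨fun h => ⟨h.1, h.2.2⟩, fun h => ⟨h.1, hf.par_eq h.1, h.2⟩⟩

/-- The first term depends on `u` alone and the two positions enter symmetrically. Comparing two
factorizations thus comes down to the inner inversions, the order of the two merged images in `σ`,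
and the final sum. -/
theorem sgn_mul_sgn_eq {f : Fact u} {a b p q : Node τ} (hw : Collision (onNode f.w) a b)
    (hv : Collision (onNode f.v) (onNode f.w p) (onNode f.w q)) :
    ∃ m : ℕ, sgn f.w * sgn f.v = (-1) ^ m ∧ (m : ZMod 2) =
      inv (NodeBefore τ) (NodeBefore σ) (onNode u) +
      innerInv (NodeBefore τ) (NodeBefore f.mid) (onNode f.w) (onNode u) +
      rk (NodeBefore σ) (onNode u a) + rk (NodeBefore σ) (onNode u p) +
      ind (NodeBefore σ (onNode u p) (onNode u a)) +
      ∑ y, ind (onNode f.v y = onNode u a) * ind (NodeBefore f.mid y (onNode f.w a)) := by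
  have hc : onNode f.v ∘ onNode f.w = onNode u := funext f.onNode_v
  refine ⟨_, ?_, (sgnExp_add hw hv (nodeBefore_tournament τ) (nodeBefore_tournament f.mid)
    (nodeBefore_tournament σ)).trans ?_⟩
  · rw [sgn_eq hw, sgn_eq hv, neg_mul_neg, pow_add]
  · rw [hc, f.onNode_v, f.onNode_v]

/-- When the two mergings take place over different nodes of `σ`, the fibre of `f.v` over `u a` is a
single node, which does not precede itself. -/
theorem sum_eq_zero_of_ne {f : Fact u} {a p q : Node τ}
    (hv : Collision (onNode f.v) (onNode f.w p) (onNode f.w q))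
    (h : onNode u a ≠ onNode u p) :
    ∑ y, ind (onNode f.v y = onNode u a) * ind (NodeBefore f.mid y (onNode f.w a)) = 0 := by
  refine Finset.sum_eq_zero fun y _ => ?_
  by_cases e : onNode f.v y = onNode u a
  · have h1 : onNode f.v y = onNode f.v (onNode f.w a) := by rw [e, f.onNode_v]
    rcases hv.uniq _ _ h1 with h2 | h2 | h2
    · rw [h2, ind_false ((nodeBefore_tournament f.mid).irrefl _), mul_zero]
    · exact absurd (by rw [← e, h2.1, f.onNode_v]) h
    · refine absurd ?_ h
      rw [← f.onNode_v a, h2.2, f.onNode_v]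
  · rw [ind_false e, zero_mul]

/-- Siblings keep their order under `f.w`, so inner inversions need identified nodes with different
parents. -/
theorem innerInv_eq_zero {f : Fact u}
    (h : ∀ x y, onNode u x = onNode u y → par τ x = par τ y) :
    innerInv (NodeBefore τ) (NodeBefore f.mid) (onNode f.w) (onNode u) = 0 := by
  refine Finset.sum_eq_zero fun x _ => Finset.sum_eq_zero fun y _ => ?_
  by_cases e : onNode u x = onNode u y
  · by_cases hb : NodeBefore τ x y
    · have h1 := (nodeBefore_iff_lt (level_eq_of_onNode_eq u e)).1 hb
      have h2 := onNode_mono f.w (h x y e) h1.le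
      rw [ind_false (P := NodeBefore f.mid _ _), mul_zero, mul_zero]
      rw [nodeBefore_iff_lt (level_eq_of_le h2).symm]
      exact h2.not_gt
    · rw [ind_false hb, zero_mul]
  · rw [ind_false e, zero_mul, mul_zero]

theorem sgn_opposite {f g : Fact u} {m m' : ℕ} (h : sgn f.w * sgn f.v = (-1) ^ m)
    (h' : sgn g.w * sgn g.v = (-1) ^ m') (e : (m : ZMod 2) = m' + 1) :
    sgn f.w * sgn f.v = -(sgn g.w * sgn g.v) := by
  rw [h, h', neg_one_pow_eq_neg e]

/-- The case of two factorizations identifying different pairs with a common node. -/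
theorem sgn_opposite_of_triple {f g : Fact u} {a b c : Node τ}
    (hsib : ∀ x y, onNode u x = onNode u y → par τ x = par τ y)
    (hf : Collision (onNode f.w) a b) (hg : Collision (onNode g.w) a c)
    (hf' : Collision (onNode f.v) (onNode f.w a) (onNode f.w c))
    (hg' : Collision (onNode g.v) (onNode g.w a) (onNode g.w b)) :
    sgn f.w * sgn f.v = -(sgn g.w * sgn g.v) := by
  obtain ⟨m, hm, em⟩ := sgn_mul_sgn_eq hf hf'
  obtain ⟨m', hm', em'⟩ := sgn_mul_sgn_eq hg hg'
  refine sgn_opposite hm hm' ?_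
  have hub : onNode u a = onNode u b := by rw [← f.onNode_v, hf.eq, f.onNode_v]
  have huc : onNode u a = onNode u c := by rw [← g.onNode_v, hg.eq, g.onNode_v]
  have hbc : b ≠ c := fun e => hf'.ne (by rw [hf.eq, e])
  -- Over `u a` the middle tree has two nodes: the image of `{a, b}` and that of `c`. The sum asks
  -- whether the latter is on the left, i.e. whether `c < b`. Exchanging the roles of `b` and `c`
  -- reverses the answer, which gives the opposite sign.
  have key : ∀ {f : Fact u} {b c : Node τ}, onNode u a = onNode u b → onNode u a = onNode u c →
      Collision (onNode f.w) a b → Collision (onNode f.v) (onNode f.w a) (onNode f.w c) →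
      ∑ y, ind (onNode f.v y = onNode u a) * ind (NodeBefore f.mid y (onNode f.w a)) =
        ind (c < b) := by
    intro f b c hb hc hw hv
    rw [Fintype.sum_eq_single (onNode f.w c)]
    · rw [ind_true (by rw [f.onNode_v, hc]), one_mul, hw.eq]
      congr 1
      have hp := hsib c b (hc.symm.trans hb)
      have hl : c.1 = b.1 := level_eq_of_onNode_eq u (hc.symm.trans hb)
      rw [nodeBefore_iff_lt (by exact hl)]
      apply propext
      have hne : onNode f.w c ≠ onNode f.w b := by rw [← hw.eq]; exact hv.ne.symm
      refine ⟨fun h => ?_, fun h => lt_of_le_of_ne (onNode_mono f.w hp h.le) hne⟩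
      refine lt_of_le_of_ne ((node_le_total hl).resolve_right fun h' => ?_)
        fun e => hne (congrArg _ e)
      exact h.not_ge (onNode_mono f.w hp.symm h')
    · intro y hy
      by_cases e : onNode f.v y = onNode u a
      · have h1 : onNode f.v y = onNode f.v (onNode f.w a) := by rw [e, f.onNode_v]
        rcases hv.uniq _ _ h1 with h2 | h2 | h2
        · rw [h2, ind_false ((nodeBefore_tournament f.mid).irrefl _), mul_zero]
        · rw [h2.1, ind_false ((nodeBefore_tournament f.mid).irrefl _), mul_zero]
        · exact absurd h2.1 hy
      · rw [ind_false e, zero_mul]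
  rw [em, em', innerInv_eq_zero hsib, innerInv_eq_zero hsib, key hub huc hf hf',
    key huc hub hg hg', add_assoc _ (ind (b < c)) 1]
  congr 1
  rcases node_le_total (level_eq_of_onNode_eq u (hub.symm.trans huc)) with h | h
  · have h1 := lt_of_le_of_ne h hbc
    rw [ind_true h1, ind_false h1.not_gt]
    exact (zmod_two_add_self 1).symm
  · have h1 := lt_of_le_of_ne h hbc.symm
    rw [ind_true h1, ind_false h1.not_gt]
    rfl

/-- The case of two factorizations identifying different pairs. -/
theorem sgn_opposite_of_ne {f g : Fact u} {a b a' b' : Node τ} (hmf : IsMid f) (hmg : IsMid g)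
    (hf : Collision (onNode f.w) a b) (hg : Collision (onNode g.w) a' b')
    (hne : onNode g.w a ≠ onNode g.w b) : sgn f.w * sgn f.v = -(sgn g.w * sgn g.v) := by
  have hne' : onNode f.w a' ≠ onNode f.w b' := fun e => by
    rcases hf.uniq _ _ e with h | ⟨rfl, rfl⟩ | ⟨rfl, rfl⟩
    · exact hg.ne h
    · exact hne hg.eq
    · exact hne hg.eq.symm
  have hu : onNode u a = onNode u b := by rw [← f.onNode_v, hf.eq, f.onNode_v]
  have hu' : onNode u a' = onNode u b' := by rw [← g.onNode_v, hg.eq, g.onNode_v]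
  have hf' : Collision (onNode f.v) (onNode f.w a') (onNode f.w b') := by
    obtain ⟨p, q, hpq⟩ := hmf.right
    exact hpq.rebase hne' (by rw [f.onNode_v, f.onNode_v, hu'])
  have hg' : Collision (onNode g.v) (onNode g.w a) (onNode g.w b) := by
    obtain ⟨p, q, hpq⟩ := hmg.right
    exact hpq.rebase hne (by rw [g.onNode_v, g.onNode_v, hu])
  -- Distinct parents would be merged by both `f.w` and `g.w` (`IsMid.par_eq`), forcing the two
  -- factorizations to merge the same pair.
  have hsib : ∀ x y, onNode u x = onNode u y → par τ x = par τ y := by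
    intro x y h
    by_contra hp
    have h1 := hf.rebase hp (hmf.par_eq h)
    have h2 := hg.rebase hp (hmg.par_eq h)
    rcases h1.uniq a b hf.eq with e | ⟨rfl, rfl⟩ | ⟨rfl, rfl⟩
    · exact hf.ne e
    · exact hne h2.eq
    · exact hne h2.eq.symm
  -- If both pairs lie in one fibre of `u`, they must share a node, since only one further merging
  -- is available; up to symmetry this is the triple case.
  by_cases hz : onNode u a = onNode u a'
  · have h1 : onNode f.v (onNode f.w a) = onNode f.v (onNode f.w a') := by
      rw [f.onNode_v, f.onNode_v, hz]
    have h2 : onNode f.w a = onNode f.w a' ∨ onNode f.w a = onNode f.w b' := by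
      rcases hf'.uniq _ _ h1 with h | h | h
      · exact Or.inl h
      · exact Or.inl h.1
      · exact Or.inr h.1
    have h3 : ∀ {c}, onNode f.w a = onNode f.w c → a = c ∨ b = c := fun {c} e => by
      rcases hf.uniq _ _ e with h | h | h
      · exact Or.inl h
      · exact Or.inr h.2.symm
      · exact absurd h.1 hf.ne
    rcases h2 with h2 | h2 <;> rcases h3 h2 with rfl | rfl
    · exact sgn_opposite_of_triple hsib hf hg hf' hg'
    · exact sgn_opposite_of_triple hsib hf.symm hg hf' hg'.symm
    · exact sgn_opposite_of_triple hsib hf hg.symm hf'.symm hg'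
    · exact sgn_opposite_of_triple hsib hf.symm hg.symm hf'.symm hg'.symm
  -- Over different nodes of `σ` the two mergings commute, and only the indicator comparing `u a`
  -- with `u a'` changes.
  · obtain ⟨m, hm, em⟩ := sgn_mul_sgn_eq hf hf'
    obtain ⟨m', hm', em'⟩ := sgn_mul_sgn_eq hg hg'
    refine sgn_opposite hm hm' ?_
    rw [em, em', innerInv_eq_zero hsib, innerInv_eq_zero hsib, sum_eq_zero_of_ne hf' hz,
      sum_eq_zero_of_ne hg' (Ne.symm hz), (nodeBefore_tournament σ).ind_swap hz]
    ring

/-- The case of two factorizations identifying the same pair. -/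
theorem sgn_opposite_of_eq {f g : Fact u} {a b x y : Node τ} (hmf : IsMid f) (hmg : IsMid g)
    (hf : Collision (onNode f.w) a b) (hg : Collision (onNode g.w) a b)
    (hx : factOrder f x y) (hy : ¬ factOrder g x y) :
    sgn f.w * sgn f.v = -(sgn g.w * sgn g.v) := by
  rw [hmf.factOrder_iff] at hx
  rw [hmg.factOrder_iff] at hy
  have hu := hx.1
  have hl := level_eq_of_onNode_eq u hu
  have hxy : x ≠ y := fun e => hy ⟨hu, by rw [e]⟩
  have hy1 : onNode g.w y < onNode g.w x := by
    have h1 := (node_le_total (v := onNode g.w x) (w := onNode g.w y) hl).resolve_left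
      fun h => hy ⟨hu, h⟩
    exact lt_of_le_of_ne h1 fun e => hy ⟨hu, e.ge⟩
  have hx1 : onNode f.w x < onNode f.w y := by
    refine lt_of_le_of_ne hx.2 fun e => hy1.ne' ?_
    rcases (hf.rebase hxy e).uniq _ _ hf.eq with h | ⟨rfl, rfl⟩ | ⟨rfl, rfl⟩
    · exact absurd h hf.ne
    · exact hg.eq
    · exact hg.eq.symm
  -- The middle trees order the images of `x` and `y` oppositely, which is impossible for siblings.
  -- So their parents are the pair merged first, and the factorizations differ by the shuffle of the
  -- children.
  have hp : par τ x ≠ par τ y := by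
    intro hp
    rcases node_le_total hl with h | h
    · exact hy1.not_ge (onNode_mono g.w hp h)
    · exact hx1.not_ge (onNode_mono f.w hp.symm h)
  -- `a` is a parent of `x` or `y`, hence at another level.
  have hza : onNode u a ≠ onNode u x := by
    intro e
    have h1 := hf.rebase hp (hmf.par_eq hu)
    have hla := level_eq_of_onNode_eq u e
    refine hxy (node_eq_of_level_par ?_ hl)
    rcases h1.uniq _ _ hf.eq with h | ⟨h, -⟩ | ⟨h, -⟩
    · exact absurd h hf.ne
    · rw [← h, hla]
    · rw [level_par_eq hl, ← h, hla]
  -- The only pair that can contribute to the inner inversions is `{x, y}`: other nodes with equal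
  -- image under `u` are already equal after `f.w`. As `f.w` and `g.w` order `x` and `y` oppositely,
  -- exactly one of the two counts is `1`.
  have key : ∀ {f : Fact u}, IsMid f → Collision (onNode f.w) a b → onNode f.w x ≠ onNode f.w y →
      Collision (onNode f.v) (onNode f.w x) (onNode f.w y) ∧
      innerInv (NodeBefore τ) (NodeBefore f.mid) (onNode f.w) (onNode u) =
        ind (NodeBefore τ x y) * ind (onNode f.w y < onNode f.w x) +
          ind (NodeBefore τ y x) * ind (onNode f.w x < onNode f.w y) := by
    intro f hmf hf hne
    have hv : Collision (onNode f.v) (onNode f.w x) (onNode f.w y) := by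
      obtain ⟨p, q, hpq⟩ := hmf.right
      exact hpq.rebase hne (by rw [f.onNode_v, f.onNode_v, hu])
    refine ⟨hv, ?_⟩
    have hinj : ∀ {c d : Node τ}, onNode u d = onNode u x → onNode f.w c = onNode f.w d →
        c = d := by
      intro c d hd e
      rcases hf.uniq _ _ e with h | h | h
      · exact h
      · refine absurd ?_ hza
        rw [← f.onNode_v, hf.eq, f.onNode_v, ← h.2, hd]
      · exact absurd (by rw [← h.2, hd]) hza
    unfold innerInv
    rw [← Fintype.sum_prod_type' (f := fun c d => ind (NodeBefore τ c d) *
      (ind (onNode u c = onNode u d) * ind (NodeBefore f.mid (onNode f.w d) (onNode f.w c)))),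
      Fintype.sum_eq_add (x, y) (y, x) (fun e => hxy (congrArg Prod.fst e))]
    · simp only
      rw [ind_true hu, ind_true hu.symm, one_mul, one_mul,
        nodeBefore_iff_lt (v := onNode f.w y) (w := onNode f.w x) hl.symm,
        nodeBefore_iff_lt (v := onNode f.w x) (w := onNode f.w y) hl]
    · rintro ⟨c, d⟩ ⟨h1, h2⟩
      simp only
      by_cases e : onNode u c = onNode u d
      · have e' : onNode f.v (onNode f.w c) = onNode f.v (onNode f.w d) := by
          rw [f.onNode_v, f.onNode_v, e]
        rcases hv.uniq _ _ e' with h | h | h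
        · rw [h, ind_false ((nodeBefore_tournament f.mid).irrefl _), mul_zero, mul_zero]
        · exact absurd (Prod.ext (hinj rfl h.1) (hinj hu.symm h.2)) h1
        · exact absurd (Prod.ext (hinj hu.symm h.1) (hinj rfl h.2)) h2
      · rw [ind_false e, zero_mul, mul_zero]
  obtain ⟨hf', ef⟩ := key hmf hf hx1.ne
  obtain ⟨hg', eg⟩ := key hmg hg hy1.ne'
  obtain ⟨m, hm, em⟩ := sgn_mul_sgn_eq hf hf'
  obtain ⟨m', hm', em'⟩ := sgn_mul_sgn_eq hg hg'
  refine sgn_opposite hm hm' ?_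
  rw [em, em', sum_eq_zero_of_ne hf' hza, sum_eq_zero_of_ne hg' hza, ef, eg, ind_true hx1,
    ind_true hy1, ind_false hx1.not_gt, ind_false hy1.not_gt,
    (nodeBefore_tournament τ).ind_swap hxy]
  ring

/-- Two different factorizations of a morphism of degree two in morphisms of degree one have
opposite signs. -/
theorem sgn_mul_sgn_of_ne {f g : Fact u} (hmf : IsMid f) (hmg : IsMid g) (h : f ≠ g) :
    sgn f.w * sgn f.v = -(sgn g.w * sgn g.v) := by
  obtain ⟨a, b, hf⟩ := hmf.left
  obtain ⟨a', b', hg⟩ := hmg.left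
  by_cases e : onNode g.w a = onNode g.w b
  · have hg1 := hg.rebase hf.ne e
    have h1 : ∃ x y, ¬ (factOrder f x y ↔ factOrder g x y) := by
      by_contra! h1
      exact h (factOrder_injective (funext fun x => funext fun y => propext (h1 x y)))
    obtain ⟨x, y, hxy⟩ := h1
    by_cases hx : factOrder f x y
    · exact sgn_opposite_of_eq hmf hmg hf hg1 hx fun h' => hxy ⟨fun _ => h', fun _ => hx⟩
    · have hy : factOrder g x y := by
        by_contra h'
        exact hxy ⟨fun h => absurd h hx, fun h => absurd h h'⟩
      rw [sgn_opposite_of_eq hmg hmf hg1 hf hy hx, neg_neg]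
  · exact sgn_opposite_of_ne hmf hmg hf hg e

theorem isMid_of_deg {f : Fact u} (h : τ.deg = f.mid.deg + 1) (h' : f.mid.deg = σ.deg + 1) :
    IsMid f :=
  ⟨exists_collision_onNode f.w h, exists_collision_onNode f.v h'⟩

end

/-! ## The matching of factorizations -/

/-- Climb from two identified nodes: their ancestors stay identified and coincide at the root, so
the last distinct ones are siblings. -/
theorem exists_siblings {u : τ ⟶ σ} {x y : Node τ} (hxy : x ≠ y) (h : onNode u x = onNode u y) :
    ∃ x y : Node τ, x ≠ y ∧ onNode u x = onNode u y ∧ par τ x = par τ y := by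
  obtain ⟨i, x⟩ := x
  obtain ⟨j, y⟩ := y
  obtain rfl : i = j := level_eq_of_onNode_eq u h
  induction i using Fin.reverseInduction with
  | last => exact absurd (node_root_unique rfl rfl) hxy
  | cast i ih =>
    by_cases hp : par τ ⟨i.castSucc, x⟩ = par τ ⟨i.castSucc, y⟩
    · exact ⟨_, _, hxy, h, hp⟩
    · have h1 : onNode u (par τ ⟨i.castSucc, x⟩) = onNode u (par τ ⟨i.castSucc, y⟩) := by
        rw [onNode_par, onNode_par, h]
      rw [par_castSucc, par_castSucc] at hp h1
      exact ih _ _ hp h1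

theorem exists_first_sibling {u : τ ⟶ σ} (hu : ¬ Function.Injective (onNode u)) :
    ∃ a b : Node τ, a ≠ b ∧ FibLE u a b ∧
      ∀ z, par τ z = par τ a → onNode u z = onNode u a → a ≤ z := by
  simp only [Function.Injective, not_forall] at hu
  obtain ⟨x, y, h, hxy⟩ := hu
  obtain ⟨x, y, hxy, h, hp⟩ := exists_siblings hxy h
  obtain ⟨a, ⟨ha1, ha2⟩, hmin⟩ := (Set.toFinite {z | par τ z = par τ x ∧
    onNode u z = onNode u x}).exists_minimal ⟨x, rfl, rfl⟩
  have hle : ∀ z, par τ z = par τ a → onNode u z = onNode u a → a ≤ z := fun z h1 h2 =>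
    (node_le_total (level_eq_of_onNode_eq u h2)).elim
      (hmin ⟨h1.trans ha1, h2.trans ha2⟩) id
  by_cases e : a = x
  · refine ⟨a, y, fun e' => hxy (e.symm.trans e'), ?_, hle⟩
    have h1 : par τ a = par τ y := ha1.trans hp
    have h2 : onNode u a = onNode u y := ha2.trans h
    exact ⟨h1, hle y h1.symm h2.symm, h2⟩
  · exact ⟨a, x, e, ⟨ha1, hle x ha1.symm ha2.symm, ha2⟩, hle⟩

/-- The descendants of the first element of a fibre with several elements define a colouring. -/
theorem exists_coloring {u : τ ⟶ σ} (hu : ¬ Function.Injective (onNode u)) :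
    ∃ blue : Node τ → Prop, Coloring (par τ) (onNode u) (FibLE u) (fun v => v.1.val) blue := by
  obtain ⟨a, b, hab, hF, hmin⟩ := exists_first_sibling hu
  refine ⟨fun x => ∃ m, (par τ)^[m] x = a, ?_, fun h => h.1, ?_, ?_, ?_, ?_⟩
  · rintro x y hxy ⟨m, hm⟩
    cases m with
    | zero =>
      obtain rfl : y = a := hm
      exact ⟨0, le_antisymm hxy.2.1 (hmin x hxy.1 hxy.2.2)⟩
    | succ m =>
      rw [Function.iterate_succ_apply, ← hxy.1] at hm
      exact ⟨m + 1, hm⟩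
  · rintro x y ⟨m, hm⟩ hxy
    refine ⟨?_, fun ⟨p, hp⟩ => ⟨p + 1, hp⟩⟩
    rintro ⟨p, hp⟩
    cases p with
    | zero =>
      -- Here `x = a`, and `y` is at the level of the parent of `a`; but `y`, being blue, is at the
      -- level of `a` or further from the root. The root itself is excluded because `b ≠ a` lies at
      -- the same level as `a`.
      exfalso
      obtain rfl : x = a := hp
      have h1 := congrArg Fin.val (level_eq_of_onNode_eq u hF.2.2)
      have h2 : (par τ x).1.val = y.1.val :=
        congrArg (fun z : Node σ => z.1.val) hxy
      have h3 := level_iterate m y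
      rw [hm] at h3
      have h4 := y.1.2
      rcases level_par x with h5 | ⟨h5, h6⟩
      · omega
      · exact hab (node_root_unique h6 ((Fin.ext h1.symm).trans h6))
    | succ p => exact ⟨p, hp⟩
  · intro x y h
    exact congrArg Fin.val (level_eq_of_onNode_eq u h)
  · intro x
    rcases level_par x with h | ⟨h1, h2⟩
    · left; omega
    · exact Or.inr ⟨h1, fun y hy => node_root_unique ((level_eq_of_onNode_eq u hy).trans h2) h2⟩
  · refine ⟨b, a, ⟨0, rfl⟩, ?_, hF⟩
    rintro ⟨m, hm⟩
    refine hab (hm.symm.trans (iterate_eq_self ?_))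
    rw [hm, level_eq_of_onNode_eq u hF.2.2]

/-- `g` covers `f`: there is a morphism of degree one from `f` to `g` under the source. -/
def Covers {u : τ ⟶ σ} (f g : Fact u) : Prop :=
  f.mid.deg = g.mid.deg + 1 ∧ ∃ z : f.mid ⟶ g.mid, f.w ≫ z = g.w ∧ z ≫ g.v = f.v

/-- A perfect matching of the factorizations which is acyclic with respect to a rank. -/
structure FactMatching (u : τ ⟶ σ) where
  upper : Fact u → Prop
  mate : Fact u → Fact u
  rank : Fact u → ℕ
  mate_mate : ∀ f, mate (mate f) = f
  upper_mate : ∀ f, upper (mate f) ↔ ¬ upper f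
  covers_mate : ∀ f, ¬ upper f → Covers f (mate f)
  rank_mate : ∀ f, ¬ upper f → rank (mate f) = rank f
  rank_le : ∀ f g, Covers f g → rank f ≤ rank g
  eq_mate : ∀ f g, Covers f g → ¬ upper f → upper g → rank f = rank g → g = mate f

theorem numClasses_eq {u : τ ⟶ σ} {f : Fact u} {T : Node τ → Node τ → Prop} (h : factOrder f = T)
    (hT : IsLocalOrder u T) : hT.numClasses = f.mid.deg + 1 := by
  subst h
  exact numClasses_factOrder f

theorem eq_of_factOrder_le {u : τ ⟶ σ} {f g : Fact u}
    (h : ∀ x y, factOrder f x y → factOrder g x y) (hd : f.mid.deg ≤ g.mid.deg) : f = g := by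
  have : Nonempty (Node τ) := ⟨root τ⟩
  refine factOrder_injective ((factOrder_localOrder f).eq_of_le (factOrder_localOrder g) h ?_)
  rw [numClasses_factOrder, numClasses_factOrder]
  omega

theorem covers_of_le {u : τ ⟶ σ} {f g : Fact u}
    (h : ∀ x y, factOrder f x y → factOrder g x y) (hd : f.mid.deg = g.mid.deg + 1) :
    Covers f g := ⟨hd, exists_hom_of_factOrder_le h⟩

theorem Covers.le {u : τ ⟶ σ} {f g : Fact u} (h : Covers f g) :
    ∀ x y, factOrder f x y → factOrder g x y := by
  obtain ⟨-, z, hz, -⟩ := h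
  exact factOrder_le_of_hom z hz

/-- Transports splitting and merging from local preorders to factorizations. The upper
factorizations are those whose pivot class is mixed; their mates, obtained by splitting, have one
more vertex in the middle tree. -/
theorem exists_factMatching {u : τ ⟶ σ} (hu : ¬ Function.Injective (onNode u)) :
    Nonempty (FactMatching u) := by
  classical
  have : Nonempty (Node τ) := ⟨root τ⟩
  obtain ⟨blue, hc⟩ := exists_coloring hu
  let lev : Node τ → ℕ := fun v => v.1.val
  let Q : Fact u → Prop := fun f => Mixed lev blue (factOrder f)
  have hM : ∀ f : Fact u, ¬ Q f →
      ∃ g : Fact u, factOrder g = merge (par τ) (onNode u) lev blue (factOrder f) := fun f hf =>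
    exists_factOrder_eq (hc.merge_localOrder (factOrder_localOrder f) hf)
  have hS : ∀ f : Fact u, ∃ g : Fact u, factOrder g = split (par τ) lev blue (factOrder f) :=
    fun f => exists_factOrder_eq (hc.split_localOrder (factOrder_localOrder f))
  choose mu hmu using hM
  choose nu hnu using hS
  have Qmu : ∀ f hf, Q (mu f hf) := fun f hf => by
    simp only [Q, hmu]
    exact hc.merge_mixed (factOrder_localOrder f) hf
  have Qnu : ∀ f, ¬ Q (nu f) := fun f => by
    simp only [Q, hnu]
    exact hc.split_not_mixed (factOrder_localOrder f)
  have nu_mu : ∀ f hf, nu (mu f hf) = f := fun f hf => factOrder_injective (by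
    rw [hnu, hmu]
    exact hc.split_merge (factOrder_localOrder f) hf)
  have deg_nu : ∀ f, Q f → (nu f).mid.deg = f.mid.deg + 1 := fun f hf => by
    have h := hc.numClasses_split (factOrder_localOrder f) hf
    rw [numClasses_eq (hnu f), numClasses_factOrder] at h
    omega
  have deg_mu : ∀ f hf, f.mid.deg = (mu f hf).mid.deg + 1 := fun f hf => by
    rw [← deg_nu _ (Qmu f hf), nu_mu]
  have agree_mu : ∀ f hf, AgreeOff blue (factOrder f) (factOrder (mu f hf)) := fun f hf => by
    rw [hmu]
    exact hc.merge_agreeOff (factOrder_localOrder f) hf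
  have agree_nu : ∀ f, AgreeOff blue (factOrder f) (factOrder (nu f)) := fun f => by
    rw [hnu]
    exact hc.split_agreeOff (factOrder_localOrder f)
  -- The merge of `f` lies below `g` and has the same number of classes, hence equals it.
  have eq_mu : ∀ f g hf, Q g → (∀ x y, factOrder f x y → factOrder g x y) →
      f.mid.deg = g.mid.deg + 1 → AgreeOff blue (factOrder f) (factOrder g) → g = mu f hf := by
    intro f g hf hg hle hd hG
    refine (eq_of_factOrder_le ?_ ?_).symm
    · rw [hmu]
      exact hc.merge_le (factOrder_localOrder f) hf (factOrder_localOrder g) hg hG hle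
    · have := deg_mu f hf
      omega
  have mu_nu : ∀ f (hf : Q f), mu (nu f) (Qnu f) = f := fun f hf => by
    refine (eq_mu (nu f) f (Qnu f) hf (fun x y h => ?_) (deg_nu f hf) (agree_nu f).symm).symm
    rw [hnu] at h
    exact h.1
  -- The rank counts the related pairs that are not (red, blue). It grows along covers, and equality
  -- of ranks along a cover means agreement off the (red, blue) pairs, so that `eq_mu` applies.
  let A : Fact u → Set (Node τ × Node τ) := fun f =>
    {p | factOrder f p.1 p.2 ∧ (blue p.1 ∨ ¬ blue p.2)}
  have hA : ∀ f g, A f = A g ↔ AgreeOff blue (factOrder f) (factOrder g) := by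
    intro f g
    refine ⟨fun h x y hxy => ?_, fun h => Set.ext fun p => and_congr_left fun hp => h _ _ hp⟩
    have h1 : (x, y) ∈ A f ↔ (x, y) ∈ A g := by rw [h]
    exact ⟨fun h2 => (h1.1 ⟨h2, hxy⟩).1, fun h2 => (h1.2 ⟨h2, hxy⟩).1⟩
  have hsub : ∀ f g, Covers f g → A f ⊆ A g := fun f g h p hp => ⟨h.le _ _ hp.1, hp.2⟩
  refine ⟨⟨Q, fun f => if hf : Q f then nu f else mu f hf, fun f => (A f).ncard,
    ?_, ?_, ?_, ?_, ?_, ?_⟩⟩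
  · intro f
    by_cases hf : Q f
    · simp only [hf, dif_pos, Qnu, dite_false]
      exact mu_nu f hf
    · simp only [hf, Qmu, dite_true, dite_false, nu_mu]
  · intro f
    by_cases hf : Q f
    · simp [hf, Qnu]
    · simp [hf, Qmu]
  · intro f hf
    simp only [hf, dite_false]
    refine covers_of_le (fun x y h => ?_) (deg_mu f hf)
    rw [hmu]
    exact Or.inl h
  · intro f hf
    simp only [hf, dite_false]
    rw [(hA _ _).2 (agree_mu f hf).symm]
  · intro f g h
    exact Set.ncard_le_ncard (hsub f g h) (Set.toFinite _)
  · intro f g h hf hg hr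
    simp only [hf, dite_false]
    have h1 := Set.eq_of_subset_of_ncard_le (hsub f g h) hr.ge (Set.toFinite _)
    exact eq_mu f g hf hg h.le h.1 ((hA f g).1 h1)

/-- A morphism of degree two has exactly two factorizations in morphisms of degree one. -/
theorem exists_two_mids {u : τ ⟶ σ} (h : τ.deg = σ.deg + 2) : ∃ f g : Fact u, f ≠ g ∧
    f.mid.deg = σ.deg + 1 ∧ g.mid.deg = σ.deg + 1 ∧
      ∀ e : Fact u, e.mid.deg = σ.deg + 1 → e = f ∨ e = g := by
  have hu : ¬ Function.Injective (onNode u) := fun hi => by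
    have := Nat.card_le_card_of_injective _ hi
    rw [card_node, card_node] at this
    omega
  obtain ⟨M⟩ := exists_factMatching hu
  let bot : Fact u := ⟨τ, 𝟙 τ, u, Category.id_comp u⟩
  let top : Fact u := ⟨σ, u, 𝟙 σ, Category.comp_id u⟩
  have hbot : ∀ f : Fact u, f.mid.deg = τ.deg → f = bot := by
    rintro ⟨θ, w, v, e⟩ hd
    obtain rfl : τ = θ := eq_of_deg_le w hd.ge
    obtain rfl := end_eq_id w
    rw [Category.id_comp] at e
    subst e
    rfl
  have htop : ∀ f : Fact u, f.mid.deg = σ.deg → f = top := by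
    rintro ⟨θ, w, v, e⟩ hd
    obtain rfl : θ = σ := eq_of_deg_le v hd.le
    obtain rfl := end_eq_id v
    rw [Category.comp_id] at e
    subst e
    rfl
  have hcov : ∀ f, M.upper f → Covers (M.mate f) f := fun f hf => by
    have h1 := M.covers_mate (M.mate f) (by rw [M.upper_mate]; exact not_not.2 hf)
    rwa [M.mate_mate] at h1
  have hb : ¬ M.upper bot := fun hb => by
    have h1 := (hcov bot hb).1
    have h2 := deg_le (M.mate bot).w
    simp only [bot] at h1 h2
    omega
  have ht : M.upper top := by
    by_contra ht
    have h1 := (M.covers_mate top ht).1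
    have h2 := deg_le (M.mate top).v
    simp only [top] at h1 h2
    omega
  have hd1 := (M.covers_mate bot hb).1
  have hd2 := (hcov top ht).1
  simp only [bot] at hd1
  simp only [top] at hd2
  -- In degree two only the three consecutive middle degrees occur, and the extreme ones are
  -- attained only by `bot` and `top`. A factorization in between is matched downwards to `top` or
  -- upwards to `bot`, so it is one of their mates.
  refine ⟨M.mate bot, M.mate top, fun e => ?_, by simp only [bot]; omega, by simp only [top]; omega,
    fun e he => ?_⟩
  · have h1 := congrArg M.mate e
    rw [M.mate_mate, M.mate_mate] at h1
    exact hb (h1 ▸ ht)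
  · by_cases hq : M.upper e
    · left
      rw [← hbot (M.mate e) (by have := (hcov e hq).1; omega), M.mate_mate]
    · right
      rw [← htop (M.mate e) (by have := (M.covers_mate e hq).1; omega), M.mate_mate]

end PTree

/-! ## Exactness from a perfect matching -/

section Exact

variable {k : Type u} [CommRing k] {S : Type} [Finite S]

/-- A differential on the functions on `S` is exact if there is a perfect matching such that the
matched coefficients are invertible and the other coefficients, from lower to upper elements,
increase a rank. -/
theorem exact_of_matching (δ : (S → k) →ₗ[k] (S → k)) (hδ : ∀ a, δ (δ a) = 0)
    [DecidableEq S] (upper : S → Prop) (mate : S → S) (rank : S → ℕ)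
    (mate_mate : ∀ s, mate (mate s) = s) (upper_mate : ∀ s, upper (mate s) ↔ ¬ upper s)
    (rank_mate : ∀ s, ¬ upper s → rank (mate s) = rank s)
    (hunit : ∀ s, ¬ upper s → IsUnit (δ (Pi.single s 1) (mate s)))
    (hlt : ∀ s t, ¬ upper s → upper t → t ≠ mate s → δ (Pi.single s 1) t ≠ 0 → rank s < rank t)
    {a : S → k} (ha : δ a = 0) : ∃ b, δ b = a := by
  have : Fintype S := Fintype.ofFinite S
  have hexp : ∀ b t, δ b t = ∑ s, b s * δ (Pi.single s 1) t := by
    intro b t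
    conv_lhs => rw [pi_eq_sum_univ' b, map_sum, Finset.sum_apply]
    refine Finset.sum_congr rfl fun s _ => ?_
    rw [map_smul, Pi.smul_apply, smul_eq_mul]
  -- Solve `δ b = a` on upper elements by increasing rank. A correction supported on lower elements
  -- of rank `m` changes no upper coordinate of smaller rank, and in rank `m` acts only through the
  -- invertible matched coefficients.
  have step : ∀ m : ℕ, ∃ b : S → k, ∀ t, upper t → rank t < m → δ b t = a t := by
    intro m
    induction m with
    | zero => exact ⟨0, fun t _ h => absurd h (Nat.not_lt_zero _)⟩
    | succ m ih =>
      obtain ⟨b, hb⟩ := ih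
      classical
      let c : S → k := fun s => if h : ¬ upper s ∧ rank s = m then
        (hunit s h.1).unit⁻¹ * (a (mate s) - δ b (mate s)) else 0
      have hc : ∀ s, ¬ (¬ upper s ∧ rank s = m) → c s = 0 := fun s h => dif_neg h
      have hs : ∀ s, ¬ upper s ∧ rank s = m →
          c s * δ (Pi.single s 1) (mate s) = a (mate s) - δ b (mate s) := by
        intro s h
        simp only [c, dif_pos h]
        rw [mul_right_comm, IsUnit.val_inv_mul, one_mul]
      refine ⟨b + c, fun t ht htm => ?_⟩
      rw [map_add, Pi.add_apply, hexp c t]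
      have hz : ∀ s, s ≠ mate t → rank t ≤ m → c s * δ (Pi.single s 1) t = 0 := by
        intro s hs htm
        by_cases h : ¬ upper s ∧ rank s = m
        · by_contra h1
          have h2 : δ (Pi.single s 1) t ≠ 0 := fun e => h1 (by rw [e, mul_zero])
          have := hlt s t h.1 ht (fun e => hs (by rw [e, mate_mate])) h2
          omega
        · rw [hc s h, zero_mul]
      have hmt : ¬ upper (mate t) := by rw [upper_mate]; exact not_not.2 ht
      have hrt := rank_mate _ hmt
      rw [mate_mate] at hrt
      rw [Fintype.sum_eq_single (mate t) fun s hs => hz s hs (by omega)]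
      by_cases htm' : rank t = m
      · have h : ¬ upper (mate t) ∧ rank (mate t) = m := ⟨hmt, by omega⟩
        have h1 := hs _ h
        rw [mate_mate] at h1
        rw [h1, add_sub_cancel]
      · rw [hc _ (by omega), zero_mul, add_zero]
        exact hb t ht (by omega)
  obtain ⟨b, hb⟩ := step (∑ t, rank t + 1)
  have hb' : ∀ t, upper t → δ b t = a t := fun t ht => hb t ht (Nat.lt_succ_of_le
    (Finset.single_le_sum (f := rank) (fun _ _ => Nat.zero_le _) (Finset.mem_univ t)))
  refine ⟨b, ?_⟩
  let e : S → k := a - δ b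
  have he : δ e = 0 := by rw [map_sub, ha, hδ, sub_zero]
  have heu : ∀ t, upper t → e t = 0 := fun t ht => sub_eq_zero.2 (hb' t ht).symm
  -- A cycle supported on lower elements is zero: its boundary at `mate s` is a unit times `e s`, up
  -- to terms of smaller rank that have already been shown to vanish.
  have hel : ∀ m s, ¬ upper s → rank s = m → e s = 0 := by
    intro m
    induction m using Nat.strong_induction_on with
    | _ m ih =>
      intro s hs hsm
      have h1 := congrFun he (mate s)
      rw [hexp, Fintype.sum_eq_single s] at h1
      · exact (hunit s hs).mul_left_eq_zero.1 h1
      · intro s' hs'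
        by_cases hu : upper s'
        · rw [heu s' hu, zero_mul]
        · by_contra h2
          have h3 : δ (Pi.single s' 1) (mate s) ≠ 0 := fun e' => h2 (by rw [e', mul_zero])
          have h4 := hlt s' (mate s) hu ((upper_mate s).2 hs)
            (fun e' => hs' (by rw [← mate_mate s, e', mate_mate])) h3
          rw [rank_mate s hs] at h4
          exact h2 (by rw [ih _ (by omega) s' hu rfl, zero_mul])
  funext s
  have : e s = 0 := by
    by_cases hu : upper s
    · exact heu s hu
    · exact hel _ s hu rfl
  exact (sub_eq_zero.1 this).symm

end Exact

/-! ## The Koszul complex -/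

section KoszulComplex

open PTree

variable {k : Type u} [CommRing k] {n : ℕ} {τ σ : PTree n}

/-- The sign of a morphism of degree one, and zero for the other morphisms. -/
noncomputable def sgn' (k : Type u) [CommRing k] {τ σ : PTree n} (u : τ ⟶ σ) : k :=
  if τ.deg = σ.deg + 1 then (sgn u : k) else 0

theorem sgn'_isUnit {u : τ ⟶ σ} (h : τ.deg = σ.deg + 1) : IsUnit (sgn' k u) := by
  rw [sgn', if_pos h, sgn, Int.cast_pow, Int.cast_neg, Int.cast_one]
  exact (isUnit_one.neg).pow _

/-- In degree two there are exactly two nonzero terms, of opposite signs; in any other degree every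
term has a factor zero. This one identity serves both `δ² = 0` for the Koszul complex and the
compatibility of `ε` with differentials. -/
theorem sum_sgn'_mul_sgn' (u : τ ⟶ σ) : ∑ f : Fact u, sgn' k f.w * sgn' k f.v = 0 := by
  have hz : ∀ f : Fact u, ¬ (τ.deg = σ.deg + 2 ∧ f.mid.deg = σ.deg + 1) →
      sgn' k f.w * sgn' k f.v = 0 := fun f hf => by
    by_cases h1 : τ.deg = f.mid.deg + 1
    · rw [sgn', sgn', if_neg (c := f.mid.deg = σ.deg + 1) (by omega), mul_zero]
    · rw [sgn', if_neg h1, zero_mul]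
  by_cases h : τ.deg = σ.deg + 2
  · obtain ⟨f, g, hne, hf, hg, hall⟩ := exists_two_mids (u := u) h
    rw [Fintype.sum_eq_add f g hne fun e he => hz e fun h1 => by
      rcases hall e h1.2 with h2 | h2
      · exact he.1 h2
      · exact he.2 h2]
    have h1 := sgn_mul_sgn_of_ne (isMid_of_deg (f := f) (by omega) hf)
      (isMid_of_deg (f := g) (by omega) hg) hne
    rw [sgn', sgn', sgn', sgn', if_pos (by omega), if_pos (by omega), if_pos (by omega),
      if_pos (by omega), ← Int.cast_mul, h1]
    simp
  · exact Finset.sum_eq_zero fun f _ => hz f fun h1 => h h1.1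

/-- The factorization `u = (v v') w'` induced by a factorization `w = v' w'`. -/
def PTree.Fact.pull {u : τ ⟶ σ} (f : Fact u) (g : Fact f.w) : Fact u :=
  ⟨g.mid, g.w, g.v ≫ f.v, by rw [← Category.assoc, g.comp_eq, f.comp_eq]⟩

/-- The differential of the Koszul complex of a morphism. -/
noncomputable def koszulDiff (k : Type u) [CommRing k] (u : τ ⟶ σ) :
    (Fact u → k) →ₗ[k] (Fact u → k) where
  toFun a f := ∑ g : Fact f.w, sgn' k g.v * a (f.pull g)
  map_add' a b := by
    funext f
    simp only [Pi.add_apply, mul_add, Finset.sum_add_distrib]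
  map_smul' c a := by
    funext f
    simp only [Pi.smul_apply, smul_eq_mul, Finset.mul_sum, RingHom.id_apply]
    exact Finset.sum_congr rfl fun _ _ => mul_left_comm _ _ _

theorem koszulDiff_apply (u : τ ⟶ σ) (a : Fact u → k) (f : Fact u) :
    koszulDiff k u a f = ∑ g : Fact f.w, sgn' k g.v * a (f.pull g) := rfl

/-- Reassociating the double factorizations with `factAssoc` isolates, for each coefficient of `a`,
the sum `sum_sgn'_mul_sgn'` of a single morphism. -/
theorem koszulDiff_koszulDiff (u : τ ⟶ σ) (a : Fact u → k) :
    koszulDiff k u (koszulDiff k u a) = 0 := by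
  funext f
  simp only [koszulDiff_apply, Pi.zero_apply, Finset.mul_sum]
  have h1 : ∑ g : Fact f.w, ∑ h : Fact g.w, sgn' k g.v * (sgn' k h.v * a ((f.pull g).pull h)) =
      ∑ p : Σ g : Fact f.w, Fact g.w,
        sgn' k p.1.v * (sgn' k p.2.v * a ((f.pull p.1).pull p.2)) :=
    (Fintype.sum_sigma' (fun (g : Fact f.w) (h : Fact g.w) =>
      sgn' k g.v * (sgn' k h.v * a ((f.pull g).pull h)))).symm
  refine h1.trans ?_
  have h2 : ∑ p : Σ g : Fact f.w, Fact g.w,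
        sgn' k p.1.v * (sgn' k p.2.v * a ((f.pull p.1).pull p.2)) =
      ∑ p : Σ g : Fact f.w, Fact g.v,
        (sgn' k p.2.w * sgn' k p.2.v) * a (f.pull p.1) := by
    refine (Fintype.sum_equiv (factAssoc f.w) _ _ ?_).symm
    rintro ⟨g, h⟩
    change sgn' k h.w * sgn' k h.v * a (f.pull g) = sgn' k h.v * (sgn' k h.w * a _)
    have e : (f.pull ((factAssoc f.w) ⟨g, h⟩).1).pull ((factAssoc f.w) ⟨g, h⟩).2 = f.pull g := by
      change (⟨g.mid, g.w, h.w ≫ (h.v ≫ f.v), _⟩ : Fact u) = ⟨g.mid, g.w, g.v ≫ f.v, _⟩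
      congr 1
      rw [← Category.assoc, h.comp_eq]
    rw [← e]
    ring
  rw [h2, Fintype.sum_sigma]
  refine Finset.sum_eq_zero fun g _ => ?_
  dsimp only
  rw [← Finset.sum_mul, sum_sgn'_mul_sgn', zero_mul]

open Classical in
-- Since `f.w` is epi, `z` is the only morphism from `f` to `g` under the source, so the matrix
-- coefficient has a single term; on matched pairs it is a sign, hence invertible over any `k`.
theorem koszulDiff_single_of_hom {u : τ ⟶ σ} {f g : Fact u} (z : f.mid ⟶ g.mid)
    (h1 : f.w ≫ z = g.w) (h2 : z ≫ g.v = f.v) :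
    koszulDiff k u (Pi.single f 1) g = sgn' k z := by
  obtain ⟨θ, w, v, e⟩ := f
  dsimp only at z h1 h2
  rw [koszulDiff_apply, Fintype.sum_eq_single (⟨θ, w, z, h1⟩ : Fact g.w)]
  · have h : g.pull ⟨θ, w, z, h1⟩ = ⟨θ, w, v, e⟩ := by
      unfold Fact.pull
      congr 1
    rw [h, Pi.single_eq_same, mul_one]
  · rintro ⟨θ', w', v', e'⟩ hne
    rw [Pi.single_eq_of_ne, mul_zero]
    intro h
    apply hne
    unfold Fact.pull at h
    dsimp only at h
    injection h with h3 h4 h5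
    subst h3
    obtain rfl := eq_of_heq h4
    congr 1
    rw [← cancel_epi w', e', h1]

open Classical in
theorem covers_of_koszulDiff_ne_zero {u : τ ⟶ σ} {f g : Fact u}
    (h : koszulDiff k u (Pi.single f 1) g ≠ 0) : Covers f g := by
  rw [koszulDiff_apply] at h
  obtain ⟨e, -, he⟩ := Finset.exists_ne_zero_of_sum_ne_zero h
  have h1 : g.pull e = f := by
    by_contra h2
    rw [Pi.single_eq_of_ne h2, mul_zero] at he
    exact he rfl
  have h3 : e.mid.deg = g.mid.deg + 1 := by
    by_contra h2
    rw [sgn', if_neg h2, zero_mul] at he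
    exact he rfl
  subst h1
  exact ⟨h3, e.v, e.comp_eq, rfl⟩

/-- The Koszul complex is exact. -/
theorem koszulDiff_exact {u : τ ⟶ σ} (hu : τ ≠ σ) {a : Fact u → k} (ha : koszulDiff k u a = 0) :
    ∃ b, koszulDiff k u b = a := by
  classical
  have hu' : ¬ Function.Injective (onNode u) := fun hi => by
    have := Nat.card_le_card_of_injective _ hi
    rw [card_node, card_node] at this
    exact hu (eq_of_deg_le u (by omega))
  obtain ⟨M⟩ := exists_factMatching hu'
  refine exact_of_matching (koszulDiff k u) (koszulDiff_koszulDiff u) M.upper M.mate M.rank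
    M.mate_mate M.upper_mate M.rank_mate ?_ ?_ ha
  · intro s hs
    obtain ⟨hd, z, h1, h2⟩ := M.covers_mate s hs
    rw [koszulDiff_single_of_hom z h1 h2]
    exact sgn'_isUnit hd
  · intro s t hs ht hne h
    have hc := covers_of_koszulDiff_ne_zero h
    exact lt_of_le_of_ne (M.rank_le s t hc) fun e => hne (M.eq_mate s t hc hs ht e)

/-- A graded version of the exactness of the Koszul complex. -/
theorem koszulDiff_exact_graded {u : τ ⟶ σ} (hu : τ ≠ σ) {a : Fact u → k} {d : ℕ}
    (hd : ∀ f, a f ≠ 0 → f.mid.deg = d) (ha : koszulDiff k u a = 0) :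
    ∃ b, koszulDiff k u b = a ∧ ∀ f, b f ≠ 0 → f.mid.deg = d + 1 := by
  classical
  obtain ⟨b, hb⟩ := koszulDiff_exact hu ha
  -- The differential lowers the degree of the middle tree by one, so only this component of `b`
  -- contributes in degree `d`.
  let b' : Fact u → k := fun f => if f.mid.deg = d + 1 then b f else 0
  refine ⟨b', ?_, fun f hf => by_contra fun h => hf (if_neg h)⟩
  funext f
  by_cases h : f.mid.deg = d
  · rw [← hb, koszulDiff_apply, koszulDiff_apply]
    refine Finset.sum_congr rfl fun g _ => ?_
    by_cases h1 : g.mid.deg = f.mid.deg + 1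
    · have h2 : b' (f.pull g) = b (f.pull g) := if_pos (by rw [← h]; exact h1)
      rw [h2]
    · rw [sgn', if_neg h1, zero_mul, zero_mul]
  · have h0 : a f = 0 := by
      by_contra h1
      exact h (hd f h1)
    rw [h0, koszulDiff_apply]
    refine Finset.sum_eq_zero fun g _ => ?_
    by_cases h1 : g.mid.deg = f.mid.deg + 1
    · have h2 : b' (f.pull g) = 0 := if_neg fun h3 => h (by
        have : g.mid.deg = d + 1 := h3
        omega)
      rw [h2, mul_zero]
    · rw [sgn', if_neg h1, zero_mul]

end KoszulComplex

noncomputable section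

/-! ## Left coordinates in a tensor algebra -/

section LeftCoord

variable {k : Type u} [CommRing k] {M : Type*} [AddCommGroup M] [Module k M]

/-- Auxiliary algebra map with values in triangular matrices. -/
def leftCoordAlg (φ : M →ₗ[k] k) :
    TensorAlgebra k M →ₐ[k] Matrix (Fin 2) (Fin 2) (TensorAlgebra k M) :=
  TensorAlgebra.lift k
    { toFun := fun m => !![0, algebraMap k _ (φ m); 0, TensorAlgebra.ι k m]
      map_add' := fun x y => by
        ext i j; fin_cases i <;> fin_cases j <;> simp
      map_smul' := fun c x => by
        ext i j; fin_cases i <;> fin_cases j <;> simp [Algebra.smul_def] }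

/-- The linear map sending `m ⊗ t` to `φ m • t` and `1` to `0`. -/
def leftCoord (φ : M →ₗ[k] k) : TensorAlgebra k M →ₗ[k] TensorAlgebra k M where
  toFun t := leftCoordAlg φ t 0 1
  map_add' s t := by simp
  map_smul' c t := by simp

theorem leftCoordAlg_apply (φ : M →ₗ[k] k) (t : TensorAlgebra k M) :
    leftCoordAlg φ t 1 0 = 0 ∧ leftCoordAlg φ t 1 1 = t := by
  induction t using TensorAlgebra.induction with
  | algebraMap r => simp [Matrix.algebraMap_matrix_apply]
  | ι x => simp [leftCoordAlg]
  | mul a b ha hb => simp [Matrix.mul_apply, Fin.sum_univ_two, ha, hb]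
  | add a b ha hb => simp [ha, hb]

theorem leftCoord_one (φ : M →ₗ[k] k) : leftCoord φ 1 = 0 := by
  simp [leftCoord]

/-- The first row of the matrix of `m` is `(0, φ m)` and the lower right entry is multiplicative, so
`φ` reads only the first letter. -/
theorem leftCoord_ι_mul (φ : M →ₗ[k] k) (m : M) (t : TensorAlgebra k M) :
    leftCoord φ (TensorAlgebra.ι k m * t) = φ m • t := by
  change leftCoordAlg φ (TensorAlgebra.ι k m * t) 0 1 = _
  rw [map_mul, Matrix.mul_apply, Fin.sum_univ_two, (leftCoordAlg_apply φ t).2]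
  simp [leftCoordAlg, Algebra.smul_def]

end LeftCoord

/-! ## Generators of the cobar construction -/

section CobarGen

open PTree

/-- The desuspension as a map of total modules. -/
def redTot {k : Type u} [CommRing k] {X : Type} (Γ : DGGraph k X) :
    Tot Γ →ₗ[k] Tot (cobarGraph Γ) :=
  totLift fun i b a =>
    incl (cobarGraph Γ) (i - 1) b a ∘ₗ toCobar Γ b a (show i = i - 1 + 1 by lia)

theorem ι_redTot {k : Type u} [CommRing k] {X : Type} (Γ : DGGraph k X) (z : Tot Γ) :
    TensorAlgebra.ι k (redTot Γ z) = redGen Γ z := by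
  suffices h : TensorAlgebra.ι k ∘ₗ redTot Γ = redGen Γ from LinearMap.congr_fun h z
  refine tot_ext fun i b a x => ?_
  rw [LinearMap.comp_apply, redTot, totLift_incl, redGen, totLift_incl]
  rfl

/-- The suspension as a map of total modules. -/
def ofTot {k : Type u} [CommRing k] {X : Type} (Γ : DGGraph k X) :
    Tot (cobarGraph Γ) →ₗ[k] Tot Γ :=
  totLift fun j b a => incl Γ (j + 1) b a ∘ₗ ofCobar Γ b a j

theorem ofTot_redTot {k : Type u} [CommRing k] {X : Type} (Γ : DGGraph k X) {b a : X}
    (hab : b ≠ a) (i : ℤ) (x : (Γ b a).X i) :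
    ofTot Γ (redTot Γ (incl Γ i b a x)) = incl Γ i b a x := by
  obtain ⟨j, rfl⟩ : ∃ j, i = j + 1 := ⟨i - 1, by lia⟩
  have h : redTot Γ (incl Γ (j + 1) b a x) = incl (cobarGraph Γ) j b a (toCobar Γ b a rfl x) := by
    rw [redTot, totLift_incl, LinearMap.comp_apply]
    have : ∀ (l : ℤ) (hl : j + 1 = l + 1), incl (cobarGraph Γ) l b a (toCobar Γ b a hl x) =
        incl (cobarGraph Γ) j b a (toCobar Γ b a rfl x) := by
      intro l hl
      obtain rfl : j = l := by lia
      rfl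
    exact this _ _
  rw [h, ofTot, totLift_incl, LinearMap.comp_apply, ofCobar_toCobar Γ hab]

variable (k : Type u) [CommRing k] {n : ℕ}

/-- The tensor algebra which contains the hom modules of the cobar construction. -/
abbrev CobarAlg (n : ℕ) : Type u := TensorAlg (cobarGraph (koszulGraph k n))

variable (n) in
/-- The total differential of the cobar construction. -/
def cobarD : CobarAlg k n →ₗ[k] CobarAlg k n := der (cobarMap (koszul k n))

/-- The hom modules of the cobar construction. -/
abbrev cobarHom (d : ℤ) (τ σ : PTree n) : Submodule k (CobarAlg k n) :=
  freeHom (cobarGraph (koszulGraph k n)) d τ σ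

/-- The generators of the cobar construction, in the tensor algebra. -/
def cobarGen {τ σ : PTree n} (v : τ ⟶ σ) : CobarAlg k n :=
  redGen (koszulGraph k n) (koszulGen k v)

variable {τ θ σ : PTree n}

/-- The generators of the Koszul construction in the homogeneous components. -/
def koszulElt (v : τ ⟶ σ) : (koszulGraph k n τ σ).X ((τ.deg : ℤ) - σ.deg) :=
  (Finsupp.single ⟨v, rfl⟩ 1 : {_u : τ ⟶ σ // (τ.deg : ℤ) - σ.deg = τ.deg - σ.deg} →₀ k)

theorem koszulGen_eq (v : τ ⟶ σ) :
    koszulGen k v = incl (koszulGraph k n) _ τ σ (koszulElt k v) := rfl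

theorem cobarGen_mem (v : τ ⟶ σ) {d : ℤ} (hd : (τ.deg : ℤ) - σ.deg = d + 1) :
    cobarGen k v ∈ cobarHom k d τ σ := redGen_mem _ hd.symm _

theorem cobarGen_self (v : σ ⟶ σ) : cobarGen k v = 0 := redGen_self _ _

variable (n) in
theorem internalD_koszul : internalD (cobarGraph (koszulGraph k n)) = 0 := by
  refine tot_ext fun i b a x => ?_
  rw [internalD_incl]
  have h : ((cobarGraph (koszulGraph k n) b a).d i (i - 1)).hom x = 0 := by
    have h0 : (cobarGraph (koszulGraph k n) b a).d i (i - 1) = 0 := by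
      change - ((reduced (koszulGraph k n)) b a).d (i + 1) (i - 1 + 1) = 0
      rw [neg_eq_zero]
      ext x
      rfl
    rw [h0]; rfl
  rw [h, map_zero, LinearMap.zero_apply]

theorem cobarD_gen (v : τ ⟶ σ) : cobarD k n (cobarGen k v) =
    ∑ f : Fact v, eps ((f.mid.deg : ℤ) - σ.deg) • (cobarGen k f.v * cobarGen k f.w) := by
  have h := der_redGen (koszul_isConnected k n) (koszulGen k v)
  rw [internalD_koszul, zero_add, totD_koszul, map_zero, neg_zero, zero_add] at h
  refine h.trans ?_
  have h1 : (koszulCoalgebra k n).comul (koszulGen k v) =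
      ∑ f : Fact v, koszulGen k f.v ⊗ₜ[k] koszulGen k f.w := koszulLift_gen _ v
  change cobarQuad (koszulGraph k n) ((koszulCoalgebra k n).comul (koszulGen k v)) = _
  rw [h1, map_sum]
  refine Finset.sum_congr rfl fun f _ => ?_
  rw [cobarQuad_tmul, koszulGen_eq, totSign_incl, map_zsmul, smul_mul_assoc]
  rfl

theorem signAlg_cobarGen (v : τ ⟶ σ) :
    signAlg _ (cobarGen k v) = - (eps ((τ.deg : ℤ) - σ.deg) • cobarGen k v) := by
  rw [signAlg_freeHom (cobarGen_mem k v (d := (τ.deg : ℤ) - σ.deg - 1) (by lia)), eps_sub_one,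
    neg_smul]

theorem cobarD_gen_mul (v : τ ⟶ σ) (t : CobarAlg k n) : cobarD k n (cobarGen k v * t) =
    ∑ f : Fact v, eps ((f.mid.deg : ℤ) - σ.deg) • (cobarGen k f.v * (cobarGen k f.w * t)) -
      eps ((τ.deg : ℤ) - σ.deg) • (cobarGen k v * cobarD k n t) := by
  have h : cobarD k n (cobarGen k v * t) = cobarD k n (cobarGen k v) * t +
    signAlg _ (cobarGen k v) * cobarD k n t := der_mul _ _ _
  rw [h, cobarD_gen, signAlg_cobarGen, Finset.sum_mul, neg_mul, smul_mul_assoc, ← sub_eq_add_neg]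
  congr 1
  exact Finset.sum_congr rfl fun f _ => by rw [smul_mul_assoc, mul_assoc]

theorem cobarD_mem {d : ℤ} {t : CobarAlg k n} (ht : t ∈ cobarHom k d τ σ) :
    cobarD k n t ∈ cobarHom k (d - 1) τ σ := der_mem (cobarMap_deg (koszul k n)) ht

variable (n) in
theorem cobarD_one : cobarD k n 1 = 0 := der_one _

theorem gen_mem_span (d : ℤ) (γ : (cobarGraph (koszulGraph k n) τ σ).X d) :
    gen (cobarGraph (koszulGraph k n)) d τ σ γ ∈
      Submodule.span k {t | ∃ v : τ ⟶ σ, τ ≠ σ ∧ (τ.deg : ℤ) - σ.deg = d + 1 ∧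
        t = cobarGen k v} := by
  by_cases h : τ = σ
  · subst h
    rw [← toCobar_ofCobar _ γ, toCobar_self, map_zero]
    exact zero_mem _
  rw [← toCobar_ofCobar _ γ, ← redGen_incl _ rfl]
  let L : ({_u : τ ⟶ σ // (τ.deg : ℤ) - σ.deg = d + 1} →₀ k) →ₗ[k] CobarAlg k n :=
    redGen (koszulGraph k n) ∘ₗ incl (koszulGraph k n) (d + 1) τ σ
  suffices hL : ∀ x, L x ∈ Submodule.span k {t | ∃ v : τ ⟶ σ, τ ≠ σ ∧
      (τ.deg : ℤ) - σ.deg = d + 1 ∧ t = cobarGen k v} from hL _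
  intro x
  induction x using Finsupp.induction_linear with
  | zero => rw [map_zero]; exact zero_mem _
  | add x y hx hy => rw [map_add]; exact add_mem hx hy
  | single v c =>
    obtain ⟨v, hv⟩ := v
    have e : ∀ (i : ℤ) (hi : (τ.deg : ℤ) - σ.deg = i),
        (redGen (koszulGraph k n) ∘ₗ incl (koszulGraph k n) i τ σ :
          ({_u : τ ⟶ σ // (τ.deg : ℤ) - σ.deg = i} →₀ k) →ₗ[k] CobarAlg k n)
          (Finsupp.single ⟨v, hi⟩ 1) = cobarGen k v := by
      rintro i rfl
      rfl
    rw [← mul_one c, ← smul_eq_mul, ← Finsupp.smul_single, map_smul, e]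
    exact Submodule.smul_mem _ _ (Submodule.subset_span ⟨v, h, hv, rfl⟩)

/-- Induction on the elements of the cobar construction. -/
theorem cobarHom_induction {P : ℤ → PTree n → CobarAlg k n → Prop}
    (zero : ∀ d σ, P d σ 0) (add : ∀ d σ s t, P d σ s → P d σ t → P d σ (s + t))
    (smul : ∀ d σ (c : k) t, P d σ t → P d σ (c • t)) (one : P 0 τ 1)
    (mul : ∀ {θ σ : PTree n} (v : θ ⟶ σ) (i d : ℤ) (s : CobarAlg k n), θ ≠ σ → Nonempty (τ ⟶ θ) →
      s ∈ cobarHom k i τ θ → (θ.deg : ℤ) - σ.deg + i = d + 1 → P i θ s → P d σ (cobarGen k v * s))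
    {d : ℤ} {t : CobarAlg k n} (ht : t ∈ cobarHom k d τ σ) : P d σ t := by
  -- The existence of a morphism is carried along because it confines the sources of first letters
  -- to the finitely many trees under `τ`, which keeps the sums over generators finite.
  suffices h : P d σ t ∧ (t ≠ 0 → Nonempty (τ ⟶ σ)) from h.1
  induction ht using Submodule.span_induction with
  | zero => exact ⟨zero _ _, fun h => absurd rfl h⟩
  | add s t _ _ hs ht =>
    refine ⟨add _ _ _ _ hs.1 ht.1, fun h => ?_⟩
    by_cases h1 : s = 0
    · exact ht.2 fun h2 => h (by rw [h1, h2, add_zero])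
    · exact hs.2 h1
  | smul c t _ ht => exact ⟨smul _ _ _ _ ht.1, fun h => ht.2 fun h1 => h (by rw [h1, smul_zero])⟩
  | mem w hw =>
    obtain ⟨m, hw⟩ := hw
    induction hw with
    | nil x => exact ⟨one, fun _ => ⟨𝟙 _⟩⟩
    | @cons m i j d b x a h γ w hw ih =>
      obtain ⟨ih1, ih2⟩ := ih one mul
      have hγ := gen_mem_span k i γ
      generalize gen (cobarGraph (koszulGraph k n)) i x a γ = g at hγ ⊢
      by_cases hw0 : w = 0
      · rw [hw0, mul_zero]
        exact ⟨zero _ _, fun h => absurd rfl h⟩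
      induction hγ using Submodule.span_induction with
      | mem g hg =>
        obtain ⟨v, hne, hd, rfl⟩ := hg
        exact ⟨mul v j d w hne (ih2 hw0) hw.mem (by lia) ih1, fun _ => ⟨(ih2 hw0).some ≫ v⟩⟩
      | zero => rw [zero_mul]; exact ⟨zero _ _, fun h => absurd rfl h⟩
      | add s t _ _ hs ht =>
        rw [add_mul]
        refine ⟨add _ _ _ _ hs.1 ht.1, fun h => ?_⟩
        by_cases h1 : s * w = 0
        · exact ht.2 fun h2 => h (by rw [h1, h2, add_zero])
        · exact hs.2 h1
      | smul c t _ ht =>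
        rw [smul_mul_assoc]
        exact ⟨smul _ _ _ _ ht.1, fun h => ht.2 fun h1 => h (by rw [h1, smul_zero])⟩

/-- A morphism between different trees has degree at least `1`, so its desuspension has degree at
least `0`. -/
theorem cobarHom_neg {d : ℤ} (hd : d < 0) {t : CobarAlg k n} (ht : t ∈ cobarHom k d τ σ) :
    t = 0 := by
  refine cobarHom_induction k (τ := τ) (P := fun d _ t => d < 0 → t = 0) ?_ ?_ ?_ ?_ ?_ ht hd
  · exact fun _ _ _ => rfl
  · intro d σ s t hs ht hd
    rw [hs hd, ht hd, add_zero]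
  · intro d σ c t ht hd
    rw [ht hd, smul_zero]
  · exact fun h => absurd h (lt_irrefl _)
  · intro θ σ v i d s hne _ _ hd ih h
    have h1 := deg_le v
    have h2 : θ.deg ≠ σ.deg := fun h2 => hne (eq_of_deg_le v h2.le)
    rw [ih (by lia), mul_zero]

theorem cobarHom_self {d : ℤ} {t : CobarAlg k n} (ht : t ∈ cobarHom k d τ τ) :
    ∃ c : k, t = c • 1 := by
  refine cobarHom_induction k (τ := τ) (P := fun _ σ t => σ = τ → ∃ c : k, t = c • 1)
    ?_ ?_ ?_ ?_ ?_ ht rfl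
  · exact fun _ _ _ => ⟨0, (zero_smul _ _).symm⟩
  · intro d σ s t hs ht h
    obtain ⟨c, rfl⟩ := hs h
    obtain ⟨c', rfl⟩ := ht h
    exact ⟨c + c', (add_smul _ _ _).symm⟩
  · intro d σ c t ht h
    obtain ⟨c', rfl⟩ := ht h
    exact ⟨c * c', smul_smul _ _ _⟩
  · exact fun _ => ⟨1, (one_smul _ _).symm⟩
  · rintro θ σ v i d s hne ⟨w⟩ _ _ _ rfl
    exact absurd (eq_of_deg_le v (deg_le w)) hne

/-! ### Coordinates -/

open Classical in
/-- The coordinate of the elements of the cobar construction on a generator on the target side. -/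
def coord (v : τ ⟶ σ) : CobarAlg k n →ₗ[k] CobarAlg k n :=
  leftCoord (koszulLift (fun {τ' σ'} v' =>
    if (⟨τ', σ', v'⟩ : Σ τ σ : PTree n, τ ⟶ σ) = ⟨τ, σ, v⟩ then (1 : k) else 0) ∘ₗ
      ofTot (koszulGraph k n))

theorem coord_one (v : τ ⟶ σ) : coord k v 1 = 0 := leftCoord_one _

open Classical in
theorem coord_gen_mul {τ' σ' : PTree n} (v : τ ⟶ σ) (v' : τ' ⟶ σ') (h : τ' ≠ σ')
    (t : CobarAlg k n) : coord k v (cobarGen k v' * t) =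
      if (⟨τ', σ', v'⟩ : Σ τ σ : PTree n, τ ⟶ σ) = ⟨τ, σ, v⟩ then t else 0 := by
  rw [cobarGen, ← ι_redTot, coord, leftCoord_ι_mul, LinearMap.comp_apply, koszulGen_eq,
    ofTot_redTot _ h]
  have h1 := koszulLift_gen (k := k) (fun {τ' σ'} v' =>
    if (⟨τ', σ', v'⟩ : Σ τ σ : PTree n, τ ⟶ σ) = ⟨τ, σ, v⟩ then (1 : k) else 0) v'
  rw [koszulGen_eq] at h1
  rw [h1, ite_smul, one_smul, zero_smul]

theorem coord_gen_mul_self (v : τ ⟶ σ) (h : τ ≠ σ) (t : CobarAlg k n) :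
    coord k v (cobarGen k v * t) = t := by
  rw [coord_gen_mul k v v h, if_pos rfl]

theorem coord_gen_mul_of_ne {τ' σ' : PTree n} (v : τ ⟶ σ) (v' : τ' ⟶ σ')
    (h : (⟨τ', σ', v'⟩ : Σ τ σ : PTree n, τ ⟶ σ) ≠ ⟨τ, σ, v⟩)
    (t : CobarAlg k n) : coord k v (cobarGen k v' * t) = 0 := by
  by_cases h1 : τ' = σ'
  · subst h1
    rw [cobarGen_self, zero_mul, map_zero]
  · rw [coord_gen_mul k v v' h1, if_neg h]

theorem coord_mem (v : θ ⟶ σ) {d e : ℤ} (he : (θ.deg : ℤ) - σ.deg + e = d + 1)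
    {t : CobarAlg k n} (ht : t ∈ cobarHom k d τ σ) : coord k v t ∈ cobarHom k e τ θ := by
  refine cobarHom_induction k (τ := τ) (P := fun d' σ' t => d = d' →
    coord k v t ∈ cobarHom k e τ θ) ?_ ?_ ?_ ?_ ?_ ht rfl
  · intro d σ _
    rw [map_zero]; exact zero_mem _
  · intro d σ s t hs ht h
    rw [map_add]; exact add_mem (hs h) (ht h)
  · intro d σ c t ht h
    rw [map_smul]; exact Submodule.smul_mem _ _ (ht h)
  · intro _
    rw [coord_one]; exact zero_mem _
  · intro θ' σ' v' i d' s hne _ hs hd _ h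
    by_cases h1 : (⟨θ', σ', v'⟩ : Σ τ σ : PTree n, τ ⟶ σ) = ⟨θ, σ, v⟩
    · cases h1
      rw [coord_gen_mul_self k _ hne]
      obtain rfl : e = i := by lia
      exact hs
    · rw [coord_gen_mul_of_ne k _ _ h1]; exact zero_mem _

/-- The morphisms with a given target whose source receives a morphism from a given tree. -/
abbrev Out (τ σ : PTree n) : Type := Σ θ : {θ : PTree n // Nonempty (τ ⟶ θ)}, (θ.1 ⟶ σ)

instance (τ σ : PTree n) : Fintype (Out τ σ) := Fintype.ofFinite _

/-- The sum of the products of the generators with a family of elements. -/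
def genSum (τ : PTree n) {σ : PTree n} (s : ∀ θ : PTree n, (θ ⟶ σ) → CobarAlg k n) :
    CobarAlg k n :=
  ∑ p : Out τ σ, cobarGen k p.2 * s p.1.1 p.2

theorem genSum_mem {d : ℤ} {s : ∀ θ : PTree n, (θ ⟶ σ) → CobarAlg k n}
    (hs : ∀ θ (v : θ ⟶ σ) (e : ℤ), θ ≠ σ → (θ.deg : ℤ) - σ.deg + e = d + 1 →
      s θ v ∈ cobarHom k e τ θ) :
    genSum k τ s ∈ cobarHom k d τ σ := by
  refine Submodule.sum_mem _ fun p _ => ?_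
  obtain ⟨⟨θ, hθ⟩, v⟩ := p
  dsimp only
  by_cases h : θ = σ
  · subst h
    rw [cobarGen_self, zero_mul]; exact zero_mem _
  · exact freeHom_mul (i := (θ.deg : ℤ) - σ.deg - 1) (j := d + 1 - ((θ.deg : ℤ) - σ.deg)) (by lia)
      (cobarGen_mem k v (by lia)) (hs θ v _ h (by lia))

theorem coord_genSum (s : ∀ θ : PTree n, (θ ⟶ σ) → CobarAlg k n) (v : θ ⟶ σ) (hne : θ ≠ σ)
    (hθ : Nonempty (τ ⟶ θ)) : coord k v (genSum k τ s) = s θ v := by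
  rw [genSum, map_sum, Fintype.sum_eq_single (⟨⟨θ, hθ⟩, v⟩ : Out τ σ)]
  · exact coord_gen_mul_self k v hne _
  · rintro ⟨⟨θ', hθ'⟩, v'⟩ h
    refine coord_gen_mul_of_ne k _ _ (fun h1 => h ?_) _
    cases h1
    rfl

/-- Freeness in usable form: with `coord_genSum`, an element between different trees amounts to its
family of coordinates on the leading generators. -/
theorem genSum_coord {d : ℤ} (hne : τ ≠ σ) {t : CobarAlg k n} (ht : t ∈ cobarHom k d τ σ) :
    genSum k τ (fun _ (v : _ ⟶ σ) => coord k v t) = t := by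
  refine cobarHom_induction k (τ := τ) (P := fun _ σ t => τ ≠ σ →
    genSum k τ (fun _ (v : _ ⟶ σ) => coord k v t) = t) ?_ ?_ ?_ ?_ ?_ ht hne
  · intro d σ _
    simp [genSum]
  · intro d σ s t hs ht h
    conv_rhs => rw [← hs h, ← ht h]
    simp only [genSum, map_add, mul_add, Finset.sum_add_distrib]
  · intro d σ c t ht h
    conv_rhs => rw [← ht h]
    simp only [genSum, map_smul, mul_smul_comm, Finset.smul_sum]
  · exact fun h => absurd rfl h
  · intro θ σ v i d s hne hθ _ _ _ _
    rw [genSum, Fintype.sum_eq_single (⟨⟨θ, hθ⟩, v⟩ : Out τ σ)]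
    · dsimp only
      rw [coord_gen_mul_self k v hne]
    · rintro ⟨⟨θ', hθ'⟩, v'⟩ h
      dsimp only
      rw [coord_gen_mul_of_ne k, mul_zero]
      intro h1
      cases h1
      exact h rfl

/-- The coordinates of the differential. -/
theorem coord_cobarD {d : ℤ} {t : CobarAlg k n} (ht : t ∈ cobarHom k d τ σ) (v : θ ⟶ σ)
    (hne : θ ≠ σ) : coord k v (cobarD k n t) = eps ((θ.deg : ℤ) - σ.deg) •
      (genSum k τ (fun _ x => coord k (x ≫ v) t) - cobarD k n (coord k v t)) := by
  refine cobarHom_induction k (τ := τ) (P := fun _ σ t => ∀ v : θ ⟶ σ, θ ≠ σ →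
    coord k v (cobarD k n t) = eps ((θ.deg : ℤ) - σ.deg) •
      (genSum k τ (fun _ x => coord k (x ≫ v) t) - cobarD k n (coord k v t)))
    ?_ ?_ ?_ ?_ ?_ ht v hne
  · intro d σ v _
    simp [genSum]
  · intro d σ s t hs ht v hne
    rw [map_add, map_add, hs v hne, ht v hne]
    simp only [genSum, map_add, mul_add, Finset.sum_add_distrib, ← smul_add]
    congr 1
    abel
  · intro d σ c t ht v hne
    rw [map_smul, map_smul, ht v hne]
    simp only [genSum, map_smul, mul_smul_comm, ← Finset.smul_sum, ← smul_sub]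
    rw [smul_comm]
  · intro v _
    simp [genSum, cobarD_one, coord_one]
  · clear hne ht v
    intro θ' σ v' i d s hne' hθ' hs _ _ v hne
    rw [cobarD_gen_mul, map_sub, map_sum, map_zsmul]
    -- Only factorizations of `v'` with second factor `v` have a nonzero coordinate, and for those
    -- the sign is that of `v`.
    have h1 : ∀ f : Fact v', coord k v (eps ((f.mid.deg : ℤ) - σ.deg) •
        (cobarGen k f.v * (cobarGen k f.w * s))) = eps ((θ.deg : ℤ) - σ.deg) •
          coord k v (cobarGen k f.v * (cobarGen k f.w * s)) := by
      intro f
      rw [map_zsmul]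
      by_cases h : (⟨f.mid, σ, f.v⟩ : Σ τ σ : PTree n, τ ⟶ σ) = ⟨θ, σ, v⟩
      · have h2 : f.mid.deg = θ.deg := congrArg (fun p => p.1.deg) h
        rw [h2]
      · rw [coord_gen_mul_of_ne k v f.v h, smul_zero, smul_zero]
    have h2 : eps ((θ'.deg : ℤ) - σ.deg) • coord k v (cobarGen k v' * cobarD k n s) =
        eps ((θ.deg : ℤ) - σ.deg) • cobarD k n (coord k v (cobarGen k v' * s)) := by
      by_cases h : (⟨θ', σ, v'⟩ : Σ τ σ : PTree n, τ ⟶ σ) = ⟨θ, σ, v⟩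
      · cases h
        rw [coord_gen_mul_self k _ hne, coord_gen_mul_self k _ hne]
      · rw [coord_gen_mul_of_ne k _ _ h, coord_gen_mul_of_ne k _ _ h, map_zero, smul_zero,
          smul_zero]
    rw [Finset.sum_congr rfl fun f _ => h1 f, h2, ← Finset.smul_sum, ← smul_sub]
    congr 2

    -- Both remaining sums run over the solutions of `x ≫ v = v'`: on one side as factorizations of
    -- `v'`, on the other as morphisms to `θ` whose composite with `v` is the leading generator.
    let F : {x : θ' ⟶ θ // x ≫ v = v'} → Fact v' := fun x => ⟨θ, x.1, v, x.2⟩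
    have : Fintype {x : θ' ⟶ θ // x ≫ v = v'} := Fintype.ofFinite _
    let G : {x : θ' ⟶ θ // x ≫ v = v'} → Out τ θ := fun x => ⟨⟨θ', hθ'⟩, x.1⟩
    have hF : Function.Injective F := by
      rintro ⟨x, hx⟩ ⟨y, hy⟩ h
      simp only [F] at h
      injection h with _ h3 _
      exact Subtype.ext h3
    have hG : Function.Injective G := by
      rintro ⟨x, hx⟩ ⟨y, hy⟩ h
      cases h
      rfl
    have e1 : ∑ f : Fact v', coord k v (cobarGen k f.v * (cobarGen k f.w * s)) =
        ∑ x : {x : θ' ⟶ θ // x ≫ v = v'}, cobarGen k x.1 * s := by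
      refine (Fintype.sum_of_injective F hF _ _ ?_ ?_).symm
      · rintro ⟨ψ, w, x, hx⟩ hf
        refine coord_gen_mul_of_ne k _ _ (fun h => hf ?_) _
        cases h
        exact ⟨⟨w, hx⟩, rfl⟩
      · intro x
        exact (coord_gen_mul_self k v hne _).symm
    have e2 : genSum k τ (fun _ x => coord k (x ≫ v) (cobarGen k v' * s)) =
        ∑ x : {x : θ' ⟶ θ // x ≫ v = v'}, cobarGen k x.1 * s := by
      refine (Fintype.sum_of_injective G hG _ _ ?_ ?_).symm
      · rintro ⟨⟨ψ, hψ⟩, x⟩ hf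
        dsimp only
        rw [coord_gen_mul_of_ne k, mul_zero]
        intro h
        apply hf
        cases h
        exact ⟨⟨x, rfl⟩, rfl⟩
      · rintro ⟨x, hx⟩
        subst hx
        dsimp only [G]
        rw [coord_gen_mul_self k _ hne']
    rw [e1, e2]

end CobarGen

end

noncomputable section

open PTree

/-! ## The augmentation of the cobar construction -/

section Aug

variable (k : Type u) [CommRing k] {n : ℕ} {τ θ σ : PTree n}

/-- The free module on the morphisms with source `τ`. -/
abbrev Under (τ : PTree n) : Type u := (Σ σ : PTree n, τ ⟶ σ) →₀ k

open Classical in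
/-- Composition with a morphism on the target side. -/
def post (τ : PTree n) (v : θ ⟶ σ) : Under k τ →ₗ[k] Under k τ :=
  Finsupp.linearCombination k fun p =>
    if h : p.1 = θ then Finsupp.single ⟨σ, p.2 ≫ eqToHom h ≫ v⟩ 1 else 0

theorem post_single (w : τ ⟶ θ) (v : θ ⟶ σ) (c : k) :
    post k τ v (Finsupp.single ⟨θ, w⟩ c) = Finsupp.single ⟨σ, w ≫ v⟩ c := by
  simp [post]

theorem post_single_of_ne {ψ : PTree n} (h : ψ ≠ θ) (w : τ ⟶ ψ) (v : θ ⟶ σ) (c : k) :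
    post k τ v (Finsupp.single ⟨ψ, w⟩ c) = 0 := by
  simp [post, h]

theorem post_post {ψ : PTree n} (v : θ ⟶ ψ) (v' : ψ ⟶ σ) (c : Under k τ) :
    post k τ v' (post k τ v c) = post k τ (v ≫ v') c := by
  induction c using Finsupp.induction_linear with
  | zero => simp
  | add c c' h h' => simp only [map_add, h, h']
  | single p c =>
    obtain ⟨θ', w⟩ := p
    by_cases h : θ' = θ
    · subst h
      rw [post_single, post_single, post_single, Category.assoc]
    · rw [post_single_of_ne k h, post_single_of_ne k h, map_zero]

instance (v : θ ⟶ σ) (u : τ ⟶ σ) : Fintype {w : τ ⟶ θ // w ≫ v = u} := Fintype.ofFinite _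

theorem post_apply (v : θ ⟶ σ) (u : τ ⟶ σ) (c : Under k τ) :
    post k τ v c ⟨σ, u⟩ = ∑ w : {w : τ ⟶ θ // w ≫ v = u}, c ⟨θ, w.1⟩ := by
  classical
  induction c using Finsupp.induction_linear with
  | zero => simp
  | add c c' h h' => simp only [map_add, Finsupp.add_apply, h, h', Finset.sum_add_distrib]
  | single p c =>
    obtain ⟨θ', w⟩ := p
    by_cases h : θ' = θ
    · subst h
      rw [post_single, Finsupp.single_apply]
      by_cases hw : w ≫ v = u
      · rw [if_pos (by rw [hw]), Fintype.sum_eq_single ⟨w, hw⟩, Finsupp.single_eq_same]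
        rintro ⟨w', hw'⟩ hne
        refine Finsupp.single_eq_of_ne fun h => hne ?_
        cases h
        rfl
      · rw [if_neg fun h => hw (by cases h; rfl)]
        refine (Finset.sum_eq_zero fun w' _ => Finsupp.single_eq_of_ne fun h => hw ?_).symm
        have h1 := w'.2
        cases h
        exact h1
    · rw [post_single_of_ne k h, Finsupp.zero_apply]
      exact (Finset.sum_eq_zero fun w' _ => Finsupp.single_eq_of_ne fun h' =>
        h (congrArg Sigma.fst h').symm).symm

theorem post_apply_of_ne {ψ : PTree n} (h : ψ ≠ σ) (v : θ ⟶ σ) (u : τ ⟶ ψ) (c : Under k τ) :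
    post k τ v c ⟨ψ, u⟩ = 0 := by
  induction c using Finsupp.induction_linear with
  | zero => simp
  | add c c' h h' => simp only [map_add, Finsupp.add_apply, h, h', add_zero]
  | single p c =>
    obtain ⟨θ', w⟩ := p
    by_cases h' : θ' = θ
    · subst h'
      rw [post_single, Finsupp.single_eq_of_ne fun h1 => h (congrArg Sigma.fst h1)]
    · rw [post_single_of_ne k h', Finsupp.zero_apply]

/-- The action of the cobar construction on the morphisms with source `τ`. -/
def augRep (τ : PTree n) : CobarAlg k n →ₐ[k] Module.End k (Under k τ) :=
  TensorAlgebra.lift k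
    (koszulLift (fun v => (sgn' k v • post k τ v : Module.End k (Under k τ))) ∘ₗ
      ofTot (koszulGraph k n))

theorem sgn'_self (v : σ ⟶ σ) : sgn' k v = 0 := if_neg (by omega)

theorem augRep_gen (v : θ ⟶ σ) : augRep k τ (cobarGen k v) = sgn' k v • post k τ v := by
  by_cases h : θ = σ
  · subst h
    rw [cobarGen_self, map_zero, sgn'_self, zero_smul]
  · rw [cobarGen, ← ι_redTot, augRep, TensorAlgebra.lift_ι_apply, LinearMap.comp_apply,
      koszulGen_eq, ofTot_redTot _ h, ← koszulGen_eq]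
    exact koszulLift_gen _ v

/-- The augmentation, with values in the free module on the morphisms with source `τ`. -/
def aug (τ : PTree n) : CobarAlg k n →ₗ[k] Under k τ :=
  LinearMap.applyₗ (Finsupp.single ⟨τ, 𝟙 τ⟩ 1 : Under k τ) ∘ₗ (augRep k τ).toLinearMap

theorem aug_apply (t : CobarAlg k n) : aug k τ t = augRep k τ t (Finsupp.single ⟨τ, 𝟙 τ⟩ 1) := rfl

theorem aug_one : aug k τ 1 = Finsupp.single ⟨τ, 𝟙 τ⟩ 1 := by
  rw [aug_apply, map_one]; rfl

theorem aug_mul (s t : CobarAlg k n) : aug k τ (s * t) = augRep k τ s (aug k τ t) := by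
  rw [aug_apply, map_mul]; rfl

theorem aug_gen_mul (v : θ ⟶ σ) (t : CobarAlg k n) :
    aug k τ (cobarGen k v * t) = sgn' k v • post k τ v (aug k τ t) := by
  rw [aug_mul, augRep_gen]; rfl

/-- In `∂{v}` only products of two generators of degree `0` act nontrivially. They carry the common
sign `-1` from the cobar differential and all act as composition with `v`, so `sum_sgn'_mul_sgn'`
cancels them. -/
theorem aug_cobarD {d : ℤ} {t : CobarAlg k n} (ht : t ∈ cobarHom k d τ σ) :
    aug k τ (cobarD k n t) = 0 := by
  refine cobarHom_induction k (τ := τ) (P := fun _ _ t => aug k τ (cobarD k n t) = 0)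
    ?_ ?_ ?_ ?_ ?_ ht
  · intro d σ
    rw [map_zero, map_zero]
  · intro d σ s t hs ht
    rw [map_add, map_add, hs, ht, add_zero]
  · intro d σ c t ht
    rw [map_smul, map_smul, ht, smul_zero]
  · rw [cobarD_one, map_zero]
  · intro θ σ v i d s _ _ _ _ hs
    rw [cobarD_gen_mul, map_sub, map_zsmul, aug_gen_mul, hs, map_zero, smul_zero, smul_zero,
      sub_zero, map_sum]
    have h : ∀ f : Fact v, aug k τ (eps ((f.mid.deg : ℤ) - σ.deg) •
        (cobarGen k f.v * (cobarGen k f.w * s))) =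
          (sgn' k f.w * sgn' k f.v) • - post k τ v (aug k τ s) := by
      intro f
      rw [map_zsmul, aug_gen_mul, aug_gen_mul, map_smul, post_post, f.comp_eq]
      by_cases h : f.mid.deg = σ.deg + 1
      · have h1 : eps ((f.mid.deg : ℤ) - σ.deg) = -1 := by
          rw [show (f.mid.deg : ℤ) - σ.deg = 1 by lia]
          simp [eps]
        rw [h1, neg_one_zsmul, smul_neg, smul_smul, mul_comm]
      · rw [show sgn' k f.v = 0 from if_neg h, zero_smul, smul_zero, mul_zero, zero_smul]
    rw [Finset.sum_congr rfl fun f _ => h f, ← Finset.sum_smul, sum_sgn'_mul_sgn', zero_smul]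

theorem aug_eq_zero {d : ℤ} (hd : d ≠ 0) {t : CobarAlg k n} (ht : t ∈ cobarHom k d τ σ) :
    aug k τ t = 0 := by
  refine cobarHom_induction k (τ := τ) (P := fun d _ t => d ≠ 0 → aug k τ t = 0)
    ?_ ?_ ?_ ?_ ?_ ht hd
  · intro d σ _
    rw [map_zero]
  · intro d σ s t hs ht h
    rw [map_add, hs h, ht h, add_zero]
  · intro d σ c t ht h
    rw [map_smul, ht h, smul_zero]
  · exact fun h => absurd rfl h
  · intro θ σ v i d s _ _ _ hd hs h
    rw [aug_gen_mul]
    by_cases h1 : θ.deg = σ.deg + 1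
    · rw [hs (by lia), map_zero, smul_zero]
    · rw [show sgn' k v = 0 from if_neg h1, zero_smul]

theorem aug_apply_of_ne {d : ℤ} {t : CobarAlg k n} (ht : t ∈ cobarHom k d τ σ)
    (hne : θ ≠ σ) (u : τ ⟶ θ) : aug k τ t ⟨θ, u⟩ = 0 := by
  refine cobarHom_induction k (τ := τ) (P := fun _ σ t => θ ≠ σ → aug k τ t ⟨θ, u⟩ = 0)
    ?_ ?_ ?_ ?_ ?_ ht hne
  · intro d σ _
    rw [map_zero, Finsupp.zero_apply]
  · intro d σ s t hs ht h
    rw [map_add, Finsupp.add_apply, hs h, ht h, add_zero]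
  · intro d σ c t ht h
    rw [map_smul, Finsupp.smul_apply, ht h, smul_zero]
  · intro h
    rw [aug_one, Finsupp.single_eq_of_ne fun h1 => h (congrArg Sigma.fst h1)]
  · intro θ' σ v i d s _ _ _ _ _ h
    rw [aug_gen_mul, Finsupp.smul_apply, post_apply_of_ne k h, smul_zero]

/-- The factorizations of a morphism as pairs. -/
def outEquivFact (u : τ ⟶ σ) :
    (Σ p : Out τ σ, {w : τ ⟶ p.1.1 // w ≫ p.2 = u}) ≃ Fact u where
  toFun q := ⟨q.1.1.1, q.2.1, q.1.2, q.2.2⟩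
  invFun f := ⟨⟨⟨f.mid, ⟨f.w⟩⟩, f.v⟩, ⟨f.w, f.comp_eq⟩⟩
  left_inv _ := rfl
  right_inv _ := rfl

/-- The formula has the shape of `koszulDiff`: this is how the Koszul complex arises from the
leading coordinates of the cobar construction. -/
theorem aug_genSum (s : ∀ θ : PTree n, (θ ⟶ σ) → CobarAlg k n) (u : τ ⟶ σ) :
    aug k τ (genSum k τ s) ⟨σ, u⟩ =
      ∑ g : Fact u, sgn' k g.v * aug k τ (s g.mid g.v) ⟨g.mid, g.w⟩ := by
  rw [← (outEquivFact u).sum_comp, Fintype.sum_sigma, genSum, map_sum, Finsupp.finsetSum_apply]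
  refine Finset.sum_congr rfl fun p _ => ?_
  rw [aug_gen_mul, Finsupp.smul_apply, post_apply, smul_eq_mul, Finset.mul_sum]
  rfl

theorem aug_genSum_eq_zero {s : ∀ θ : PTree n, (θ ⟶ σ) → CobarAlg k n}
    (hs : ∀ p : Out τ σ, aug k τ (s p.1.1 p.2) = 0) : aug k τ (genSum k τ s) = 0 := by
  rw [genSum, map_sum]
  exact Finset.sum_eq_zero fun p _ => by rw [aug_gen_mul, hs p, map_zero, smul_zero]

/-- The mate of the factorization through the target has one more vertex in its middle tree.
Iterating, every morphism is a composite of morphisms of degree one, whence the surjectivity of the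
augmentation. -/
theorem exists_fact_deg (u : τ ⟶ σ) (h : τ ≠ σ) : ∃ f : Fact u, f.mid.deg = σ.deg + 1 := by
  have hu' : ¬ Function.Injective (onNode u) := fun hi => by
    have := Nat.card_le_card_of_injective _ hi
    rw [card_node, card_node] at this
    exact h (eq_of_deg_le u (by omega))
  obtain ⟨M⟩ := exists_factMatching hu'
  let top : Fact u := ⟨σ, u, 𝟙 σ, Category.comp_id u⟩
  have ht : M.upper top := by
    by_contra ht
    have h1 := (M.covers_mate top ht).1
    have h2 := deg_le (M.mate top).v
    simp only [top] at h1 h2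
    omega
  have h1 := M.covers_mate (M.mate top) (by rw [M.upper_mate]; exact not_not.2 ht)
  rw [M.mate_mate] at h1
  exact ⟨M.mate top, h1.1⟩

theorem sgn'_mul_self {u : τ ⟶ σ} (h : τ.deg = σ.deg + 1) : sgn' k u * sgn' k u = 1 := by
  rw [sgn', if_pos h, sgn, Int.cast_pow, Int.cast_neg, Int.cast_one, ← mul_pow]
  simp

theorem exists_aug_eq_single (u : τ ⟶ σ) :
    ∃ s ∈ cobarHom k 0 τ σ, aug k τ s = Finsupp.single ⟨σ, u⟩ 1 := by
  induction hm : τ.deg - σ.deg using Nat.strong_induction_on generalizing σ with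
  | _ m ih =>
    by_cases h : τ = σ
    · subst h
      obtain rfl := end_eq_id u
      exact ⟨1, one_mem_freeHom τ, aug_one k⟩
    · obtain ⟨⟨θ, w, v, rfl⟩, hf⟩ := exists_fact_deg u h
      dsimp only at hf
      have h1 := deg_le w
      obtain ⟨s, hs, hs'⟩ := ih (τ.deg - θ.deg) (by omega) w rfl
      refine ⟨sgn' k v • (cobarGen k v * s), Submodule.smul_mem _ _
        (freeHom_mul (add_zero 0) (cobarGen_mem k v (by lia)) hs), ?_⟩
      rw [map_smul, aug_gen_mul, hs', post_single, smul_smul, sgn'_mul_self k hf, one_smul]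

theorem exists_aug_eq (c : (τ ⟶ σ) → k) :
    ∃ s ∈ cobarHom k 0 τ σ, ∀ u, aug k τ s ⟨σ, u⟩ = c u := by
  classical
  have : Fintype (τ ⟶ σ) := Fintype.ofFinite _
  choose s hs hs' using fun u : τ ⟶ σ => exists_aug_eq_single k u
  refine ⟨∑ u, c u • s u, Submodule.sum_mem _ fun u _ => Submodule.smul_mem _ _ (hs u),
    fun u => ?_⟩
  rw [map_sum, Finsupp.finsetSum_apply, Fintype.sum_eq_single u]
  · rw [map_smul, hs', Finsupp.smul_apply, Finsupp.single_eq_same, smul_eq_mul, mul_one]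
  · intro u' hu'
    rw [map_smul, hs', Finsupp.smul_apply, Finsupp.single_eq_of_ne, smul_zero]
    intro h
    exact hu' (by cases h; rfl)

end Aug

/-! ## Acyclicity -/

section Acyclic

variable (k : Type u) [CommRing k] {n : ℕ} {τ θ σ : PTree n}

theorem cobarD_cobarD {d : ℤ} {t : CobarAlg k n} (ht : t ∈ cobarHom k d τ σ) :
    cobarD k n (cobarD k n t) = 0 := by
  refine der_der (cobarMap_deg (koszul k n)) (fun i b a γ => ?_) ht
  have h := der_cobar (koszul_isConnected k n) i b a γ
  rwa [internalD_koszul, zero_add] at h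

theorem ne_of_comp {ψ : PTree n} (x : ψ ⟶ θ) (v : θ ⟶ σ) (h : θ ≠ σ) : ψ ≠ σ := by
  rintro rfl
  exact h (eq_of_deg_le v (deg_le x))

theorem deg_lt (v : θ ⟶ σ) (h : θ ≠ σ) : σ.deg < θ.deg := by
  by_contra h1
  exact h (eq_of_deg_le v (not_lt.1 h1))

theorem genSum_congr {s s' : ∀ θ : PTree n, (θ ⟶ σ) → CobarAlg k n}
    (h : ∀ θ (v : θ ⟶ σ), θ ≠ σ → Nonempty (τ ⟶ θ) → s θ v = s' θ v) :
    genSum k τ s = genSum k τ s' := by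
  refine Finset.sum_congr rfl ?_
  rintro ⟨⟨θ, hθ⟩, v⟩ _
  dsimp only
  by_cases h1 : θ = σ
  · subst h1
    rw [cobarGen_self, zero_mul, zero_mul]
  · rw [h θ v h1 hθ]

theorem genSum_eq_zero {s : ∀ θ : PTree n, (θ ⟶ σ) → CobarAlg k n}
    (h : ∀ θ (v : θ ⟶ σ), θ ≠ σ → Nonempty (τ ⟶ θ) → s θ v = 0) : genSum k τ s = 0 := by
  rw [genSum_congr k (s' := fun _ _ => 0) h]
  simp [genSum]

/-- The augmentation of the cobar construction is acyclic on the hom module from `τ` to `σ`. -/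
def Acyclic (τ σ : PTree n) : Prop :=
  ∀ (d : ℤ) (t : CobarAlg k n), t ∈ cobarHom k d τ σ → cobarD k n t = 0 → aug k τ t = 0 →
    ∃ s ∈ cobarHom k (d + 1) τ σ, cobarD k n s = t

variable {k}

/-- A primitive can have nonzero augmentation only in degree `0`; then `t` has degree `-1` and
vanishes, so `0` serves as primitive. -/
theorem Acyclic.exists_aug_eq_zero (h : Acyclic k τ σ) {d : ℤ} {t : CobarAlg k n}
    (ht : t ∈ cobarHom k d τ σ) (hD : cobarD k n t = 0) (ha : aug k τ t = 0) :
    ∃ s ∈ cobarHom k (d + 1) τ σ, cobarD k n s = t ∧ aug k τ s = 0 := by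
  by_cases hd : d + 1 = 0
  · rw [cobarHom_neg k (by lia) ht]
    exact ⟨0, zero_mem _, map_zero _, map_zero _⟩
  · obtain ⟨s, hs, hs'⟩ := h d t ht hD ha
    exact ⟨s, hs, hs', aug_eq_zero k hd hs⟩

/-- The coordinates of the differential of a sum of products with generators. -/
theorem coord_cobarD_genSum {d : ℤ} {s : ∀ θ : PTree n, (θ ⟶ σ) → CobarAlg k n}
    (hs : ∀ θ (v : θ ⟶ σ) (e : ℤ), θ ≠ σ → (θ.deg : ℤ) - σ.deg + e = d + 1 →
      s θ v ∈ cobarHom k e τ θ) (v : θ ⟶ σ) (hne : θ ≠ σ) (hθ : Nonempty (τ ⟶ θ)) :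
    coord k v (cobarD k n (genSum k τ s)) = eps ((θ.deg : ℤ) - σ.deg) •
      (genSum k τ (fun ψ x => s ψ (x ≫ v)) - cobarD k n (s θ v)) := by
  rw [coord_cobarD k (genSum_mem k hs) v hne, coord_genSum k s v hne hθ]
  congr 2
  exact genSum_congr k fun ψ x _ hψ => coord_genSum k s _ (ne_of_comp x v hne) hψ

theorem cobarD_coord {d : ℤ} {t : CobarAlg k n} (ht : t ∈ cobarHom k d τ σ)
    (hD : cobarD k n t = 0) (v : θ ⟶ σ) (hne : θ ≠ σ) :
    cobarD k n (coord k v t) = genSum k τ (fun _ x => coord k (x ≫ v) t) := by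
  have h := coord_cobarD k ht v hne
  rw [hD, map_zero] at h
  have h1 := congrArg (fun x => eps ((θ.deg : ℤ) - σ.deg) • x) h
  simp only [smul_smul, eps_mul_self, one_smul, smul_zero] at h1
  exact (sub_eq_zero.1 h1.symm).symm

/-- A cycle is a boundary if its coordinates are in the kernel of the augmentation. -/
theorem exists_cobarD_eq_of_coord
    (ih : ∀ θ : PTree n, θ ≠ σ → Nonempty (θ ⟶ σ) → Nonempty (τ ⟶ θ) → Acyclic k τ θ)
    (hne : τ ≠ σ) {d : ℤ} (m : ℕ) {t : CobarAlg k n} (ht : t ∈ cobarHom k d τ σ)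
    (hD : cobarD k n t = 0)
    (ha : ∀ θ (v : θ ⟶ σ), θ ≠ σ → Nonempty (τ ⟶ θ) → aug k τ (coord k v t) = 0)
    (hm : ∀ θ (v : θ ⟶ σ), θ ≠ σ → Nonempty (τ ⟶ θ) → σ.deg + m < θ.deg → coord k v t = 0) :
    ∃ s ∈ cobarHom k (d + 1) τ σ, cobarD k n s = t := by
  induction m generalizing t with
  | zero =>
    refine ⟨0, zero_mem _, ?_⟩
    rw [map_zero, ← genSum_coord k hne ht]
    exact (genSum_eq_zero k fun θ v h hθ => hm θ v h hθ (deg_lt v h)).symm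
  | succ m ihm =>
    -- Treat the coordinates of the largest possible degree. The boundary of such a coordinate
    -- involves only deeper ones, which vanish, so it is a cycle in the kernel of the augmentation,
    -- and induction on the source of `v` supplies a primitive `z` with zero augmentation.
    have hz : ∀ θ (v : θ ⟶ σ), ∃ z : CobarAlg k n,
        (∀ e : ℤ, θ ≠ σ → (θ.deg : ℤ) - σ.deg + e = d + 1 + 1 → z ∈ cobarHom k e τ θ) ∧
        aug k τ z = 0 ∧
        (θ.deg = σ.deg + m + 1 → Nonempty (τ ⟶ θ) → cobarD k n z = coord k v t) ∧
        (θ.deg ≠ σ.deg + m + 1 → z = 0) := by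
      intro θ v
      by_cases h : θ.deg = σ.deg + m + 1 ∧ Nonempty (τ ⟶ θ)
      · have hne' : θ ≠ σ := by
          rintro rfl
          omega
        obtain ⟨z, hz, hz', hz''⟩ := (ih θ hne' ⟨v⟩ h.2).exists_aug_eq_zero (d := d - m)
          (coord_mem k v (by lia) ht) (by
            rw [cobarD_coord ht hD v hne']
            refine genSum_eq_zero k fun ψ x hx hψ => hm ψ _ (ne_of_comp x v hne') hψ ?_
            have := deg_lt x hx
            omega) (ha θ v hne' h.2)
        refine ⟨z, fun e _ he => ?_, hz'', fun _ _ => hz', fun h1 => absurd h.1 h1⟩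
        obtain rfl : e = d - m + 1 := by lia
        exact hz
      · exact ⟨0, fun _ _ _ => zero_mem _, map_zero _, fun h1 h2 => absurd ⟨h1, h2⟩ h,
          fun _ => rfl⟩
    choose z hz hza hzD hz0 using hz
    have hy : genSum k τ z ∈ cobarHom k (d + 1) τ σ := genSum_mem k hz
    have hyD : cobarD k n (genSum k τ z) ∈ cobarHom k d τ σ := by
      have := cobarD_mem k hy
      rwa [add_sub_cancel_right] at this
    -- Adding this boundary cancels the top coordinates, the sign being the one of
    -- `coord_cobarD_genSum` in degree `m + 1`. The other coordinates stay in the kernel of the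
    -- augmentation because the `z` do and the augmentation kills boundaries.
    obtain ⟨s, hs, hs'⟩ := ihm
      (t := t + eps ((m : ℤ) + 1) • cobarD k n (genSum k τ z))
      (add_mem ht (zsmul_mem hyD _))
      (by rw [map_add, map_zsmul, cobarD_cobarD k hy, hD, smul_zero, add_zero])
      (by
        intro θ v hne' hθ
        rw [map_add, map_zsmul, coord_cobarD_genSum hz v hne' hθ, map_add, ha θ v hne' hθ,
          map_zsmul, map_zsmul, map_sub, aug_genSum_eq_zero k (s := fun ψ x => z ψ (x ≫ v)) (fun _ => hza _ _),
          aug_cobarD k (hz θ v (d + 1 + 1 - ((θ.deg : ℤ) - σ.deg)) hne' (by lia))]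
        simp)
      (by
        intro θ v hne' hθ hlt
        rw [map_add, map_zsmul, coord_cobarD_genSum hz v hne' hθ, genSum_eq_zero k
          (fun ψ x hx _ => hz0 ψ _ (by have := deg_lt x hx; omega)), zero_sub]
        by_cases h : θ.deg = σ.deg + m + 1
        · rw [hzD θ v h hθ, show (θ.deg : ℤ) - σ.deg = m + 1 by lia, smul_smul, eps_mul_self,
            one_smul, add_neg_cancel]
        · rw [hz0 θ v h, hm θ v hne' hθ (by omega)]
          simp)
    refine ⟨s - eps ((m : ℤ) + 1) • genSum k τ z, sub_mem hs (zsmul_mem hy _), ?_⟩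
    rw [map_sub, map_zsmul, hs', add_sub_cancel_right]

/-- A two-step spectral sequence argument done by hand: exactness of the Koszul complexes corrects
the classes of the coordinates to zero, and then `exists_cobarD_eq_of_coord` applies. -/
theorem exists_cobarD_eq_of_ne
    (ih : ∀ θ : PTree n, θ ≠ σ → Nonempty (θ ⟶ σ) → Nonempty (τ ⟶ θ) → Acyclic k τ θ)
    (hne : τ ≠ σ) (d : ℕ) {t : CobarAlg k n} (ht : t ∈ cobarHom k d τ σ)
    (hD : cobarD k n t = 0) (ha : aug k τ t = 0) :
    ∃ s ∈ cobarHom k (d + 1) τ σ, cobarD k n s = t := by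
  -- The class of `t` on the first page, one function for each `u`. For degree reasons it lives on
  -- factorizations whose second factor has degree `d + 1`.
  let a : ∀ u : τ ⟶ σ, Fact u → k := fun u f => aug k τ (coord k f.v t) ⟨f.mid, f.w⟩
  have ha1 : ∀ u f, a u f ≠ 0 → f.mid.deg = σ.deg + d + 1 := by
    intro u f hf
    by_contra h
    refine hf ?_
    have h1 := aug_eq_zero k (d := d + 1 - ((f.mid.deg : ℤ) - σ.deg)) (by lia)
      (coord_mem k f.v (by lia) ht)
    exact congrFun (congrArg DFunLike.coe h1) _
  have ha2 : ∀ u, koszulDiff k u (a u) = 0 := by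
    intro u
    funext f
    have h1 : koszulDiff k u (a u) f =
        aug k τ (genSum k τ fun _ x => coord k (x ≫ f.v) t) ⟨f.mid, f.w⟩ :=
      (aug_genSum k (fun _ x => coord k (x ≫ f.v) t) f.w).symm
    rw [h1]
    obtain ⟨θ, w, v, h⟩ := f
    dsimp only
    -- At the factorization with identity second factor, the Koszul differential computes the
    -- augmentation of `t`, zero by hypothesis. Elsewhere it is the augmentation of a boundary,
    -- since `t` is a cycle.
    by_cases hθ : θ = σ
    · subst hθ
      obtain rfl := end_eq_id v
      simp only [Category.comp_id]
      rw [genSum_coord k hne ht, ha]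
      rfl
    · rw [← cobarD_coord ht hD v hθ, aug_cobarD k
        (coord_mem k v (e := d + 1 - ((θ.deg : ℤ) - σ.deg)) (by lia) ht)]
      rfl
  choose b hb hb1 using fun u => koszulDiff_exact_graded hne (ha1 u) (ha2 u)
  have hbu : ∀ (u : τ ⟶ σ) (θ : PTree n) (w : τ ⟶ θ) (v : θ ⟶ σ) (h : w ≫ v = u),
      b (w ≫ v) ⟨θ, w, v, rfl⟩ = b u ⟨θ, w, v, h⟩ := by
    rintro _ θ w v rfl
    rfl
  have hs : ∀ θ (v : θ ⟶ σ), ∃ s : CobarAlg k n,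
      (∀ e : ℤ, θ ≠ σ → (θ.deg : ℤ) - σ.deg + e = (d : ℤ) + 1 + 1 → s ∈ cobarHom k e τ θ) ∧
      (∀ w : τ ⟶ θ, aug k τ s ⟨θ, w⟩ = b (w ≫ v) ⟨θ, w, v, rfl⟩) := by
    intro θ v
    -- Exactly here the coordinate has degree `0`, where every function on morphisms is an
    -- augmentation; in all other degrees `b` vanishes and `0` lifts it.
    by_cases h : θ.deg = σ.deg + d + 1 + 1
    · obtain ⟨s, hs, hs'⟩ := exists_aug_eq k fun w : τ ⟶ θ => b (w ≫ v) ⟨θ, w, v, rfl⟩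
      refine ⟨s, fun e _ he => ?_, hs'⟩
      obtain rfl : e = 0 := by lia
      exact hs
    · refine ⟨0, fun _ _ _ => zero_mem _, fun w => ?_⟩
      rw [map_zero, Finsupp.zero_apply]
      by_contra h1
      exact h (hb1 _ _ (Ne.symm h1))
  choose s hs hsb using hs
  have hy : genSum k τ s ∈ cobarHom k (d + 1) τ σ := genSum_mem k hs
  have hyD : cobarD k n (genSum k τ s) ∈ cobarHom k d τ σ := by
    have := cobarD_mem k hy
    rwa [add_sub_cancel_right] at this
  have ht' : t - eps ((d : ℤ) + 1) • cobarD k n (genSum k τ s) ∈ cobarHom k d τ σ :=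
    sub_mem ht (zsmul_mem hyD _)
  -- The bound `τ.deg` makes the vanishing condition vacuous, as no tree under `τ` has larger
  -- degree.
  obtain ⟨r, hr, hr'⟩ := exists_cobarD_eq_of_coord ih hne (d := d) τ.deg ht'
    (by rw [map_sub, map_zsmul, cobarD_cobarD k hy, hD, smul_zero, sub_zero])
    (by
      intro θ v hne' hθ
      refine Finsupp.ext fun p => ?_
      obtain ⟨ψ, w⟩ := p
      by_cases hψ : ψ = θ
      · subst hψ
        rw [map_sub, map_zsmul, coord_cobarD_genSum hs v hne' hθ, map_sub, map_zsmul, map_zsmul,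
          map_sub, aug_cobarD k (hs ψ v (d + 1 + 1 - ((ψ.deg : ℤ) - σ.deg)) hne' (by lia)),
          sub_zero, Finsupp.sub_apply, Finsupp.smul_apply, Finsupp.smul_apply, aug_genSum,
          Finsupp.zero_apply]
        have h1 : ∑ g : Fact w, sgn' k g.v * aug k τ (s g.mid (g.v ≫ v)) ⟨g.mid, g.w⟩ =
            koszulDiff k (w ≫ v) (b (w ≫ v)) ⟨ψ, w, v, rfl⟩ := by
          rw [koszulDiff_apply]
          refine Finset.sum_congr rfl fun g _ => ?_
          rw [hsb]
          congr 1
          exact hbu _ _ _ _ _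
        rw [h1, hb]
        change a (w ≫ v) ⟨ψ, w, v, rfl⟩ - _ = 0
        by_cases h2 : a (w ≫ v) ⟨ψ, w, v, rfl⟩ = 0
        · rw [h2, smul_zero, smul_zero, sub_zero]
        · have h3 := ha1 _ _ h2
          dsimp only at h3
          rw [show (ψ.deg : ℤ) - σ.deg = d + 1 by lia, smul_smul, eps_mul_self, one_smul,
            sub_self]
      · rw [Finsupp.zero_apply]
        exact aug_apply_of_ne k
          (coord_mem k v (e := d + 1 - ((θ.deg : ℤ) - σ.deg)) (by lia) ht') hψ w)
    (by
      rintro θ v - ⟨w⟩ h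
      have := deg_le w
      omega)
  refine ⟨r + eps ((d : ℤ) + 1) • genSum k τ s, add_mem hr (zsmul_mem hy _), ?_⟩
  rw [map_add, map_zsmul, hr', sub_add_cancel]

variable (k) in
/-- The augmentation of the cobar construction is acyclic. -/
theorem acyclic (τ σ : PTree n) : Acyclic k τ σ := by
  induction hm : τ.deg - σ.deg using Nat.strong_induction_on generalizing σ with
  | _ m ih =>
    intro d t ht hD ha
    rcases lt_or_ge d 0 with hd | hd
    · rw [cobarHom_neg k hd ht]
      exact ⟨0, zero_mem _, map_zero _⟩
    by_cases hne : τ = σ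
    · subst hne
      obtain ⟨c, rfl⟩ := cobarHom_self k ht
      rw [map_smul, aug_one, Finsupp.smul_single, smul_eq_mul, mul_one,
        Finsupp.single_eq_zero] at ha
      rw [ha, zero_smul]
      exact ⟨0, zero_mem _, map_zero _⟩
    · obtain ⟨d, rfl⟩ := Int.eq_ofNat_of_zero_le hd
      refine exists_cobarD_eq_of_ne ?_ hne d ht hD ha
      rintro θ h ⟨v⟩ ⟨w⟩
      refine ih (τ.deg - θ.deg) ?_ θ rfl
      have h1 := deg_lt v h
      have h2 := deg_le w
      omega

end Acyclic

end

/-! ### The augmentation as a dg-functor, its homology, and minimality. -/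

noncomputable section

open PTree

/-- A criterion for quasi-isomorphisms to a complex concentrated in degree `0`. -/
theorem quasiIso_of_concentrated {k : Type u} [CommRing k] {C D : ChainComplex (ModuleCat.{u} k) ℤ}
    (f : C ⟶ D) (hC : ∀ i : ℤ, i < 0 → ∀ x : C.X i, x = 0) (hD : ∀ i j, D.d i j = 0)
    (hD' : ∀ i : ℤ, i ≠ 0 → ∀ x : D.X i, x = 0) (hs : Function.Surjective (f.f 0).hom)
    (he : ∀ (i : ℤ) (x : C.X i), (C.d i (i - 1)).hom x = 0 → (f.f i).hom x = 0 →
      ∃ y : C.X (i + 1), (C.d (i + 1) i).hom y = x) : QuasiIso f := by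
  rw [quasiIso_iff]
  intro i
  have hp : (ComplexShape.down ℤ).prev i = i + 1 := by simp
  have hn : (ComplexShape.down ℤ).next i = i - 1 := by simp
  by_cases hi : i = 0
  · subst hi
    rw [quasiIsoAt_iff' f _ _ _ hp hn, ShortComplex.quasiIso_iff_of_zeros']
    rotate_left
    · ext x
      exact hC _ (by lia) _
    · exact hD _ _
    · exact hD _ _
    refine ⟨?_, (ModuleCat.epi_iff_surjective _).2 hs⟩
    rw [ShortComplex.moduleCat_exact_iff]
    intro x hx
    exact he 0 x (hC _ (by lia) _) hx
  · rw [quasiIsoAt_iff_exactAt', HomologicalComplex.exactAt_iff' _ _ _ _ hp hn,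
      ShortComplex.moduleCat_exact_iff]
    · intro x hx
      exact he i x hx (hD' i hi _)
    · rw [HomologicalComplex.exactAt_iff' _ _ _ _ hp hn, ShortComplex.moduleCat_exact_iff]
      intro x hx
      exact ⟨0, (map_zero _).trans (hD' i hi x).symm⟩

section Aug

variable (k : Type u) [CommRing k] {n : ℕ} {τ θ σ : PTree n}

/-- The morphisms `τ ⟶ σ` in the total set of morphisms with source `τ`. -/
def toUnder (i : ℤ) (τ σ : PTree n) (u : {_u : τ ⟶ σ // i = 0}) : Σ σ : PTree n, τ ⟶ σ :=
  ⟨σ, u.1⟩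

theorem toUnder_injective (i : ℤ) (τ σ : PTree n) : Function.Injective (toUnder i τ σ) := by
  rintro ⟨u, hu⟩ ⟨v, hv⟩ h
  cases h
  rfl

/-- The components of the augmentation. -/
def augHom (i : ℤ) (τ σ : PTree n) : cobarHom k i τ σ →ₗ[k] ({_u : τ ⟶ σ // i = 0} →₀ k) :=
  Finsupp.lcomapDomain (toUnder i τ σ) (toUnder_injective i τ σ) ∘ₗ aug k τ ∘ₗ
    (cobarHom k i τ σ).subtype

/-- The components of the augmentation are determined by their values in the total module. -/
def embed (i : ℤ) (τ σ : PTree n) : ({_u : τ ⟶ σ // i = 0} →₀ k) →ₗ[k] Under k τ :=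
  Finsupp.lmapDomain k k (toUnder i τ σ)

theorem embed_injective (i : ℤ) (τ σ : PTree n) : Function.Injective (embed k i τ σ) :=
  Finsupp.mapDomain_injective (toUnder_injective i τ σ)

theorem embed_single (i : ℤ) (u : {_u : τ ⟶ σ // i = 0}) (c : k) :
    embed k i τ σ (Finsupp.single u c) = Finsupp.single ⟨σ, u.1⟩ c :=
  Finsupp.mapDomain_single

/-- The augmentation is concentrated in degree `0` and on the target `σ`, so restricting to the
component loses nothing. Identities between components can then be checked in the single module
`Under k τ`, free of degree conditions. -/
theorem embed_augHom (i : ℤ) (t : cobarHom k i τ σ) :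
    embed k i τ σ (augHom k i τ σ t) = aug k τ t := by
  refine Finsupp.mapDomain_comapDomain _ (toUnder_injective i τ σ) _ ?_
  rintro ⟨θ, u⟩ h
  rw [Finset.mem_coe, Finsupp.mem_support_iff] at h
  have hθ : θ = σ := by
    by_contra hθ
    exact h (aug_apply_of_ne k t.2 hθ u)
  have hi : i = 0 := by
    by_contra hi
    exact h (DFunLike.congr_fun (aug_eq_zero k hi t.2) _)
  subst hθ
  exact ⟨⟨u, hi⟩, rfl⟩

/-- Composition with a morphism on the source side. -/
def pre (w : τ ⟶ θ) : Under k θ →ₗ[k] Under k τ :=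
  Finsupp.lmapDomain k k fun p => ⟨p.1, w ≫ p.2⟩

theorem pre_single (w : τ ⟶ θ) (v : θ ⟶ σ) (c : k) :
    pre k w (Finsupp.single ⟨σ, v⟩ c) = Finsupp.single ⟨σ, w ≫ v⟩ c :=
  Finsupp.mapDomain_single

theorem post_pre {ψ : PTree n} (w : τ ⟶ θ) (v : ψ ⟶ σ) (c : Under k θ) :
    post k τ v (pre k w c) = pre k w (post k θ v c) := by
  induction c using Finsupp.induction_linear with
  | zero => simp only [map_zero]
  | add c c' h h' => simp only [map_add, h, h']
  | single p c =>
    obtain ⟨ψ', x⟩ := p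
    rw [pre_single]
    by_cases h : ψ' = ψ
    · subst h
      rw [post_single, post_single, pre_single, Category.assoc]
    · rw [post_single_of_ne k h, post_single_of_ne k h, map_zero]

/-- Generators act by composition on the target side, which commutes with composition on the source
side. This relates the actions for different sources and yields the compatibility of the
augmentation with composition. -/
theorem augRep_pre {d : ℤ} {t : CobarAlg k n} {ψ : PTree n} (ht : t ∈ cobarHom k d ψ σ)
    (w : τ ⟶ θ) (c : Under k θ) : augRep k τ t (pre k w c) = pre k w (augRep k θ t c) := by
  refine cobarHom_induction k (P := fun _ _ t =>
    augRep k τ t (pre k w c) = pre k w (augRep k θ t c)) ?_ ?_ ?_ ?_ ?_ ht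
  · intro d σ
    simp only [map_zero, LinearMap.zero_apply]
  · intro d σ s t hs ht
    simp only [map_add, LinearMap.add_apply, hs, ht]
  · intro d σ a t ht
    simp only [map_smul, LinearMap.smul_apply, ht]
  · simp only [map_one, Module.End.one_apply]
  · intro _ σ v i d s _ _ _ _ hs
    rw [map_mul, map_mul, Module.End.mul_apply, Module.End.mul_apply, hs, augRep_gen, augRep_gen,
      LinearMap.smul_apply, LinearMap.smul_apply, post_pre, map_smul]

theorem augHom_comp {i j l : ℤ} (h : i + j = l) (s : cobarHom k i θ σ) (t : cobarHom k j τ θ) :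
    augHom k l τ σ (freeComp _ h s t) = omegaComp k n h (augHom k i θ σ s) (augHom k j τ θ t) := by
  apply embed_injective k l τ σ
  rw [embed_augHom, freeComp_coe, aug_mul, ← embed_augHom]
  generalize augHom k j τ θ t = x
  induction x using Finsupp.induction_linear with
  | zero => simp only [map_zero]
  | add x y hx hy => simp only [map_add, hx, hy]
  | single w c =>
    have h1 : embed k j τ θ (Finsupp.single w c) =
        c • pre k w.1 (Finsupp.single ⟨θ, 𝟙 θ⟩ 1) := by
      rw [embed_single, pre_single, Category.comp_id, Finsupp.smul_single, smul_eq_mul, mul_one]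
    rw [h1, map_smul, augRep_pre k s.2, ← aug_apply, ← embed_augHom]
    generalize augHom k i θ σ s = y
    induction y using Finsupp.induction_linear with
    | zero => simp only [map_zero, LinearMap.zero_apply, smul_zero]
    | add x y hx hy => simp only [map_add, LinearMap.add_apply, smul_add, hx, hy]
    | single v a =>
      rw [omegaComp_single, embed_single, embed_single, pre_single, Finsupp.smul_single,
        smul_eq_mul, mul_comm]

theorem res_d_coe {i j : ℤ} (h : j + 1 = i) (t : cobarHom k i τ σ) :
    ((((res k n).Hom τ σ).d i j).hom t : cobarHom k j τ σ).1 = cobarD k n t.1 := by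
  have h1 := derHom_apply (internalD_deg (cobarGraph (koszulGraph k n))) τ σ h t
  have h2 := derHom_apply (cobarMap_deg (koszul k n)) τ σ h t
  -- The internal differential is zero on generators; additivity of `der` in that map forces the
  -- derivation it induces to vanish too.
  have h3 : der (internalD (cobarGraph (koszulGraph k n))) t.1 = 0 := by
    have h4 := der_add (internalD (cobarGraph (koszulGraph k n)))
      (internalD (cobarGraph (koszulGraph k n))) t.2
    rw [internalD_koszul, add_zero] at h4
    rw [internalD_koszul]
    exact left_eq_add.1 h4
  change ((derHom (internalD_deg (cobarGraph (koszulGraph k n))) τ σ i j).hom t :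
      cobarHom k j τ σ).1 + ((derHom (cobarMap_deg (koszul k n)) τ σ i j).hom t :
      cobarHom k j τ σ).1 = _
  rw [h1, h3, zero_add]
  exact h2

variable (n) in
/-- The augmentation of the cobar construction, as a morphism of dg-categories. -/
def augFunctor : DGFunctor (res k n) (omega k n) where
  map τ σ :=
    { f := fun i => ModuleCat.ofHom (augHom k i τ σ)
      comm' := fun i j hij => by
        have h : j + 1 = i := hij
        ext t
        change (0 : {_u : τ ⟶ σ // j = 0} →₀ k) =
          augHom k j τ σ ((((res k n).Hom τ σ).d i j).hom t)
        apply embed_injective k j τ σ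
        refine (map_zero _).trans (Eq.symm ((embed_augHom k j _).trans ?_))
        exact (congrArg (aug k τ) (res_d_coe k h t)).trans
          (aug_cobarD k (show cobarHom k i τ σ from t).2) }
  map_one τ := by
    apply embed_injective k 0 τ τ
    change embed k 0 τ τ (augHom k 0 τ τ ⟨1, one_mem_freeHom τ⟩) =
      embed k 0 τ τ (Finsupp.single ⟨𝟙 τ, rfl⟩ 1)
    rw [embed_augHom, embed_single, aug_one]
  map_comp h s t := augHom_comp k h s t

theorem augFunctor_resGen (u : τ ⟶ σ) (j : ℤ)
    (hj : (τ.deg : ℤ) - σ.deg = j + 1) :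
    (((augFunctor k n).map τ σ).f j).hom (resGen k u j hj) = augGen k u j := by
  apply embed_injective k j τ σ
  refine (embed_augHom k j (resGen k u j hj)).trans ?_
  have h1 : (resGen k u j hj : cobarHom k j τ σ).1 = cobarGen k u := by
    have h2 : ∀ (i : ℤ) (hi : (τ.deg : ℤ) - σ.deg = i) (h : i = j + 1),
        gen (cobarGraph (koszulGraph k n)) j τ σ (toCobar (koszulGraph k n) τ σ h
          (Finsupp.single ⟨u, hi⟩ 1 : {_u : τ ⟶ σ // (τ.deg : ℤ) - σ.deg = i} →₀ k)) =
          cobarGen k u := by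
      rintro i rfl h
      exact (redGen_incl (koszulGraph k n) h (koszulElt k u)).symm
    exact h2 _ hj rfl
  rw [h1, ← mul_one (cobarGen k u), aug_gen_mul, aug_one, post_single, Category.id_comp]
  by_cases h : j = 0
  · have h2 : augGen k u j =
        (Finsupp.single ⟨u, h⟩ (sgn u : k) : {_u : τ ⟶ σ // j = 0} →₀ k) := dif_pos h
    refine Eq.trans ?_ (congrArg (embed k j τ σ) h2).symm
    rw [embed_single, sgn', if_pos (by lia), Finsupp.smul_single, smul_eq_mul, mul_one]
  · have h2 : augGen k u j = (0 : {_u : τ ⟶ σ // j = 0} →₀ k) := dif_neg h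
    refine Eq.trans ?_ (congrArg (embed k j τ σ) h2).symm
    rw [map_zero, sgn', if_neg (by lia), zero_smul]

theorem augFunctor_isWeakEquivalence : (augFunctor k n).IsWeakEquivalence := by
  intro τ σ
  refine quasiIso_of_concentrated _ ?_ (fun _ _ => rfl) ?_ ?_ ?_
  · intro i hi t
    exact Subtype.ext (cobarHom_neg k hi (show cobarHom k i τ σ from t).2)
  · intro i hi x
    change {_u : τ ⟶ σ // i = 0} →₀ k at x
    exact Finsupp.ext fun u => absurd u.2 hi
  · intro c
    change {_u : τ ⟶ σ // (0 : ℤ) = 0} →₀ k at c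
    obtain ⟨s, hs, hs'⟩ := exists_aug_eq k fun u : τ ⟶ σ => c ⟨u, rfl⟩
    exact ⟨(⟨s, hs⟩ : cobarHom k 0 τ σ), Finsupp.ext fun u => hs' u.1⟩
  · intro i t hD ha
    change cobarHom k i τ σ at t
    have h1 : cobarD k n t.1 = 0 := by
      rw [← res_d_coe k (show i - 1 + 1 = i by lia), hD]
      rfl
    have h2 : aug k τ t.1 = 0 := by
      rw [← embed_augHom]
      exact (congrArg (embed k i τ σ) ha).trans (map_zero _)
    obtain ⟨s, hs, hs'⟩ := acyclic k τ σ i t.1 t.2 h1 h2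
    refine ⟨(⟨s, hs⟩ : cobarHom k (i + 1) τ σ), Subtype.ext ?_⟩
    exact (res_d_coe k rfl _).trans hs'

variable (n) in
-- The differential of a generator is a combination of products of exactly two generators.
-- Factorizations through an identity need not be excluded, since the generator of an identity is
-- zero.
theorem cobar_isMinimal :
    IsMinimal (cobarGraph (koszul k n).graph) (cobarTwist (koszul_isConnected k n)) := by
  refine ⟨fun τ σ i j => ?_, fun τ σ i j γ => ?_⟩
  · change - ((reduced (koszulGraph k n)) τ σ).d (i + 1) (j + 1) = 0
    rw [neg_eq_zero]
    ext x
    rfl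
  · by_cases h : j + 1 = i
    · have h0 := derHom_apply (cobarMap_deg (koszul k n)) τ σ h ⟨_, gen_mem γ⟩
      refine (congrArg (· ∈ decHom (cobarGraph (koszulGraph k n)) j τ σ) h0).mpr ?_
      change cobarD k n (gen (cobarGraph (koszulGraph k n)) i τ σ γ) ∈ _
      have h1 := gen_mem_span k i γ
      generalize gen (cobarGraph (koszulGraph k n)) i τ σ γ = g at h1 ⊢
      induction h1 using Submodule.span_induction with
      | zero => rw [map_zero]; exact zero_mem _
      | add s t _ _ hs ht => rw [map_add]; exact add_mem hs ht
      | smul c t _ ht => rw [map_smul]; exact Submodule.smul_mem _ _ ht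
      | mem t ht =>
        obtain ⟨v, -, hd, rfl⟩ := ht
        rw [cobarD_gen]
        refine Submodule.sum_mem _ fun f _ => ?_
        have hw : Word (cobarGraph (koszulGraph k n)) 2 j τ σ (cobarGen k f.v * cobarGen k f.w) := by
          have e1 : cobarGen k f.v = gen _ _ _ _ _ := redGen_incl (koszulGraph k n)
            (show (f.mid.deg : ℤ) - σ.deg = (f.mid.deg : ℤ) - σ.deg - 1 + 1 by lia)
            (koszulElt k f.v)
          have e2 : cobarGen k f.w = gen _ _ _ _ _ := redGen_incl (koszulGraph k n)
            (show (τ.deg : ℤ) - f.mid.deg = (τ.deg : ℤ) - f.mid.deg - 1 + 1 by lia)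
            (koszulElt k f.w)
          rw [e1, e2]
          exact Word.cons (by lia) _ (Word.single _)
        exact zsmul_mem (Submodule.subset_span
          (s := {w | ∃ m, 2 ≤ m ∧ Word (cobarGraph (koszulGraph k n)) m j τ σ w})
          ⟨2, le_rfl, hw⟩) _
    · have h0 : (cobarTwist (koszul_isConnected k n)).map τ σ i j = 0 :=
        (cobarTwist (koszul_isConnected k n)).shape τ σ i j h
      rw [h0]
      exact zero_mem _

end Aug

end

end PrunedTree

theorem mainTheorem5 (k : Type u) [CommRing k] (n : ℕ) :
    PrunedTree.IsQuasiFree (PrunedTree.res k n) ∧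
    (∃ ε : PrunedTree.DGFunctor (PrunedTree.res k n) (PrunedTree.omega k n),
      (∀ (τ σ : PrunedTree.PTree n) (u : τ ⟶ σ), τ ≠ σ →
        ∀ (j : ℤ) (hj : (τ.deg : ℤ) - σ.deg = j + 1),
          ((ε.map τ σ).f j).hom (PrunedTree.resGen k u j hj) = PrunedTree.augGen k u j) ∧
      ε.IsWeakEquivalence) ∧
    PrunedTree.IsMinimal (PrunedTree.cobarGraph (PrunedTree.koszul k n).graph)
      (PrunedTree.cobarTwist (PrunedTree.koszul_isConnected k n)) :=
  ⟨⟨_, _, rfl⟩, ⟨PrunedTree.augFunctor k n,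
    fun _ _ u _ j hj => PrunedTree.augFunctor_resGen k u j hj,
    PrunedTree.augFunctor_isWeakEquivalence k⟩, PrunedTree.cobar_isMinimal k n⟩
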